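/- Consider the ring of $N=6$ nodes with next-nearest-neighbour coupling ($m=2$), indices taken modulo $6$, and the steady-state system $$d\,(u_{n+2}+u_{n+1}+u_{n-1}+u_{n-2}-4u_n)+f(u_n,\mu)=0,\qquad 1\le n\le 6 .\tag{1}$$ Assume that $f:\mathbb{R}\times\mathbb{R}\to\mathbb{R}$ is $C^\infty$ and bistable, that is: (i) $f(-u,\mu)=-f(u,\mu)$; (ii) there are continuous functions $u_\pm$ on $[0,1]$ such that for each $\mu\in[0,1]$ the nonnegative zeros of $f(\cdot,\mu)$ are $0$, $u_-(\mu)$, $u_+(\mu)$, with $0<u_-(\mu)<u_+(\mu)$ for $\mu\in(0,1)$, and $f_u(0,\mu)<0$ for $\mu\in(0,1]$, $f_u(u_+(\mu),\mu)<0$ for $\mu\in[0,1)$, $f_u(u_-(\mu),\mu)>0$ for $\mu\in(0,1)$; (iii) at $\mu=0$ the zeros $0,\pm u_-$ (but not $u_+$) collide in a generic subcritical pitchfork: $u_-(0)=0<u_+(0)$, $f_u(0,0)=0$, $f_{u\mu}(0,0)<0<f_{uuu}(0,0)$; (iv) at $\mu=1$ the zeros $u_\pm$ collide in a generic saddle-node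 at $u=1$: $u_\pm(1)=1$, $f_u(1,1)=0$, $f_\mu(1,1)\ne0$, $f_{uu}(1,1)\neq0$. A state is $\kappa$-symmetric if $u_6=u_2$ and $u_5=u_3$; such a state is written $(u_1,u_2,u_3,u_4)$. For $\mu\in[0,1]$ put $\bar V^{(1)}=(u_-,0,0,0)$, $\bar U^{(1)}=(u_+,0,0,0)$, $\bar W^{(23)}=(u_+,u_-,u_-,0)$, $\bar U^{(3)}=(u_+,u_+,u_+,0)$, $\bar V^{(4)}=(u_+,u_+,u_+,u_-)$, where $u_\pm=u_\pm(\mu)$. Let $\Gamma_{6,2}\subset\mathbb{R}^6\times[0,1]$ be the union over $\mu\in[0,1]$ of the points $(P(\mu),\mu)$ for these five patterns $P$; it is an arc that runs through the patterns in the listed order, with endpoints $\mathcal E=\{(\bar V^{(1)}(0),0),(\bar V^{(4)}(1),1)\}$ and with corners exactly at $(\bar U^{(1)}(0),0)=(\bar W^{(23)}(0),0)$, $(\bar W^{(23)}(1),1)=(\bar U^{(3)}(1),1)$ and $(\bar U^{(3)}(0),0)=(\bar V^{(4)}(0),0)$. Let $\mathcal B_\delta(X)$ be the set of points at distance less than $\delta$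 from $X$. Then for each $\delta_*>0$ such that some point of $\Gamma_{6,2}$ has distance greater than $2\delta_*$ from $\mathcal E$ there exist $d_*>0$, a $C^1$ injective parametrization $g:[0,1]\to\mathbb{R}^6\times\mathbb{R}$ of an arc $A\subset\Gamma_{6,2}\setminus\mathcal B_{2\delta_*}(\mathcal E)$ whose derivative vanishes at most at the corners, and curves $\gamma_d:[0,1]\to\mathbb{R}^6\times[0,1]$, $0<d<d_*$, such that: (a) for each $0<d<d_*$, $\gamma_d$ is a smooth embedded arc (injective with nowhere vanishing derivative), it is contained in $\mathcal B_{\delta_*}(\Gamma_{6,2})\setminus\mathcal B_{2\delta_*}(\mathcal E)$, and it consists of $\kappa$-symmetric solutions $(U,\mu)$ of (1); (b) $\gamma_d(s)$ is smooth jointly in $(d,s)\in(0,d_*)\times[0,1]$; (c) $\gamma_d$ is $C^1$-close to $\Gamma_{6,2}$: $\gamma_d$ and $\gamma_d'$ are uniformly within $\delta_*$ of $g$ and $g'$ on $[0,1]$ for each $0<d<d_*$, and $\gamma_d\to g$ in $C^1([0,1])$ as $d\to0^+$; in particular the limit of the branch is contained in $\Gamma_{6,2}$. Moreover, there is $\delta_0>0$,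 depending only on $f$, such that for $\delta_*<\delta_0$ the arc $A$ is all of $\Gamma_{6,2}\setminus\mathcal B_{2\delta_*}(\mathcal E)$. -/

import Mathlib

open Set Filter Topology
open scoped ContDiff

noncomputable section

namespace RingLattice

/-! ### The lattice system on a ring of `N` nodes (indices are taken modulo `N`) -/

/-- States `U = (u_n)` on a ring with `N` nodes, with the Euclidean norm. -/
abbrev Config (N : ℕ) : Type := EuclideanSpace ℝ (ZMod N)

/-- The space `ℝ^N × ℝ` of pairs `(U, μ)`, with the Euclidean norm. -/
abbrev Point (N : ℕ) : Type := WithLp 2 (Config N × ℝ)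

/-- The pair `(U, μ)`. -/
def mkPoint {N : ℕ} (U : Config N) (μ : ℝ) : Point N := WithLp.toLp 2 (U, μ)

/-- The coupling operator `Δ_m` on the ring; `m = ⌊N/2⌋` is all-to-all coupling. -/
def coupling {N : ℕ} [NeZero N] (m : ℕ) (U : Config N) (n : ZMod N) : ℝ :=
  if m < N / 2 then
    -(2 * (m : ℝ) + 1) * U n + ∑ j ∈ Finset.Icc (-(m : ℤ)) (m : ℤ), U (n + (j : ZMod N))
  else
    -(N : ℝ) * U n + ∑ j : ZMod N, U j

/-- The right-hand side `𝓕(U, μ, d)_n = d (Δ_m U)_n + f(u_n, μ)`. -/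
def rhs {N : ℕ} [NeZero N] (f : ℝ → ℝ → ℝ) (m : ℕ) (U : Config N) (μ d : ℝ) (n : ZMod N) : ℝ :=
  d * coupling m U n + f (U n) μ

/-- `(U, μ)` solves the steady-state system `𝓕(U, μ, d) = 0`. -/
def IsSteadyState {N : ℕ} [NeZero N] (f : ℝ → ℝ → ℝ) (m : ℕ) (d : ℝ) (p : Point N) : Prop :=
  ∀ n : ZMod N, rhs f m p.fst p.snd d n = 0

/-- Invariance under the flip `κ (u_1, u_2, …, u_N) = (u_1, u_N, …, u_2)`, which sends
node `n` to node `2 - n`. -/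
def IsFlipSymmetric {N : ℕ} (U : Config N) : Prop := ∀ n : ZMod N, U (2 - n) = U n

/-! ### The bistable nonlinearity -/

/-- The hypothesis on the nonlinearity `f(u, μ)`, with root curves `u_- = uM` and `u_+ = uP`. -/
structure IsBistable (f : ℝ → ℝ → ℝ) (uM uP : ℝ → ℝ) : Prop where
  smooth : ContDiff ℝ ∞ (fun p : ℝ × ℝ => f p.1 p.2)
  odd : ∀ u μ, f (-u) μ = -f u μ
  /-- The nonnegative roots are `0`, `u_-(μ)` and `u_+(μ)`. -/
  roots : ∀ μ ∈ Icc (0 : ℝ) 1, ∀ u, 0 ≤ u → (f u μ = 0 ↔ u = 0 ∨ u = uM μ ∨ u = uP μ)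
  order : ∀ μ ∈ Ioo (0 : ℝ) 1, 0 < uM μ ∧ uM μ < uP μ
  continuousOn_uM : ContinuousOn uM (Icc 0 1)
  continuousOn_uP : ContinuousOn uP (Icc 0 1)
  /-- Linear stability of the roots, away from the bifurcations in which they take part. -/
  stable_zero : ∀ μ ∈ Ioc (0 : ℝ) 1, deriv (fun u => f u μ) 0 < 0
  stable_uP : ∀ μ ∈ Ico (0 : ℝ) 1, deriv (fun u => f u μ) (uP μ) < 0
  unstable_uM : ∀ μ ∈ Ioo (0 : ℝ) 1, 0 < deriv (fun u => f u μ) (uM μ)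
  /-- At `μ = 0` the roots `0`, `± u_-` (but not `u_+`) collide in a generic subcritical
  pitchfork bifurcation. -/
  uM_zero : uM 0 = 0
  uP_zero : 0 < uP 0
  pitchfork_u : deriv (fun u => f u 0) 0 = 0
  pitchfork_uμ : deriv (fun μ => deriv (fun u => f u μ) 0) 0 < 0
  pitchfork_uuu : 0 < iteratedDeriv 3 (fun u => f u 0) 0
  /-- At `μ = 1` the roots `u_±` collide in a generic saddle-node bifurcation at `u = 1`. -/
  uM_one : uM 1 = 1
  uP_one : uP 1 = 1
  saddleNode_u : deriv (fun u => f u 1) 1 = 0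
  saddleNode_μ : deriv (fun μ => f 1 μ) 1 ≠ 0
  saddleNode_uu : iteratedDeriv 2 (fun u => f u 1) 1 ≠ 0

/-! ### Patterns at `d = 0` -/

/-- The representative in `{1, …, ⌊N/2⌋ + 1}` of node `n` under the flip `n ↦ 2 - n`. -/
def flipIndex {N : ℕ} (n : ZMod N) : ℕ := 1 + min (n - 1).val (1 - n).val

/-- The flip-symmetric state whose entries at the nodes `1, …, ⌊N/2⌋ + 1` are given by `w`. -/
def symmExtend (N : ℕ) (w : ℕ → ℝ) : Config N := WithLp.toLp 2 fun n => w (flipIndex n)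

/-- The pattern `Ū^(k)(μ)`. -/
def barU (N : ℕ) (uP : ℝ → ℝ) (k : ℕ) (μ : ℝ) : Config N :=
  symmExtend N fun n => if n ≤ k then uP μ else 0

/-- The pattern `V̄^(k)(μ)`. -/
def barV (N : ℕ) (uM uP : ℝ → ℝ) (k : ℕ) (μ : ℝ) : Config N :=
  symmExtend N fun n => if n < k then uP μ else if n = k then uM μ else 0

/-- The pattern `W̄^(23)(μ)` on the ring with six nodes. -/
def barW23 (uM uP : ℝ → ℝ) (μ : ℝ) : Config 6 :=
  symmExtend 6 fun n => if n = 1 then uP μ else if n = 2 ∨ n = 3 then uM μ else 0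

/-- The curve `Γ_{6,2}`. -/
def Gamma62 (uM uP : ℝ → ℝ) : Set (Point 6) :=
  ⋃ μ ∈ Icc (0 : ℝ) 1,
    {mkPoint (barV 6 uM uP 1 μ) μ, mkPoint (barU 6 uP 1 μ) μ, mkPoint (barW23 uM uP μ) μ,
      mkPoint (barU 6 uP 3 μ) μ, mkPoint (barV 6 uM uP 4 μ) μ}

/-- The exceptional set `𝓔`: the two endpoints of `Γ_{6,2}`. -/
def exceptional (uM uP : ℝ → ℝ) : Set (Point 6) :=
  {mkPoint (barV 6 uM uP 1 0) 0, mkPoint (barV 6 uM uP 4 1) 1}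

/-- The three corners of `Γ_{6,2}`, at which the one-sided tangent lines differ:
`Ū^(1)(0) = W̄^(23)(0)`, `W̄^(23)(1) = Ū^(3)(1)` and `Ū^(3)(0) = V̄^(4)(0)`. -/
def corners62 (uP : ℝ → ℝ) : Set (Point 6) :=
  {mkPoint (barU 6 uP 1 0) 0, mkPoint (barU 6 uP 3 1) 1, mkPoint (barU 6 uP 3 0) 0}

/-! ### Curves parametrized by `[0, 1]` -/

section Curves

variable {X : Type*} [NormedAddCommGroup X] [NormedSpace ℝ X]

/-- `g` is an injective `C^1` parametrization by `[0, 1]` of the set `A`, whose derivative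
can vanish only at points of `C`. -/
structure IsArcParam (g : ℝ → X) (A C : Set X) : Prop where
  contDiffOn : ContDiffOn ℝ 1 g (Icc 0 1)
  injOn : InjOn g (Icc 0 1)
  image_eq : g '' Icc 0 1 = A
  regular : ∀ s ∈ Icc (0 : ℝ) 1, g s ∉ C → derivWithin g (Icc 0 1) s ≠ 0

/-- `c` is a smooth embedding of `[0, 1]`. -/
structure IsSmoothArc (c : ℝ → X) : Prop where
  contDiffOn : ContDiffOn ℝ ∞ c (Icc 0 1)
  injOn : InjOn c (Icc 0 1)
  regular : ∀ s ∈ Icc (0 : ℝ) 1, derivWithin c (Icc 0 1) s ≠ 0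

/-- On `[0, 1]` the curves `c` and `g` are `ε`-close together with their first derivatives. -/
def IsC1Close (ε : ℝ) (c g : ℝ → X) : Prop :=
  ∀ s ∈ Icc (0 : ℝ) 1, ‖c s - g s‖ < ε ∧
    ‖derivWithin c (Icc 0 1) s - derivWithin g (Icc 0 1) s‖ < ε

end Curves

end RingLattice

end

/-! All five patterns have u₂ = u₃, so solutions are sought among κ-symmetric states with u₂ = u₃.
With a = u₁, b = u₂, c = u₄ the system becomes 4d(b - a) + f(a, μ) = 0, d(a + c - 2b) + f(b, μ) = 0,
4d(b - c) + f(c, μ) = 0. At d = 0 these equations decouple and Γ solves them. Away from the three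
corners the kernel of the linearization in (a, b, c, μ) is spanned by the velocity of Γ, even at the
first fold, where only a is at a saddle-node. There the implicit function theorem suffices.

At the corners the weak coupling decides how the branch turns. At the first and third one component
sits at the pitchfork and its neighbours act on it as a source dκ with κ > 0. In the region μ ≥ 0, u
+ μ ≥ 0 the solutions of dκ + f(u, μ) = 0 follow u = 0 and then u = u_-, and u - μ is a coordinate
along them. At the second corner a and b are both near the saddle-node. Since c is near 0, b feels a
sink of size about d; this keeps b below a and a strictly stable, while b passes through the fold
and serves as coordinate. The quantitative form is ‖y‖ ≤ C |ℓ·y| for every tangent y, with ℓ a fixed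
direction and C independent of d: `corner_one`, `corner_two`, `corner_three`.

Γ is parametrized smoothly over [0, 4] by `curve`, which comes to rest to infinite order at the
corners. This rests on `exists_profile`: putting μ = (1 - σ²)² makes the arc of roots smooth in σ
across both the pitchfork and the fold. The point x(s, d) of the branch is selected by v(s)·(x -
Γ(s)) = d s, with v transversal to Γ and constant near each corner. `exists_branch_of_constraint`
gives existence and uniqueness: inside a closed sector that discards the unwanted roots, solutions
are close to Γ by compactness and nondegenerate for d > 0, and a connectedness argument carries the
unique solution from a regular starting time across the corners.

Near a corner, differentiating the selecting condition gives ℓ·x' = ℓ·Γ' + d. The summand d keeps x'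
nonzero where Γ' vanishes, and together with ‖x'‖ ≤ C |ℓ·x'| it forces x' → 0 = Γ' at the corner.
Hence the convergence is C¹, and the arcs are regular and injective (`eventually_velocity`,
`eventually_dot_pos`, `eventually_injOn`).

For small δ the distance to each endpoint of Γ is monotone near that endpoint, so the part of Γ at
distance at least 2δ is one arc. The branch deviates from Γ by O(d) at its ends, and shrinking the
parameter interval by Kd at both ends keeps it outside the balls. For larger δ a short arc around
one far point is enough. -/

noncomputable section

namespace RingLattice

/-! ### Hadamard's lemma, implicit functions and the smooth transition function -/

section Calculus

/-- Integrating a `C^n` function of two variables over `[0, 1]` in the second one gives a `C^n`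
function of the first one. -/
theorem contDiff_integral_unitInterval {E : Type} [NormedAddCommGroup E] [NormedSpace ℝ E]
    [ProperSpace E] (n : ℕ) :
    ∀ {G : Type} [NormedAddCommGroup G] [NormedSpace ℝ G] {φ : E × ℝ → G}, ContDiff ℝ n φ →
      ContDiff ℝ n (fun z => ∫ t in (0 : ℝ)..1, φ (z, t)) := by
  -- The target space is quantified inside the induction, because the derivative takes values in a
  -- space of operators.
  induction n with
  | zero =>
    intro G _ _ φ hφ
    have hc : Continuous φ := hφ.continuous
    exact contDiff_zero.2
      (intervalIntegral.continuous_parametric_intervalIntegral_of_continuous' (by exact hc) 0 1)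
  | succ n ih =>
    intro G _ _ φ hφ
    have hφ1 : ContDiff ℝ 1 φ := hφ.of_le (by exact_mod_cast Nat.le_add_left 1 n)
    have hdiff : Differentiable ℝ φ := hφ1.differentiable one_ne_zero
    let ψ : E × ℝ → E →L[ℝ] G := fun p => (fderiv ℝ φ p).comp (ContinuousLinearMap.inl ℝ E ℝ)
    have hψ : ContDiff ℝ n ψ :=
      (hφ.fderiv_right (m := n) (by push_cast; exact le_rfl)).clm_comp contDiff_const
    have hψc : Continuous ψ := hψ.continuous
    have hφc : Continuous φ := hφ.continuous
    push_cast
    refine contDiff_succ_iff_hasFDerivAt.2 ⟨fun z => ∫ t in (0 : ℝ)..1, ψ (z, t), ih hψ, ?_⟩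
    intro z
    -- The derivative is bounded on a compact neighbourhood, which supplies the constant dominating
    -- function.
    obtain ⟨B, hB⟩ := ((isCompact_closedBall z 1).prod
        (isCompact_Icc (a := (0 : ℝ)) (b := 1))).exists_bound_of_continuousOn
      hψc.continuousOn
    refine intervalIntegral.hasFDerivAt_integral_of_dominated_of_fderiv_le
      (F := fun z t => φ (z, t)) (F' := fun z t => ψ (z, t)) (bound := fun _ => B)
      (Metric.ball_mem_nhds z one_pos) ?_ ?_ ?_ ?_ ?_ ?_
    · exact Eventually.of_forall fun y =>
        (show Continuous fun t => φ (y, t) by fun_prop).aestronglyMeasurable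
    · exact (show Continuous fun t => φ (z, t) by fun_prop).intervalIntegrable _ _
    · exact (show Continuous fun t => ψ (z, t) by fun_prop).aestronglyMeasurable
    · refine Eventually.of_forall fun t ht y hy => hB (y, t) ⟨Metric.ball_subset_closedBall hy, ?_⟩
      rw [uIoc_of_le zero_le_one] at ht
      exact ⟨ht.1.le, ht.2⟩
    · exact intervalIntegrable_const
    · refine Eventually.of_forall fun t _ y _ => ?_
      exact (hdiff (y, t)).hasFDerivAt.comp y (hasFDerivAt_prodMk_left y t)

/-- Hadamard's lemma: a smooth function that vanishes on `x = 0` is `x` times a smooth function. -/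
theorem exists_contDiff_eq_mul {E : Type} [NormedAddCommGroup E] [NormedSpace ℝ E]
    [ProperSpace E] {φ : ℝ × E → ℝ} (hφ : ContDiff ℝ ∞ φ) (h0 : ∀ y, φ (0, y) = 0) :
    ∃ q : ℝ × E → ℝ, ContDiff ℝ ∞ q ∧ ∀ x y, φ (x, y) = x * q (x, y) := by
  -- φ(x, y) is the integral over t in [0, 1] of the derivative of φ(t x, y), and this derivative is
  -- x ψ.
  let ψ : (ℝ × E) × ℝ → ℝ := fun p => fderiv ℝ φ (p.2 * p.1.1, p.1.2) (1, 0)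
  have hψ : ContDiff ℝ ∞ ψ := by
    have h1 : ContDiff ℝ ∞ (fderiv ℝ φ) := hφ.fderiv_right (by simp)
    have h2 : ContDiff ℝ ∞ fun p : (ℝ × E) × ℝ => ((p.2 * p.1.1, p.1.2) : ℝ × E) := by fun_prop
    exact (h1.comp h2).clm_apply contDiff_const
  refine ⟨fun p => ∫ t in (0 : ℝ)..1, ψ (p, t), contDiff_infty.2 fun n =>
    contDiff_integral_unitInterval n (hψ.of_le (by exact_mod_cast le_top)), fun x y => ?_⟩
  have hd : ∀ t : ℝ, HasDerivAt (fun t => φ (t * x, y)) (x * ψ ((x, y), t)) t := by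
    intro t
    have h1 : HasDerivAt (fun t : ℝ => ((t * x, y) : ℝ × E)) (x, 0) t := by
      simpa using ((hasDerivAt_id t).mul_const x).prodMk (hasDerivAt_const t y)
    have h2 := ((hφ.differentiable (by simp)) (t * x, y)).hasFDerivAt.comp_hasDerivAt t h1
    refine h2.congr_deriv ?_
    have : ((x, 0) : ℝ × E) = x • (1, 0) := by simp
    rw [this, map_smul]; rfl
  have hc : Continuous fun t => x * ψ ((x, y), t) := by
    have := hψ.continuous
    fun_prop
  have h := intervalIntegral.integral_eq_sub_of_hasDerivAt (a := 0) (b := 1)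
    (fun t _ => hd t) (hc.intervalIntegrable _ _)
  rw [intervalIntegral.integral_const_mul] at h
  simpa [h0] using h.symm

/-- The derivative of `s ↦ F (α s, β s)` for a function `F` of two real variables. -/
theorem hasDerivAt_comp_two {F : ℝ × ℝ → ℝ} (hF : Differentiable ℝ F) {α β : ℝ → ℝ}
    {α' β' s : ℝ} (hα : HasDerivAt α α' s) (hβ : HasDerivAt β β' s) :
    HasDerivAt (fun s => F (α s, β s))
      (fderiv ℝ F (α s, β s) (1, 0) * α' + fderiv ℝ F (α s, β s) (0, 1) * β') s := by
  have h := (hF (α s, β s)).hasFDerivAt.comp_hasDerivAt s (hα.prodMk hβ)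
  refine h.congr_deriv ?_
  have : ((α', β') : ℝ × ℝ) = α' • (1, 0) + β' • (0, 1) := by simp
  rw [this, map_add, map_smul, map_smul]
  simp [mul_comm]

/-- The implicit function theorem for a map whose partial derivative is injective. -/
theorem exists_implicit_function {P X : Type*} [NormedAddCommGroup P] [NormedSpace ℝ P]
    [CompleteSpace P] [NormedAddCommGroup X] [NormedSpace ℝ X] [FiniteDimensional ℝ X]
    {H : P × X → X} {u : P × X} (hH : ContDiffAt ℝ ∞ H u) (hu : H u = 0)
    (hinj : ∀ y, fderiv ℝ H u (0, y) = 0 → y = 0) :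
    ∃ φ : P → X, ContDiffAt ℝ ∞ φ u.1 ∧ φ u.1 = u.2 ∧ ∀ᶠ v in 𝓝 u, H v = 0 ↔ φ v.1 = v.2 := by
  have := FiniteDimensional.complete ℝ X
  have hinv : (fderiv ℝ H u ∘L .inr ℝ P X).IsInvertible := by
    have hi : Function.Injective ((fderiv ℝ H u ∘L .inr ℝ P X : X →L[ℝ] X) : X →ₗ[ℝ] X) := by
      refine (injective_iff_map_eq_zero _).2 fun y hy => hinj y ?_
      simpa using hy
    refine ⟨(LinearEquiv.ofInjectiveEndo _ hi).toContinuousLinearEquiv, ?_⟩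
    ext y
    rfl
  have hn : (∞ : WithTop ℕ∞) ≠ 0 := by simp
  refine ⟨hH.implicitFunction hn hinv, hH.contDiffAt_implicitFunction hn hinv,
    hH.implicitFunction_apply_self hn hinv, ?_⟩
  simpa [hu] using hH.eventually_apply_eq_iff_implicitFunction hn hinv

/-- Injectivity of the partial derivative is an open condition. -/
theorem eventually_injective_fderiv {P X : Type*} [NormedAddCommGroup P] [NormedSpace ℝ P]
    [NormedAddCommGroup X] [NormedSpace ℝ X] [FiniteDimensional ℝ X]
    {H : P × X → X} {u : P × X} (hH : ContDiff ℝ ∞ H)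
    (hinj : ∀ y, fderiv ℝ H u (0, y) = 0 → y = 0) :
    ∀ᶠ v in 𝓝 u, ∀ y, fderiv ℝ H v (0, y) = 0 → y = 0 := by
  let A : P × X → X →L[ℝ] X := fun v => fderiv ℝ H v ∘L .inr ℝ P X
  have hA : Continuous A :=
    ((hH.fderiv_right (m := 0) (by simp)).clm_comp contDiff_const).continuous
  have hi : Function.Injective (A u) :=
    (injective_iff_map_eq_zero _).2 fun y hy => hinj y (by simpa [A] using hy)
  -- In finite dimension an injective map satisfies ‖y‖ ≤ K ‖A y‖, so a perturbation of norm below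
  -- 1/K creates no kernel.
  obtain ⟨K, hK, hanti⟩ := (A u).toLinearMap.exists_antilipschitzWith (LinearMap.ker_eq_bot.2 hi)
  have hopen := hA.continuousAt (x := u) |>.eventually
    (Metric.ball_mem_nhds (A u) (ε := (K : ℝ)⁻¹) (by positivity))
  filter_upwards [hopen] with v hv y hy
  have h1 : ‖y‖ ≤ K * ‖A u y‖ := by
    simpa using hanti.le_mul_dist y 0
  have h2 : A v y = 0 := by simpa [A] using hy
  have h3 : ‖A u y‖ ≤ ‖A v - A u‖ * ‖y‖ := by
    have := (A v - A u).le_opNorm y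
    simpa [h2] using this
  by_contra hne
  have hy0 : 0 < ‖y‖ := norm_pos_iff.2 hne
  have hlt : ‖A v - A u‖ < (K : ℝ)⁻¹ := by simpa [dist_eq_norm] using hv
  have hK' : (0 : ℝ) < K := by exact_mod_cast hK
  have : K * ‖A u y‖ < ‖y‖ := by
    calc (K : ℝ) * ‖A u y‖ ≤ K * (‖A v - A u‖ * ‖y‖) := by gcongr
      _ < K * ((K : ℝ)⁻¹ * ‖y‖) := by gcongr
      _ = ‖y‖ := by field_simp
  linarith

/-- The derivative of the smooth transition function is positive between `0` and `1`. -/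
theorem deriv_smoothTransition_pos {x : ℝ} (h0 : 0 < x) (h1 : x < 1) :
    0 < deriv Real.smoothTransition x := by
  have hE : ∀ y : ℝ, 0 < y → HasDerivAt expNegInvGlue (Real.exp (-y⁻¹) * (y⁻¹) ^ 2) y := by
    intro y hy
    have h : HasDerivAt (fun z : ℝ => Real.exp (-z⁻¹)) (Real.exp (-y⁻¹) * (y⁻¹) ^ 2) y := by
      refine ((hasDerivAt_inv hy.ne').neg.exp).congr_deriv ?_
      simp
    refine h.congr_of_eventuallyEq ?_
    filter_upwards [lt_mem_nhds hy] with z hz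
    simp [expNegInvGlue, not_le.2 hz]
  have hx := hE x h0
  have hy : HasDerivAt (fun z => expNegInvGlue (1 - z)) _ x :=
    (hE (1 - x) (by linarith)).comp x ((hasDerivAt_id x).const_sub 1)
  have hd := hx.div (hx.add hy) (Real.smoothTransition.pos_denom x).ne'
  have : deriv Real.smoothTransition x = _ := HasDerivAt.deriv hd
  rw [this]
  have p1 := expNegInvGlue.pos_of_pos h0
  have p2 := expNegInvGlue.pos_of_pos (x := 1 - x) (by linarith)
  have p3 : 0 < 1 - x := by linarith
  -- With E = `expNegInvGlue` the numerator reduces to E'(x) E(1 - x) + E(x) E'(1 - x).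
  refine div_pos ?_ (pow_pos (add_pos p1 p2) 2)
  simp only [Pi.add_apply]
  have e1 : 0 < Real.exp (-x⁻¹) * (x⁻¹) ^ 2 := by positivity
  have e2 : 0 < Real.exp (-(1 - x)⁻¹) * ((1 - x)⁻¹) ^ 2 := by positivity
  have := mul_pos e1 p2
  have := mul_pos p1 e2
  nlinarith

end Calculus

/-! ### Continuation of solutions inside a closed constraint -/

section Continuation

/-- Let `K` be a relation between parameters `s ∈ [a, b]` and points of `X` whose graph is compact
and which is, near each of its points, the graph of a function of `s` that is continuous there.
If one parameter has exactly one partner then all of them do. -/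
theorem existsUnique_of_local_graph {X : Type*} [NormedAddCommGroup X] {a b : ℝ} (hab : a ≤ b)
    {K : Set (ℝ × X)}
    (hK : IsCompact K) (hKs : ∀ p ∈ K, p.1 ∈ Icc a b)
    (hloc : ∀ p ∈ K, ∃ φ : ℝ → X, ContinuousAt φ p.1 ∧ φ p.1 = p.2 ∧
      ∀ᶠ q : ℝ × X in 𝓝 p, q.1 ∈ Icc a b → (q ∈ K ↔ φ q.1 = q.2))
    (ha : ∃! x, (a, x) ∈ K) : ∀ s ∈ Icc a b, ∃! x, (s, x) ∈ K := by
  have hlift : ∀ p ∈ K, ∃ φ : ℝ → X, ContinuousAt φ p.1 ∧ φ p.1 = p.2 ∧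
      ∀ᶠ s in 𝓝 p.1, s ∈ Icc a b → (s, φ s) ∈ K := by
    intro p hp
    obtain ⟨φ, hφ, hφp, hev⟩ := hloc p hp
    refine ⟨φ, hφ, hφp, ?_⟩
    have ht : Tendsto (fun s => (s, φ s)) (𝓝 p.1) (𝓝 p) := by
      have : ContinuousAt (fun s => (s, φ s)) p.1 := continuousAt_id.prodMk hφ
      simpa [ContinuousAt, hφp] using this
    filter_upwards [ht.eventually hev] with s hs hsab
    exact (hs hsab).2 rfl
  -- existence
  let A : Set (Icc a b) := Subtype.val ⁻¹' (Prod.fst '' K)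
  have hAc : IsClosed A := (hK.image continuous_fst).isClosed.preimage continuous_subtype_val
  have hAo : IsOpen A := by
    rw [isOpen_iff_mem_nhds]
    rintro ⟨s, hs⟩ ⟨p, hp, rfl⟩
    obtain ⟨φ, -, -, hev⟩ := hlift p hp
    have := (continuous_subtype_val.tendsto (⟨p.1, hs⟩ : Icc a b)).eventually hev
    filter_upwards [this] with t ht
    exact ⟨(t, φ t), ht t.2, rfl⟩
  -- uniqueness
  let D : Set (ℝ × X × X) := {q | (q.1, q.2.1) ∈ K ∧ (q.1, q.2.2) ∈ K ∧ q.2.1 ≠ q.2.2}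
  -- In the limit two partners could only merge, but then two points of K near one point would share
  -- a parameter, against the local graph property.
  have hDcl : IsClosed D := by
    rw [isClosed_iff_frequently]
    rintro ⟨s, x, y⟩ hfr
    have c1 : IsClosed {q : ℝ × X × X | (q.1, q.2.1) ∈ K} :=
      hK.isClosed.preimage (by fun_prop)
    have c2 : IsClosed {q : ℝ × X × X | (q.1, q.2.2) ∈ K} :=
      hK.isClosed.preimage (by fun_prop)
    have m1 : (s, x) ∈ K := isClosed_iff_frequently.1 c1 _ (hfr.mono fun q hq => hq.1)
    have m2 : (s, y) ∈ K := isClosed_iff_frequently.1 c2 _ (hfr.mono fun q hq => hq.2.1)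
    refine ⟨m1, m2, ?_⟩
    rintro (rfl : x = y)
    obtain ⟨φ, -, -, hev⟩ := hloc _ m1
    have t1 : Tendsto (fun q : ℝ × X × X => (q.1, q.2.1)) (𝓝 (s, x, x)) (𝓝 (s, x)) :=
      Continuous.tendsto (by fun_prop) _
    have t2 : Tendsto (fun q : ℝ × X × X => (q.1, q.2.2)) (𝓝 (s, x, x)) (𝓝 (s, x)) :=
      Continuous.tendsto (by fun_prop) _
    obtain ⟨q, hq, h1, h2⟩ :=
      (hfr.and_eventually ((t1.eventually hev).and (t2.eventually hev))).exists
    have e1 := (h1 (hKs _ hq.1)).1 hq.1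
    have e2 := (h2 (hKs (q.1, q.2.2) hq.2.1)).1 hq.2.1
    exact hq.2.2 (e1.symm.trans e2)
  have hDc : IsCompact D := by
    refine ((hK.image continuous_fst).prod ((hK.image continuous_snd).prod
      (hK.image continuous_snd))).of_isClosed_subset hDcl ?_
    rintro q ⟨h1, h2, -⟩
    exact ⟨⟨_, h1, rfl⟩, ⟨_, h1, rfl⟩, ⟨_, h2, rfl⟩⟩
  let B : Set (Icc a b) := Subtype.val ⁻¹' (Prod.fst '' D)
  have hBc : IsClosed B := (hDc.image continuous_fst).isClosed.preimage continuous_subtype_val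
  -- Two distinct partners continue along their own local graphs and remain distinct by continuity.
  have hBo : IsOpen B := by
    rw [isOpen_iff_mem_nhds]
    rintro ⟨s, hs⟩ ⟨q, hq, rfl⟩
    obtain ⟨φ, hφ, hφq, hev⟩ := hlift _ hq.1
    obtain ⟨ψ, hψ, hψq, hev'⟩ := hlift _ hq.2.1
    have hne : ∀ᶠ t in 𝓝 q.1, φ t ≠ ψ t :=
      (ContinuousAt.prodMk hφ hψ).eventually
        (isOpen_ne_fun continuous_fst continuous_snd |>.mem_nhds (by simpa [hφq, hψq] using hq.2.2))
    have := (continuous_subtype_val.tendsto (⟨q.1, hs⟩ : Icc a b)).eventually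
      (hev.and (hev'.and hne))
    filter_upwards [this] with t ht
    exact ⟨(t, φ t, ψ t), ⟨ht.1 t.2, ht.2.1 t.2, ht.2.2⟩, rfl⟩
  have hpc : PreconnectedSpace (Icc a b) := Subtype.preconnectedSpace isPreconnected_Icc
  have haI : a ∈ Icc a b := left_mem_Icc.2 hab
  obtain ⟨x₀, hx₀, hux₀⟩ := ha
  have hA : A = univ := by
    refine (isClopen_iff.1 ⟨hAc, hAo⟩).resolve_left fun h => ?_
    have : (⟨a, haI⟩ : Icc a b) ∈ A := ⟨(a, x₀), hx₀, rfl⟩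
    simp [h] at this
  have hB : B = ∅ := by
    refine (isClopen_iff.1 ⟨hBc, hBo⟩).resolve_right fun h => ?_
    have : (⟨a, haI⟩ : Icc a b) ∈ B := h ▸ mem_univ _
    obtain ⟨⟨s, x, y⟩, ⟨h1, h2, h3⟩, (rfl : s = a)⟩ := this
    exact h3 ((hux₀ _ h1).trans (hux₀ _ h2).symm)
  intro s hs
  have : (⟨s, hs⟩ : Icc a b) ∈ A := hA ▸ mem_univ _
  obtain ⟨⟨s', x⟩, hx, (rfl : s' = s)⟩ := this
  refine ⟨x, hx, fun y hy => ?_⟩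
  by_contra hne
  have : (⟨s', hs⟩ : Icc a b) ∈ B := ⟨(s', y, x), ⟨hy, hx, hne⟩, rfl⟩
  simp [hB] at this

/-- Continuation of a curve of solutions. The curve `g` solves `H = 0` at `d = 0`; near it, and
subject to the closed constraint `T`, there are no other solutions at `d = 0`, and for `d > 0`
solutions are nondegenerate and satisfy the constraint strictly. Then there is a unique solution
near `g s` for small `d > 0`, it depends smoothly on `(s, d)` and it converges to `g`. -/
theorem exists_branch_of_constraint {X : Type*} [NormedAddCommGroup X] [NormedSpace ℝ X]
    [FiniteDimensional ℝ X] {H : (ℝ × ℝ) × X → X} (hH : ContDiff ℝ ∞ H) {g : ℝ → X}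
    (hg : Continuous g) {T : Set (ℝ × X)} (hT : IsClosed T) {a b : ℝ} (hab : a ≤ b)
    (hg0 : H ((a, 0), g a) = 0)
    (hlim : ∀ s ∈ Icc a b, ∀ᶠ q : ℝ × X in 𝓝 (s, g s),
      H ((q.1, 0), q.2) = 0 → q ∈ T → q.2 = g q.1)
    (hreg : ∀ s ∈ Icc a b, ∀ᶠ v : (ℝ × ℝ) × X in 𝓝 ((s, 0), g s), 0 < v.1.2 → H v = 0 →
      (v.1.1, v.2) ∈ T → (v.1.1, v.2) ∈ interior T ∧ ∀ y, fderiv ℝ H v (0, y) = 0 → y = 0)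
    (ha : ∀ y, fderiv ℝ H ((a, 0), g a) (0, y) = 0 → y = 0) (hTa : (a, g a) ∈ interior T) :
    ∃ dstar : ℝ, 0 < dstar ∧ ∃ x : ℝ × ℝ → X,
      (∀ s ∈ Icc a b, ∀ d ∈ Ioo 0 dstar, H ((s, d), x (s, d)) = 0 ∧ (s, x (s, d)) ∈ T) ∧
      (∀ s ∈ Ioo a b, ∀ d ∈ Ioo 0 dstar, ContDiffAt ℝ ∞ x (s, d)) ∧
      ∀ ε : ℝ, 0 < ε → ∀ᶠ d in 𝓝[>] (0 : ℝ), ∀ s ∈ Icc a b, ‖x (s, d) - g s‖ < ε := by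
  have hprop : ProperSpace X := FiniteDimensional.proper ℝ X
  have hHc : Continuous H := hH.continuous
  have haI : a ∈ Icc a b := left_mem_Icc.2 hab
  -- uniform neighbourhood
  have hU1 : ∀ᶠ w : ℝ × X in 𝓝 (0, 0), ∀ s ∈ Icc a b, 0 < w.1 → H ((s, w.1), g s + w.2) = 0 →
      (s, g s + w.2) ∈ T → (s, g s + w.2) ∈ interior T ∧
        ∀ y, fderiv ℝ H ((s, w.1), g s + w.2) (0, y) = 0 → y = 0 := by
    refine isCompact_Icc.eventually_forall_of_forall_eventually fun s hs => ?_
    have ht : Tendsto (fun z : (ℝ × X) × ℝ => (((z.2, z.1.1), g z.2 + z.1.2) : (ℝ × ℝ) × X))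
        (𝓝 ((0, 0), s)) (𝓝 ((s, 0), g s)) := by
      have : Continuous (fun z : (ℝ × X) × ℝ => (((z.2, z.1.1), g z.2 + z.1.2) : (ℝ × ℝ) × X)) := by
        fun_prop
      simpa using this.tendsto ((0, 0), s)
    exact ht.eventually (hreg s hs)
  have hU2 : ∀ᶠ w : X in 𝓝 0, ∀ s ∈ Icc a b, H ((s, 0), g s + w) = 0 →
      (s, g s + w) ∈ T → w = 0 := by
    refine isCompact_Icc.eventually_forall_of_forall_eventually fun s hs => ?_
    have ht : Tendsto (fun z : X × ℝ => ((z.2, g z.2 + z.1) : ℝ × X))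
        (𝓝 (0, s)) (𝓝 (s, g s)) := by
      have : Continuous (fun z : X × ℝ => ((z.2, g z.2 + z.1) : ℝ × X)) := by fun_prop
      simpa using this.tendsto (0, s)
    filter_upwards [ht.eventually (hlim s hs)] with z hz h1 h2
    simpa using hz h1 h2
  obtain ⟨r₁, hr₁, hU1⟩ := Metric.eventually_nhds_iff.1 hU1
  obtain ⟨r₂, hr₂, hU2⟩ := Metric.eventually_nhds_iff.1 hU2
  obtain ⟨r, hr, hrr₁, hrr₂⟩ : ∃ r, 0 < r ∧ r < r₁ ∧ r < r₂ :=
    ⟨min r₁ r₂ / 2, by positivity, by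
      linarith [min_le_left r₁ r₂, lt_min hr₁ hr₂], by
      linarith [min_le_right r₁ r₂, lt_min hr₁ hr₂]⟩
  -- The constrained solutions in a closed tube around the curve. The radius r is strictly smaller
  -- than r₁ and r₂, so the estimates above apply on the whole closed tube.
  let G : ℝ → Set (ℝ × X) := fun d =>
    {p | p.1 ∈ Icc a b ∧ H ((p.1, d), p.2) = 0 ∧ p ∈ T ∧ ‖p.2 - g p.1‖ ≤ r}
  -- a priori estimate
  have hapr : ∀ ε : ℝ, 0 < ε → ∀ᶠ d in 𝓝[>] (0 : ℝ), ∀ p ∈ G d, ‖p.2 - g p.1‖ < ε := by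
    intro ε hε
    have : ∀ᶠ d in 𝓝 (0 : ℝ), ∀ q ∈ Icc a b ×ˢ Metric.closedBall (0 : X) r,
        H ((q.1, d), g q.1 + q.2) = 0 → (q.1, g q.1 + q.2) ∈ T → ‖q.2‖ < ε := by
      refine (isCompact_Icc.prod (isCompact_closedBall _ _)).eventually_forall_of_forall_eventually
        fun q hq => ?_
      -- A point of the tube that is not within ε of the curve fails at d = 0 either the equation or
      -- the closed constraint. Both failures persist nearby, and compactness of the tube makes this
      -- uniform.
      by_cases hqε : ‖q.2‖ < ε
      · have : ∀ᶠ z : ℝ × ℝ × X in 𝓝 (0, q), ‖z.2.2‖ < ε :=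
          (show Continuous fun z : ℝ × ℝ × X => ‖z.2.2‖ by fun_prop).continuousAt.eventually
            (gt_mem_nhds hqε)
        filter_upwards [this] with z hz _ _ using hz
      by_cases hq0 : H ((q.1, 0), g q.1 + q.2) = 0
      · have hqT : (q.1, g q.1 + q.2) ∉ T := by
          intro hqT
          have hlt : dist q.2 0 < r₂ := (Metric.mem_closedBall.1 hq.2).trans_lt hrr₂
          have := hU2 hlt q.1 hq.1 hq0 hqT
          rw [this, norm_zero] at hqε
          exact hqε hε
        have : ∀ᶠ z : ℝ × ℝ × X in 𝓝 (0, q), (z.2.1, g z.2.1 + z.2.2) ∉ T :=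
          (show Continuous fun z : ℝ × ℝ × X => (z.2.1, g z.2.1 + z.2.2) by
            fun_prop).continuousAt (x := (0, q)) |>.eventually (hT.isOpen_compl.mem_nhds hqT)
        filter_upwards [this] with z hz _ h using absurd h hz
      · have : ∀ᶠ z : ℝ × ℝ × X in 𝓝 (0, q), H ((z.2.1, z.1), g z.2.1 + z.2.2) ≠ 0 :=
          (show Continuous fun z : ℝ × ℝ × X => H ((z.2.1, z.1), g z.2.1 + z.2.2) by
            fun_prop).continuousAt (x := (0, q)) |>.eventually (isOpen_ne.mem_nhds hq0)
        filter_upwards [this] with z hz h _ using absurd h hz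
    filter_upwards [nhdsWithin_le_nhds this] with d hd p hp
    have := hd (p.1, p.2 - g p.1) ⟨hp.1, by simpa using hp.2.2.2⟩
    simp only [add_sub_cancel] at this
    exact this hp.2.1 hp.2.2.1
  -- the solution at the left end
  obtain ⟨φ₀, hφ₀, hφ₀a, hev₀⟩ := exists_implicit_function hH.contDiffAt hg0 ha
  have hstart : ∀ᶠ d in 𝓝[>] (0 : ℝ), ∃! x, (a, x) ∈ G d := by
    have hφc : ContinuousAt (fun d : ℝ => φ₀ (a, d)) 0 := by
      have h1 : ContinuousAt φ₀ (a, 0) := hφ₀.continuousAt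
      exact h1.comp_of_eq (f := fun d : ℝ => (a, d)) (by fun_prop) rfl
    have ht : Tendsto (fun d : ℝ => (((a, d), φ₀ (a, d)) : (ℝ × ℝ) × X)) (𝓝 0)
        (𝓝 ((a, 0), g a)) := by
      have h2 : ContinuousAt (fun d : ℝ => (((a, d), φ₀ (a, d)) : (ℝ × ℝ) × X)) 0 :=
        ContinuousAt.prodMk (by fun_prop) hφc
      simpa [ContinuousAt, hφ₀a] using h2
    have ht' : Tendsto (fun d : ℝ => ((a, φ₀ (a, d)) : ℝ × X)) (𝓝 0) (𝓝 (a, g a)) := by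
      have h2 : ContinuousAt (fun d : ℝ => ((a, φ₀ (a, d)) : ℝ × X)) 0 :=
        ContinuousAt.prodMk (by fun_prop) hφc
      simpa [ContinuousAt, hφ₀a] using h2
    have hbd : ∀ᶠ d in 𝓝 (0 : ℝ), ‖φ₀ (a, d) - g a‖ < r := by
      have : ContinuousAt (fun d : ℝ => ‖φ₀ (a, d) - g a‖) 0 := (hφc.sub continuousAt_const).norm
      refine this.eventually (gt_mem_nhds ?_)
      simpa [hφ₀a] using hr
    -- ρ is a radius on which the implicit function is the only solution. The a priori estimate with
    -- ε = ρ brings every element of `G d` over a into that ball.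
    obtain ⟨ρ, hρ, hball⟩ := Metric.eventually_nhds_iff.1 hev₀
    have hsmall : ∀ᶠ d in 𝓝 (0 : ℝ), |d| < ρ :=
      continuous_abs.continuousAt.eventually (gt_mem_nhds (by simpa using hρ))
    filter_upwards [nhdsWithin_le_nhds (ht.eventually hev₀),
      nhdsWithin_le_nhds (ht'.eventually (isOpen_interior.mem_nhds hTa)),
      nhdsWithin_le_nhds hbd, nhdsWithin_le_nhds hsmall, hapr ρ hρ] with d h1 h2 h3 h4 h5
    refine ⟨φ₀ (a, d), ⟨haI, h1.2 rfl, interior_subset h2, h3.le⟩, fun y hy => ?_⟩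
    have hy' : dist (((a, d), y) : (ℝ × ℝ) × X) ((a, 0), g a) < ρ := by
      rw [Prod.dist_eq, Prod.dist_eq]
      simp only [dist_self, sub_zero, dist_eq_norm]
      refine max_lt (max_lt hρ h4) (h5 _ hy)
    exact ((hball hy').1 hy.2.1).symm
  have hall := (hstart.and (hapr r hr)).and
    (Ioo_mem_nhdsGT hr₁ : ∀ᶠ d in 𝓝[>] (0 : ℝ), d ∈ Ioo 0 r₁)
  obtain ⟨dstar, hdstar, hall⟩ := mem_nhdsGT_iff_exists_Ioo_subset.1 hall
  -- the solution set is locally a graph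
  have hgraph : ∀ d ∈ Ioo 0 dstar, ∀ p ∈ G d, ∃ φ : ℝ × ℝ → X, ContDiffAt ℝ ∞ φ (p.1, d) ∧
      φ (p.1, d) = p.2 ∧ ∀ᶠ v : (ℝ × ℝ) × X in 𝓝 ((p.1, d), p.2), v.1.1 ∈ Icc a b →
        ((v.1.1, v.2) ∈ G v.1.2 ↔ φ v.1 = v.2) := by
    intro d hd p hp
    obtain ⟨⟨-, h2⟩, h3⟩ := hall hd
    have hpr := h2 p hp
    have hdist : dist ((d, p.2 - g p.1) : ℝ × X) (0, 0) < r₁ := by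
      rw [Prod.dist_eq]
      simp only [dist_zero_right, Real.norm_of_nonneg hd.1.le]
      exact max_lt h3.2 (hpr.trans hrr₁)
    have hr' := hU1 hdist p.1 hp.1 hd.1
    simp only [add_sub_cancel] at hr'
    obtain ⟨hint, hinj⟩ := hr' hp.2.1 hp.2.2.1
    obtain ⟨φ, hφ, hφp, hev⟩ := exists_implicit_function hH.contDiffAt hp.2.1 hinj
    refine ⟨φ, hφ, hφp, ?_⟩
    -- The constraint and the tube condition hold strictly, hence also nearby. Locally, membership
    -- in the solution set is then just H = 0.
    have e1 : ∀ᶠ v : (ℝ × ℝ) × X in 𝓝 ((p.1, d), p.2), (v.1.1, v.2) ∈ interior T :=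
      (show Continuous fun v : (ℝ × ℝ) × X => (v.1.1, v.2) by fun_prop).continuousAt.eventually
        (isOpen_interior.mem_nhds hint)
    have e2 : ∀ᶠ v : (ℝ × ℝ) × X in 𝓝 ((p.1, d), p.2), ‖v.2 - g v.1.1‖ < r :=
      (show Continuous fun v : (ℝ × ℝ) × X => ‖v.2 - g v.1.1‖ by fun_prop).continuousAt.eventually
        (gt_mem_nhds hpr)
    filter_upwards [hev, e1, e2] with v h1 h2 h3 hv
    rw [← h1]
    exact ⟨fun h => h.2.1, fun h => ⟨hv, h, interior_subset h2, h3.le⟩⟩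
  have huniq : ∀ d ∈ Ioo 0 dstar, ∀ s ∈ Icc a b, ∃! x, (s, x) ∈ G d := by
    intro d hd
    refine existsUnique_of_local_graph hab ?_ (fun p hp => hp.1) ?_ (hall hd).1.1
    · have hcl : IsClosed (G d) := by
        have c1 : IsClosed {p : ℝ × X | p.1 ∈ Icc a b} := isClosed_Icc.preimage continuous_fst
        have c2 : IsClosed {p : ℝ × X | H ((p.1, d), p.2) = 0} :=
          isClosed_singleton.preimage
            (show Continuous fun p : ℝ × X => H ((p.1, d), p.2) by fun_prop)
        have c3 : IsClosed {p : ℝ × X | ‖p.2 - g p.1‖ ≤ r} :=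
          isClosed_le (by fun_prop) continuous_const
        exact c1.inter (c2.inter (hT.inter c3))
      have hcomp : IsCompact ((fun q : ℝ × X => (q.1, g q.1 + q.2)) ''
          (Icc a b ×ˢ Metric.closedBall (0 : X) r)) :=
        (isCompact_Icc.prod (isCompact_closedBall _ _)).image (by fun_prop)
      refine hcomp.of_isClosed_subset hcl fun p hp => ?_
      exact ⟨(p.1, p.2 - g p.1), ⟨hp.1, by simpa using hp.2.2.2⟩, by simp⟩
    · intro p hp
      obtain ⟨φ, hφ, hφp, hev⟩ := hgraph d hd p hp
      refine ⟨fun s => φ (s, d), ?_, hφp, ?_⟩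
      · exact hφ.continuousAt.comp_of_eq (f := fun s : ℝ => (s, d)) (by fun_prop) rfl
      · have ht : Tendsto (fun q : ℝ × X => (((q.1, d), q.2) : (ℝ × ℝ) × X)) (𝓝 p)
            (𝓝 ((p.1, d), p.2)) := Continuous.tendsto (by fun_prop) _
        exact ht.eventually hev
  have hex : ∀ p : ℝ × ℝ, ∃ x : X, p.1 ∈ Icc a b → p.2 ∈ Ioo 0 dstar → (p.1, x) ∈ G p.2 := by
    intro p
    by_cases h : p.1 ∈ Icc a b ∧ p.2 ∈ Ioo 0 dstar
    · obtain ⟨x, hx, -⟩ := huniq p.2 h.2 p.1 h.1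
      exact ⟨x, fun _ _ => hx⟩
    · exact ⟨0, fun h1 h2 => absurd ⟨h1, h2⟩ h⟩
  choose x hx using hex
  refine ⟨dstar, hdstar, x, fun s hs d hd => ?_, fun s hs d hd => ?_, fun ε hε => ?_⟩
  · have := hx (s, d) hs hd
    exact ⟨this.2.1, this.2.2.1⟩
  -- The local implicit function also takes values in the solution set, so uniqueness identifies it
  -- with x, jointly in (s, d).
  · have hsI := Ioo_subset_Icc_self hs
    obtain ⟨φ, hφ, hφp, hev⟩ := hgraph d hd _ (hx (s, d) hsI hd)
    refine hφ.congr_of_eventuallyEq ?_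
    have ht : Tendsto (fun p : ℝ × ℝ => ((p, φ p) : (ℝ × ℝ) × X)) (𝓝 (s, d))
        (𝓝 ((s, d), x (s, d))) := by
      have : ContinuousAt (fun p : ℝ × ℝ => ((p, φ p) : (ℝ × ℝ) × X)) (s, d) :=
        continuousAt_id.prodMk hφ.continuousAt
      simpa [ContinuousAt, hφp] using this
    have hnb : Ioo a b ×ˢ Ioo 0 dstar ∈ 𝓝 ((s, d) : ℝ × ℝ) :=
      (isOpen_Ioo.prod isOpen_Ioo).mem_nhds ⟨hs, hd⟩
    filter_upwards [ht.eventually hev, hnb] with p hp hpm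
    have hpI := Ioo_subset_Icc_self hpm.1
    have hK : (p.1, φ p) ∈ G p.2 := (hp hpI).2 rfl
    obtain ⟨z, -, hz⟩ := huniq p.2 hpm.2 p.1 hpI
    exact (hz _ (hx p hpI hpm.2)).trans (hz _ hK).symm
  · filter_upwards [hapr ε hε, Ioo_mem_nhdsGT hdstar] with d hd hdd s hs
    exact hd _ (hx (s, d) hs hdd)

end Continuation

/-! ### Normal forms of the pitchfork and the saddle-node -/

section NormalForms

/-- The nonlinearity as a function on the plane. -/
def nl (f : ℝ → ℝ → ℝ) (p : ℝ × ℝ) : ℝ := f p.1 p.2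

/-- The partial derivative `f_u`. -/
def nlU (f : ℝ → ℝ → ℝ) (p : ℝ × ℝ) : ℝ := fderiv ℝ (nl f) p (1, 0)

/-- The partial derivative `f_μ`. -/
def nlM (f : ℝ → ℝ → ℝ) (p : ℝ × ℝ) : ℝ := fderiv ℝ (nl f) p (0, 1)

/-- The derivative of `(u - c) L(u)`. -/
theorem deriv_sub_mul {L : ℝ → ℝ} (hL : Differentiable ℝ L) (c : ℝ) :
    deriv (fun u => (u - c) * L u) = fun u => L u + (u - c) * deriv L u := by
  funext u
  have h : HasDerivAt (fun u => (u - c) * L u) (1 * L u + (u - c) * deriv L u) u :=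
    ((hasDerivAt_id u).sub_const c).mul (hL u).hasDerivAt
  rw [h.deriv, one_mul]

variable {f : ℝ → ℝ → ℝ} {uM uP : ℝ → ℝ}

theorem IsBistable.contDiff_nl (hf : IsBistable f uM uP) : ContDiff ℝ ∞ (nl f) := hf.smooth

theorem IsBistable.contDiff_nlU (hf : IsBistable f uM uP) : ContDiff ℝ ∞ (nlU f) :=
  (hf.contDiff_nl.fderiv_right (by simp)).clm_apply contDiff_const

theorem IsBistable.contDiff_nlM (hf : IsBistable f uM uP) : ContDiff ℝ ∞ (nlM f) :=
  (hf.contDiff_nl.fderiv_right (by simp)).clm_apply contDiff_const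

theorem IsBistable.hasDerivAt_comp (hf : IsBistable f uM uP) {α β : ℝ → ℝ} {α' β' s : ℝ}
    (hα : HasDerivAt α α' s) (hβ : HasDerivAt β β' s) :
    HasDerivAt (fun s => f (α s) (β s))
      (nlU f (α s, β s) * α' + nlM f (α s, β s) * β') s :=
  hasDerivAt_comp_two (hf.contDiff_nl.differentiable (by simp)) hα hβ

theorem IsBistable.hasDerivAt_left (hf : IsBistable f uM uP) (u μ : ℝ) :
    HasDerivAt (fun u => f u μ) (nlU f (u, μ)) u := by
  simpa using hf.hasDerivAt_comp (hasDerivAt_id u) (hasDerivAt_const u μ)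

theorem IsBistable.hasDerivAt_right (hf : IsBistable f uM uP) (u μ : ℝ) :
    HasDerivAt (fun μ => f u μ) (nlM f (u, μ)) μ := by
  simpa using hf.hasDerivAt_comp (hasDerivAt_const μ u) (hasDerivAt_id μ)

theorem IsBistable.deriv_left (hf : IsBistable f uM uP) (u μ : ℝ) :
    deriv (fun u => f u μ) u = nlU f (u, μ) := (hf.hasDerivAt_left u μ).deriv

theorem IsBistable.zero_left (hf : IsBistable f uM uP) (μ : ℝ) : f 0 μ = 0 := by
  have := hf.odd 0 μ
  simp only [neg_zero] at this
  linarith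

theorem IsBistable.nlM_zero (hf : IsBistable f uM uP) (μ : ℝ) : nlM f (0, μ) = 0 := by
  have h := hf.hasDerivAt_right 0 μ
  have h0 : (fun μ => f 0 μ) = fun _ => 0 := funext hf.zero_left
  rw [h0] at h
  exact h.unique (hasDerivAt_const μ 0)

/-- Normal form of the pitchfork bifurcation at `(0, 0)`. -/
theorem IsBistable.pitchfork_form (hf : IsBistable f uM uP) :
    ∃ (q₀ : ℝ → ℝ) (q₂ : ℝ × ℝ → ℝ), ContDiff ℝ ∞ q₀ ∧ ContDiff ℝ ∞ q₂ ∧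
      (∀ u μ, f u μ = u * (μ * q₀ μ + u ^ 2 * q₂ (u, μ))) ∧ q₀ 0 < 0 ∧ 0 < q₂ (0, 0) := by
  obtain ⟨q, hq, hfq⟩ := exists_contDiff_eq_mul hf.contDiff_nl hf.zero_left
  simp only [nl] at hfq
  have hqU : ∀ μ, q (0, μ) = nlU f (0, μ) := by
    intro μ
    have h1 : HasDerivAt (fun u => u * q (u, μ))
        (1 * q (0, μ) + 0 * deriv (fun u => q (u, μ)) 0) 0 := by
      refine (hasDerivAt_id (0 : ℝ)).mul (DifferentiableAt.hasDerivAt ?_)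
      have : ContDiff ℝ ∞ fun u => q (u, μ) := by fun_prop
      exact this.differentiable (by simp) 0
    have h0 : (fun u => f u μ) = fun u => u * q (u, μ) := funext fun u => hfq u μ
    have h2 := hf.hasDerivAt_left 0 μ
    rw [h0] at h2
    simpa using h1.unique h2
  -- As f is odd, f/u is even. Its linear coefficient `q₁ (0, μ)` therefore vanishes, and a second
  -- factor u can be split off.
  have heven : ∀ u μ, q (-u, μ) = q (u, μ) := by
    intro u μ
    rcases eq_or_ne u 0 with rfl | hu
    · simp
    · have h := hf.odd u μ
      rw [hfq, hfq] at h
      have : u * (q (-u, μ) - q (u, μ)) = 0 := by linarith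
      rcases mul_eq_zero.1 this with h | h
      · exact absurd h hu
      · linarith
  obtain ⟨q₁, hq₁, hqq₁⟩ := exists_contDiff_eq_mul (φ := fun p : ℝ × ℝ => q p - q (0, p.2))
    (by fun_prop) (fun y => by simp)
  simp only at hqq₁
  have hq₁0 : ∀ μ, q₁ (0, μ) = 0 := by
    intro μ
    have hd : ContDiff ℝ ∞ fun u => q₁ (u, μ) := by fun_prop
    have hodd : ∀ u, u ≠ 0 → q₁ (-u, μ) = -q₁ (u, μ) := by
      intro u hu
      have h1 := hqq₁ u μ
      have h2 := hqq₁ (-u) μ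
      rw [heven] at h2
      have : u * (q₁ (-u, μ) + q₁ (u, μ)) = 0 := by linarith
      rcases mul_eq_zero.1 this with h | h
      · exact absurd h hu
      · linarith
    have hc : Continuous fun u => q₁ (-u, μ) + q₁ (u, μ) := by
      have := hq₁.continuous
      fun_prop
    have h0 : q₁ (-0, μ) + q₁ (0, μ) = 0 := by
      refine tendsto_nhds_unique ((hc.tendsto 0).mono_left
        (nhdsWithin_le_nhds (s := ({0}ᶜ : Set ℝ)))) ?_
      refine tendsto_const_nhds.congr' ?_
      filter_upwards [self_mem_nhdsWithin] with u hu
      rw [hodd u hu]; ring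
    simp only [neg_zero] at h0
    linarith
  obtain ⟨q₂, hq₂, hqq₂⟩ := exists_contDiff_eq_mul hq₁ hq₁0
  obtain ⟨r, hr, hqr⟩ := exists_contDiff_eq_mul (φ := fun p : ℝ × ℝ => q (0, p.1))
    (by fun_prop) (fun y => by
      show q (0, 0) = 0
      rw [hqU, ← hf.deriv_left]
      exact hf.pitchfork_u)
  simp only at hqr
  have hform : ∀ u μ, f u μ = u * (μ * r (μ, 0) + u ^ 2 * q₂ (u, μ)) := by
    intro u μ
    rw [hfq, ← hqr μ 0]
    have h1 := hqq₁ u μ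
    rw [hqq₂] at h1
    have : q (u, μ) = q (0, μ) + u ^ 2 * q₂ (u, μ) := by linarith
    rw [this]
  refine ⟨fun μ => r (μ, 0), q₂, by fun_prop, hq₂, hform, ?_, ?_⟩
  · have h := hf.pitchfork_uμ
    have h0 : (fun μ => deriv (fun u => f u μ) 0) = fun μ => (μ - 0) * r (μ, 0) := by
      funext μ
      rw [hf.deriv_left, ← hqU, hqr μ 0, sub_zero]
    have hd : ContDiff ℝ ∞ fun μ => r (μ, 0) := by fun_prop
    rw [h0, deriv_sub_mul (hd.differentiable (by simp))] at h
    simpa using h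
  · have h := hf.pitchfork_uuu
    have hk : ContDiff ℝ ∞ fun u => q₂ (u, 0) := by fun_prop
    set k : ℝ → ℝ := fun u => q₂ (u, 0) with hkdef
    -- At μ = 0 the function is u³ k(u), with third derivative 6 k(0) at the origin. Each
    -- differentiation below is rewritten so that one factor u fewer remains.
    have h0 : (fun u => f u 0) = fun u => (u - 0) * ((u - 0) * ((u - 0) * k u)) := by
      funext u
      rw [hform]
      simp only [hkdef]
      ring
    have hk1 : ContDiff ℝ ∞ (deriv k) := (contDiff_infty_iff_deriv.1 hk).2
    have hk2 : ContDiff ℝ ∞ (deriv (deriv k)) := (contDiff_infty_iff_deriv.1 hk1).2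
    rw [h0, iteratedDeriv_succ', deriv_sub_mul, deriv_sub_mul, deriv_sub_mul] at h
    rotate_left
    · exact hk.differentiable (by simp)
    · exact ContDiff.differentiable (n := ∞) (by fun_prop) (by simp)
    · exact ContDiff.differentiable (n := ∞) (by fun_prop) (by simp)
    have h1 : (fun u => (u - 0) * ((u - 0) * k u) + (u - 0) * ((u - 0) * k u +
        (u - 0) * (k u + (u - 0) * deriv k u))) =
        fun u => (u - 0) * ((u - 0) * (3 * k u + (u - 0) * deriv k u)) := by
      funext u; ring
    rw [h1, iteratedDeriv_succ', deriv_sub_mul, deriv_sub_mul] at h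
    rotate_left
    · exact ContDiff.differentiable (n := ∞) (by fun_prop) (by simp)
    · exact ContDiff.differentiable (n := ∞) (by fun_prop) (by simp)
    set l : ℝ → ℝ := fun u => 3 * k u + (u - 0) * deriv k u with hl
    have hls : ContDiff ℝ ∞ l := by fun_prop
    have hl1 : ContDiff ℝ ∞ (deriv l) := (contDiff_infty_iff_deriv.1 hls).2
    have h2 : (fun u => (u - 0) * l u + (u - 0) * (l u + (u - 0) * deriv l u)) =
        fun u => (u - 0) * (2 * l u + (u - 0) * deriv l u) := by
      funext u; ring
    rw [h2, iteratedDeriv_one, deriv_sub_mul] at h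
    · simp [hl, hkdef] at h ⊢
      linarith
    · exact ContDiff.differentiable (n := ∞) (by fun_prop) (by simp)

/-- Normal form of the saddle-node bifurcation at `(1, 1)`. -/
theorem IsBistable.saddleNode_form (hf : IsBistable f uM uP) :
    ∃ (k : ℝ → ℝ) (h : ℝ × ℝ → ℝ), ContDiff ℝ ∞ k ∧ ContDiff ℝ ∞ h ∧
      (∀ u μ, f u μ = (u - 1) ^ 2 * k u + (1 - μ) * h (u, μ)) ∧ k 1 < 0 ∧ 0 < h (1, 1) := by
  have hF := hf.contDiff_nl
  have h11 : f 1 1 = 0 :=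
    (hf.roots 1 (by simp) 1 zero_le_one).2 (Or.inr (Or.inr hf.uP_one.symm))
  obtain ⟨h, hh, hfh⟩ := exists_contDiff_eq_mul
    (φ := fun p : ℝ × ℝ => nl f (p.2, 1 - p.1) - nl f (p.2, 1)) (by fun_prop) (fun y => by simp)
  obtain ⟨q, hq, hfq⟩ := exists_contDiff_eq_mul
    (φ := fun p : ℝ × ℝ => nl f (1 + p.1, 1)) (by fun_prop) (fun y => by simpa [nl] using h11)
  simp only [nl] at hfh hfq
  have hq0 : ∀ y, q (0, y) = 0 := by
    intro y
    have h1 : deriv (fun u => f u 1) =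
        fun u => q (u - 1, y) + (u - 1) * deriv (fun u => q (u - 1, y)) u := by
      have h0 : (fun u => f u 1) = fun u => (u - 1) * q (u - 1, y) := by
        funext u
        rw [← hfq (u - 1) y]; simp
      have hd : ContDiff ℝ ∞ fun u => q (u - 1, y) := by fun_prop
      rw [h0, deriv_sub_mul (hd.differentiable (by simp))]
    have h2 := hf.saddleNode_u
    rw [h1] at h2
    simpa using h2
  obtain ⟨k, hk, hqk⟩ := exists_contDiff_eq_mul hq hq0
  have hform : ∀ u μ, f u μ = (u - 1) ^ 2 * k (u - 1, 0) + (1 - μ) * h (1 - μ, u) := by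
    intro u μ
    have h1 := hfh (1 - μ) u
    have h2 := hfq (u - 1) 0
    rw [hqk] at h2
    simp only [sub_sub_cancel, add_sub_cancel] at h1 h2
    rw [h2] at h1
    linarith
  have hk1 : ContDiff ℝ ∞ fun u => k (u - 1, 0) := by fun_prop
  have hh1 : ContDiff ℝ ∞ fun p : ℝ × ℝ => h (1 - p.2, p.1) := by fun_prop
  refine ⟨fun u => k (u - 1, 0), fun p => h (1 - p.2, p.1), hk1, hh1, hform, ?_⟩
  set K : ℝ → ℝ := fun u => k (u - 1, 0) with hK
  have hKne : K 1 ≠ 0 := by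
    have h2 := hf.saddleNode_uu
    have h0 : (fun u => f u 1) = fun u => (u - 1) * ((u - 1) * K u) := by
      funext u
      rw [hform]
      simp only [hK]
      ring
    have hK' : ContDiff ℝ ∞ (deriv K) := (contDiff_infty_iff_deriv.1 hk1).2
    rw [h0, iteratedDeriv_succ', deriv_sub_mul, deriv_sub_mul] at h2
    rotate_left
    · exact hk1.differentiable (by simp)
    · exact ContDiff.differentiable (n := ∞) (by fun_prop) (by simp)
    have h1 : (fun u => (u - 1) * K u + (u - 1) * (K u + (u - 1) * deriv K u)) =
        fun u => (u - 1) * (2 * K u + (u - 1) * deriv K u) := by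
      funext u; ring
    rw [h1, iteratedDeriv_one, deriv_sub_mul] at h2
    · intro h3
      simp [h3] at h2
    · exact ContDiff.differentiable (n := ∞) (by fun_prop) (by simp)
  -- This gives the sign of k(1). At μ = 1 there are no roots strictly between 0 and 1, and
  -- stability of 0 makes f negative just to the right of 0.
  have hfneg : ∀ u ∈ Ioo (0 : ℝ) 1, f u 1 < 0 := by
    have hcont : Continuous fun u => f u 1 := by
      have : Continuous (nl f) := hF.continuous
      exact this.comp (by fun_prop : Continuous fun u : ℝ => (u, (1 : ℝ)))
    have hne : ∀ u ∈ Ioo (0 : ℝ) 1, f u 1 ≠ 0 := by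
      intro u hu h0
      rcases (hf.roots 1 (by simp) u hu.1.le).1 h0 with h | h | h
      · linarith [hu.1]
      · linarith [hu.2, hf.uM_one]
      · linarith [hu.2, hf.uP_one]
    have hd := hf.hasDerivAt_left 0 1
    have hneg : nlU f (0, 1) < 0 := by
      rw [← hf.deriv_left]; exact hf.stable_zero 1 (by simp)
    have hsl := (hasDerivAt_iff_tendsto_slope.1 hd).eventually (gt_mem_nhds hneg)
    have hsl' : ∀ᶠ u in 𝓝[>] (0 : ℝ), slope (fun u => f u 1) 0 u < 0 :=
      hsl.filter_mono (nhdsWithin_mono (0 : ℝ) fun u hu => ne_of_gt (mem_Ioi.1 hu))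
    obtain ⟨v, hv, hv1⟩ := (hsl'.and (Ioo_mem_nhdsGT (zero_lt_one : (0 : ℝ) < 1))).exists
    have hfv : f v 1 < 0 := by
      rw [slope_def_field, hf.zero_left, sub_zero, sub_zero] at hv
      exact neg_of_div_neg_left hv hv1.1.le
    intro u hu
    by_contra hcon
    have hcon' : 0 < f u 1 := lt_of_le_of_ne (not_lt.1 hcon) (hne u hu).symm
    have hsub : uIcc v u ⊆ Ioo 0 1 := by
      intro z hz
      have := ordConnected_Ioo.uIcc_subset hv1 hu hz
      exact this
    obtain ⟨z, hz, hz0⟩ := intermediate_value_uIcc (hcont.continuousOn (s := uIcc v u))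
      (show (0 : ℝ) ∈ uIcc (f v 1) (f u 1) by
        rw [uIcc_of_le (hfv.trans hcon').le]; exact ⟨hfv.le, hcon'.le⟩)
    exact hne z (hsub hz) hz0
  have hKle : K 1 ≤ 0 := by
    have hc : Tendsto K (𝓝[<] 1) (𝓝 (K 1)) :=
      (hk1.continuous.tendsto 1).mono_left nhdsWithin_le_nhds
    refine le_of_tendsto hc ?_
    filter_upwards [Ioo_mem_nhdsLT (zero_lt_one : (0 : ℝ) < 1)] with u hu
    have h1 := hfneg u hu
    rw [hform] at h1
    simp only [sub_self, zero_mul, add_zero] at h1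
    have : 0 < (u - 1) ^ 2 := by
      have : u - 1 ≠ 0 := by linarith [hu.2]
      positivity
    by_contra hcon
    have := mul_pos this (not_le.1 hcon)
    linarith
  have hKlt : K 1 < 0 := lt_of_le_of_ne hKle hKne
  refine ⟨hKlt, ?_⟩
  have hne : h (1 - 1, 1) ≠ 0 := by
    have h2 := hf.saddleNode_μ
    have hl : ContDiff ℝ ∞ fun μ => -h (1 - μ, 1) := by fun_prop
    have h0 : (fun μ => f 1 μ) = fun μ => (μ - 1) * (-h (1 - μ, 1)) := by
      funext μ
      rw [hform]; ring
    rw [h0, deriv_sub_mul (hl.differentiable (by simp))] at h2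
    simpa using h2
  -- The sign of h(1, 1) comes from the roots u₊(μ) as μ increases to 1: there (u - 1)² k ≤ 0 is
  -- balanced by (1 - μ) h, so h ≥ 0 along them.
  have hcw : ContinuousWithinAt uP (Iio 1) 1 := by
    have h1 : ContinuousWithinAt uP (Icc 0 1) 1 := hf.continuousOn_uP 1 (by simp)
    exact h1.mono_of_mem_nhdsWithin (Icc_mem_nhdsLT (zero_lt_one' ℝ))
  have ht : Tendsto (fun μ => (uP μ, μ)) (𝓝[<] 1) (𝓝 (1, 1)) := by
    have h1 : Tendsto uP (𝓝[<] 1) (𝓝 1) := by simpa [ContinuousWithinAt, hf.uP_one] using hcw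
    exact h1.prodMk_nhds nhdsWithin_le_nhds
  have hc : Tendsto (fun μ => h (1 - μ, uP μ)) (𝓝[<] 1) (𝓝 (h (1 - 1, 1))) :=
    (hh1.continuous.tendsto (1, 1)).comp ht
  show 0 < h (1 - 1, 1)
  refine lt_of_le_of_ne ?_ (Ne.symm hne)
  refine ge_of_tendsto hc ?_
  have hKev : ∀ᶠ μ in 𝓝[<] (1 : ℝ), K (uP μ) < 0 := by
    have h1 : Tendsto uP (𝓝[<] 1) (𝓝 1) := by simpa [ContinuousWithinAt, hf.uP_one] using hcw
    exact ((hk1.continuous.tendsto 1).comp h1).eventually (gt_mem_nhds hKlt)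
  filter_upwards [hKev, Ioo_mem_nhdsLT (zero_lt_one : (0 : ℝ) < 1)] with μ h1 hμ
  have hroot : f (uP μ) μ = 0 :=
    (hf.roots μ ⟨hμ.1.le, hμ.2.le⟩ _ ((hf.order μ hμ).1.trans (hf.order μ hμ).2).le).2
      (Or.inr (Or.inr rfl))
  rw [hform] at hroot
  have h3 : (uP μ - 1) ^ 2 * K (uP μ) ≤ 0 := mul_nonpos_of_nonneg_of_nonpos (by positivity) h1.le
  by_contra hcon
  have h4 : (1 - μ) * h (1 - μ, uP μ) < 0 :=
    mul_neg_of_pos_of_neg (by linarith [hμ.2]) (not_le.1 hcon)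
  simp only [hK] at h3
  linarith

end NormalForms

/-! ### Uniform bounds near the two bifurcation points -/

section LocalBounds

variable {f : ℝ → ℝ → ℝ} {uM uP : ℝ → ℝ}

/-- Quantitative form of the pitchfork normal form near `(0, 0)`. -/
theorem IsBistable.pitchfork_bounds (hf : IsBistable f uM uP) :
    ∃ α C : ℝ, 0 < α ∧ 0 < C ∧ ∀ᶠ p : ℝ × ℝ in 𝓝 (0, 0), ∃ q₀ q₂ q₃ m : ℝ,
      f p.1 p.2 = p.1 * (p.2 * q₀ + p.1 ^ 2 * q₂) ∧ nlU f p = p.2 * q₀ + p.1 ^ 2 * q₃ ∧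
      nlM f p = p.1 * m ∧ -C ≤ q₀ ∧ q₀ ≤ -α ∧ α ≤ q₂ ∧ q₂ ≤ C ∧ 2 * q₂ ≤ q₃ ∧ q₃ ≤ C ∧
      -C ≤ m ∧ m ≤ -α := by
  obtain ⟨q₀, q₂, h₀, h₂, hform, hneg, hpos⟩ := hf.pitchfork_form
  -- Differentiating the normal form gives f_u = μ q₀ + u² Q and f_μ = u N. Since Q = 3 q₂ > 0 at
  -- the origin, 2 q₂ ≤ Q holds nearby.
  let Q : ℝ × ℝ → ℝ := fun p => 3 * q₂ p + p.1 * fderiv ℝ q₂ p (1, 0)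
  let N : ℝ × ℝ → ℝ := fun p => q₀ p.2 + p.2 * deriv q₀ p.2 + p.1 ^ 2 * fderiv ℝ q₂ p (0, 1)
  have hq₀' : ContDiff ℝ ∞ (deriv q₀) := (contDiff_infty_iff_deriv.1 h₀).2
  have hq₂' : ContDiff ℝ ∞ (fderiv ℝ q₂) := h₂.fderiv_right (by simp)
  have cQ : Continuous Q := by
    have := hq₂'.continuous
    have := h₂.continuous
    fun_prop
  have cN : Continuous N := by
    have := hq₂'.continuous
    have := h₀.continuous
    have := hq₀'.continuous
    fun_prop
  have cq₀ : Continuous fun p : ℝ × ℝ => q₀ p.2 := h₀.continuous.comp continuous_snd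
  have hU : ∀ p : ℝ × ℝ, nlU f p = p.2 * q₀ p.2 + p.1 ^ 2 * Q p := by
    rintro ⟨u, μ⟩
    have h1 := hf.hasDerivAt_left u μ
    have h0 : (fun u => f u μ) = fun u => u * (μ * q₀ μ + u ^ 2 * q₂ (u, μ)) :=
      funext fun u => hform u μ
    rw [h0] at h1
    have h2 : HasDerivAt (fun u => q₂ (u, μ)) (fderiv ℝ q₂ (u, μ) (1, 0)) u := by
      simpa using hasDerivAt_comp_two (h₂.differentiable (by simp)) (hasDerivAt_id u)
        (hasDerivAt_const u μ)
    have h3 := (hasDerivAt_id u).mul ((((hasDerivAt_id u).pow 2).mul h2).const_add (μ * q₀ μ))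
    have := h1.unique h3
    rw [this]
    simp [Q]
    ring
  have hM : ∀ p : ℝ × ℝ, nlM f p = p.1 * N p := by
    rintro ⟨u, μ⟩
    have h1 := hf.hasDerivAt_right u μ
    have h0 : (fun μ => f u μ) = fun μ => u * (μ * q₀ μ + u ^ 2 * q₂ (u, μ)) :=
      funext fun μ => hform u μ
    rw [h0] at h1
    have h2 : HasDerivAt (fun μ => q₂ (u, μ)) (fderiv ℝ q₂ (u, μ) (0, 1)) μ := by
      simpa using hasDerivAt_comp_two (h₂.differentiable (by simp)) (hasDerivAt_const μ u)
        (hasDerivAt_id μ)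
    have h3 := (((hasDerivAt_id μ).mul (h₀.differentiable (by simp) μ).hasDerivAt).add
      (h2.const_mul (u ^ 2))).const_mul u
    have := h1.unique h3
    rw [this]
    simp [N]
  set α : ℝ := min (-q₀ 0 / 2) (q₂ (0, 0) / 2) with hα
  have hα1 : α ≤ -q₀ 0 / 2 := min_le_left _ _
  have hα2 : α ≤ q₂ (0, 0) / 2 := min_le_right _ _
  have hα0 : 0 < α := lt_min (by linarith) (by linarith)
  refine ⟨α, 4 * (|q₀ 0| + |q₂ (0, 0)|), hα0, by
    have := abs_pos.2 hneg.ne; positivity, ?_⟩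
  have hN0 : N (0, 0) = q₀ 0 := by simp [N]
  have hQ0 : Q (0, 0) = 3 * q₂ (0, 0) := by simp [Q]
  have a1 : |q₀ 0| = -q₀ 0 := abs_of_neg hneg
  have a2 : |q₂ (0, 0)| = q₂ (0, 0) := abs_of_pos hpos
  rw [a1, a2]
  have e1 : ∀ᶠ p : ℝ × ℝ in 𝓝 (0, 0), q₀ p.2 < -α :=
    (cq₀.tendsto (0, 0)).eventually_lt_const (by linarith)
  have e2 : ∀ᶠ p : ℝ × ℝ in 𝓝 (0, 0), -(4 * (-q₀ 0 + q₂ (0, 0))) < q₀ p.2 :=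
    (cq₀.tendsto (0, 0)).eventually_const_lt (by linarith)
  have e3 : ∀ᶠ p : ℝ × ℝ in 𝓝 (0, 0), α < q₂ p :=
    (h₂.continuous.tendsto (0, 0)).eventually_const_lt (by linarith)
  have e4 : ∀ᶠ p : ℝ × ℝ in 𝓝 (0, 0), q₂ p < 4 * (-q₀ 0 + q₂ (0, 0)) :=
    (h₂.continuous.tendsto (0, 0)).eventually_lt_const (by linarith)
  have e5 : ∀ᶠ p : ℝ × ℝ in 𝓝 (0, 0), Q p < 4 * (-q₀ 0 + q₂ (0, 0)) :=
    (cQ.tendsto (0, 0)).eventually_lt_const (by rw [hQ0]; linarith)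
  have e6 : ∀ᶠ p : ℝ × ℝ in 𝓝 (0, 0), 2 * q₂ p < Q p :=
    ((continuous_const.mul h₂.continuous).tendsto (0, 0)).eventually_lt (cQ.tendsto (0, 0))
      (by rw [hQ0]; show 2 * q₂ (0, 0) < _; linarith)
  have e7 : ∀ᶠ p : ℝ × ℝ in 𝓝 (0, 0), N p < -α :=
    (cN.tendsto (0, 0)).eventually_lt_const (by rw [hN0]; linarith)
  have e8 : ∀ᶠ p : ℝ × ℝ in 𝓝 (0, 0), -(4 * (-q₀ 0 + q₂ (0, 0))) < N p :=
    (cN.tendsto (0, 0)).eventually_const_lt (by rw [hN0]; linarith)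
  filter_upwards [e1, e2, e3, e4, e5, e6, e7, e8] with p h1 h2 h3 h4 h5 h6 h7 h8
  exact ⟨q₀ p.2, q₂ p, Q p, N p, hform _ _, hU p, hM p, h2.le, h1.le, h3.le, h4.le,
    h6.le, h5.le, h8.le, h7.le⟩

/-- Second order expansion in `u` near the saddle-node point. -/
theorem IsBistable.saddleNode_bounds (hf : IsBistable f uM uP) :
    ∃ α C : ℝ, 0 < α ∧ 0 < C ∧
      (∀ᶠ p : ℝ × ℝ × ℝ in 𝓝 (1, 1, 1), ∃ R S : ℝ,
        f p.2.1 p.2.2 = f p.1 p.2.2 + (p.2.1 - p.1) * nlU f (p.1, p.2.2) + (p.2.1 - p.1) ^ 2 * R ∧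
        nlU f (p.2.1, p.2.2) = nlU f (p.1, p.2.2) + (p.2.1 - p.1) * S ∧
        R ≤ -α ∧ |S| ≤ C) ∧
      ∀ᶠ p : ℝ × ℝ in 𝓝 (1, 1), -C ≤ nlM f p ∧ nlM f p ≤ -α ∧ (1 ≤ p.2 → f p.1 p.2 ≤ 0) := by
  have hF := hf.contDiff_nl
  have hU := hf.contDiff_nlU
  have hM := hf.contDiff_nlM
  obtain ⟨k, h, hk, hh, hform, hk1, hh1⟩ := hf.saddleNode_form
  -- increments in `u`
  obtain ⟨G, hG, hFG⟩ := exists_contDiff_eq_mul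
    (φ := fun p : ℝ × ℝ × ℝ => nl f (p.2.1 + p.1, p.2.2) - nl f p.2) (by fun_prop)
    (fun y => by simp)
  obtain ⟨S, hS, hUS⟩ := exists_contDiff_eq_mul
    (φ := fun p : ℝ × ℝ × ℝ => nlU f (p.2.1 + p.1, p.2.2) - nlU f p.2) (by fun_prop)
    (fun y => by simp)
  simp only [nl] at hFG
  simp only at hUS
  have hG0 : ∀ y, G (0, y) = nlU f y := by
    intro y
    have h1 : HasDerivAt (fun x => f y.1 y.2 + x * G (x, y))
        (1 * G (0, y) + 0 * deriv (fun x => G (x, y)) 0) 0 := by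
      refine ((hasDerivAt_id (0 : ℝ)).mul (DifferentiableAt.hasDerivAt ?_)).const_add _
      have : ContDiff ℝ ∞ fun x => G (x, y) := by fun_prop
      exact this.differentiable (by simp) 0
    have h0 : (fun x => f y.1 y.2 + x * G (x, y)) = fun x => f (y.1 + x) y.2 := by
      funext x; rw [← hFG]; ring
    have h2 : HasDerivAt (fun x => f (y.1 + x) y.2) (nlU f (y.1 + 0, y.2)) 0 := by
      simpa using
        hf.hasDerivAt_comp ((hasDerivAt_id (0 : ℝ)).const_add y.1) (hasDerivAt_const 0 y.2)
    rw [h0] at h1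
    have := h1.unique h2
    simpa using this
  obtain ⟨R, hR, hGR⟩ := exists_contDiff_eq_mul
    (φ := fun p : ℝ × ℝ × ℝ => G p - nlU f p.2) (by fun_prop) (fun y => by simp [hG0])
  simp only at hGR
  have hexp : ∀ x y, f (y.1 + x) y.2 = f y.1 y.2 + x * nlU f y + x ^ 2 * R (x, y) := by
    intro x y
    have h1 := hFG x y
    have h2 := hGR x y
    have h3 : G (x, y) = nlU f y + x * R (x, y) := by linarith
    rw [h3] at h1
    linarith
  -- Both sides are limits of f(1 + x, 1)/x² as x → 0, so the quadratic coefficient inherits the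
  -- sign of k(1).
  have hR11 : R (0, 1, 1) = k 1 := by
    have hcont : Tendsto (fun x : ℝ => R (x, 1, 1)) (𝓝[≠] 0) (𝓝 (R (0, 1, 1))) :=
      ((show Continuous fun x : ℝ => R (x, 1, 1) by
        have := hR.continuous
        fun_prop).tendsto 0).mono_left nhdsWithin_le_nhds
    have hcont' : Tendsto (fun x : ℝ => k (1 + x)) (𝓝[≠] 0) (𝓝 (k 1)) := by
      have h1 : Continuous fun x : ℝ => k (1 + x) := by
        have := hk.continuous
        fun_prop
      simpa using (h1.tendsto 0).mono_left (nhdsWithin_le_nhds (s := ({0}ᶜ : Set ℝ)))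
    refine tendsto_nhds_unique hcont (hcont'.congr' ?_)
    filter_upwards [self_mem_nhdsWithin] with x hx
    have h1 := hexp x (1, 1)
    have h2 : nlU f (1, 1) = 0 := by
      rw [← hf.deriv_left]; exact hf.saddleNode_u
    have h3 : f 1 1 = 0 := by rw [hform]; ring
    rw [h2, hform] at h1
    simp only [h3] at h1
    have : x ^ 2 * (k (1 + x) - R (x, 1, 1)) = 0 := by linarith
    have hx' : x ≠ 0 := hx
    rcases mul_eq_zero.1 this with h | h
    · exact absurd h (by positivity)
    · linarith
  have hM11 : nlM f (1, 1) = -h (1, 1) := by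
    have h1 := hf.hasDerivAt_right 1 1
    have h0 : (fun μ => f 1 μ) = fun μ => (1 - μ) * h (1, μ) := by
      funext μ; rw [hform]; ring
    rw [h0] at h1
    have h2 : HasDerivAt (fun μ => (1 - μ) * h (1, μ))
        (-1 * h (1, 1) + (1 - 1) * deriv (fun μ => h (1, μ)) 1) 1 := by
      refine ((hasDerivAt_id (1 : ℝ)).const_sub 1).mul (DifferentiableAt.hasDerivAt ?_)
      have : ContDiff ℝ ∞ fun μ => h (1, μ) := by fun_prop
      exact this.differentiable (by simp) 1
    have := h1.unique h2
    simpa using this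
  set α : ℝ := min (-k 1 / 2) (h (1, 1) / 2) with hα
  have hα1 : α ≤ -k 1 / 2 := min_le_left _ _
  have hα2 : α ≤ h (1, 1) / 2 := min_le_right _ _
  have hα0 : 0 < α := lt_min (by linarith) (by linarith)
  refine ⟨α, 1 + |S (0, 1, 1)| + 2 * h (1, 1), hα0, by positivity, ?_, ?_⟩
  · have cT : Continuous fun p : ℝ × ℝ × ℝ => (p.2.1 - p.1, p.1, p.2.2) := by fun_prop
    have tT : Tendsto (fun p : ℝ × ℝ × ℝ => (p.2.1 - p.1, p.1, p.2.2)) (𝓝 (1, 1, 1))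
        (𝓝 (0, 1, 1)) := by
      simpa using cT.tendsto (1, 1, 1)
    have e1 := ((hR.continuous.tendsto (0, 1, 1)).comp tT).eventually_lt_const (u := -α)
      (by rw [hR11]; linarith)
    have e2 := ((hS.continuous.abs.tendsto (0, 1, 1)).comp tT).eventually_lt_const
      (u := 1 + |S (0, 1, 1)| + 2 * h (1, 1)) (by linarith)
    filter_upwards [e1, e2] with p h1 h2
    refine ⟨R (p.2.1 - p.1, p.1, p.2.2), S (p.2.1 - p.1, p.1, p.2.2), ?_, ?_, h1.le, h2.le⟩
    · simpa using hexp (p.2.1 - p.1) (p.1, p.2.2)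
    · have := hUS (p.2.1 - p.1) (p.1, p.2.2)
      simp only [add_sub_cancel] at this
      linarith
  · have e1 := (hM.continuous.tendsto (1, 1)).eventually_lt_const (u := -α)
      (by rw [hM11]; linarith)
    have e2 := (hM.continuous.tendsto (1, 1)).eventually_const_lt
      (u := -(1 + |S (0, 1, 1)| + 2 * h (1, 1)))
      (by rw [hM11]; linarith [abs_nonneg (S (0, 1, 1))])
    have e3 := ((hk.continuous.comp continuous_fst).tendsto ((1, 1) : ℝ × ℝ)).eventually_lt_const
      (u := 0) (by simpa using hk1)
    have e4 := (hh.continuous.tendsto (1, 1)).eventually_const_lt hh1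
    filter_upwards [e1, e2, e3, e4] with p h1 h2 h3 h4
    refine ⟨h2.le, h1.le, fun hp => ?_⟩
    rw [hform]
    simp only [Function.comp_apply] at h3
    have a1 : (p.1 - 1) ^ 2 * k p.1 ≤ 0 := mul_nonpos_of_nonneg_of_nonpos (by positivity) h3.le
    have a2 : (1 - p.2) * h (p.1, p.2) ≤ 0 :=
      mul_nonpos_of_nonpos_of_nonneg (by linarith) h4.le
    linarith

theorem IsBistable.root_uM (hf : IsBistable f uM uP) {μ : ℝ} (hμ : μ ∈ Icc (0 : ℝ) 1) :
    f (uM μ) μ = 0 := by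
  have h0 : 0 ≤ uM μ := by
    rcases eq_or_lt_of_le hμ.1 with rfl | h1
    · exact hf.uM_zero.ge
    rcases eq_or_lt_of_le hμ.2 with rfl | h2
    · simp [hf.uM_one]
    · exact (hf.order μ ⟨h1, h2⟩).1.le
  exact (hf.roots μ hμ _ h0).2 (Or.inr (Or.inl rfl))

theorem IsBistable.uP_pos (hf : IsBistable f uM uP) {μ : ℝ} (hμ : μ ∈ Icc (0 : ℝ) 1) :
    0 < uP μ := by
  rcases eq_or_lt_of_le hμ.1 with rfl | h1
  · exact hf.uP_zero
  rcases eq_or_lt_of_le hμ.2 with rfl | h2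
  · simp [hf.uP_one]
  · exact (hf.order μ ⟨h1, h2⟩).1.trans (hf.order μ ⟨h1, h2⟩).2

theorem IsBistable.root_uP (hf : IsBistable f uM uP) {μ : ℝ} (hμ : μ ∈ Icc (0 : ℝ) 1) :
    f (uP μ) μ = 0 :=
  (hf.roots μ hμ _ (hf.uP_pos hμ).le).2 (Or.inr (Or.inr rfl))

theorem IsBistable.nlU_zero_neg (hf : IsBistable f uM uP) {μ : ℝ} (hμ : μ ∈ Ioc (0 : ℝ) 1) :
    nlU f (0, μ) < 0 := by
  rw [← hf.deriv_left]; exact hf.stable_zero μ hμ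

theorem IsBistable.nlU_uP_neg (hf : IsBistable f uM uP) {μ : ℝ} (hμ : μ ∈ Ico (0 : ℝ) 1) :
    nlU f (uP μ, μ) < 0 := by
  rw [← hf.deriv_left]; exact hf.stable_uP μ hμ

theorem IsBistable.nlU_uM_pos (hf : IsBistable f uM uP) {μ : ℝ} (hμ : μ ∈ Ioo (0 : ℝ) 1) :
    0 < nlU f (uM μ, μ) := by
  rw [← hf.deriv_left]; exact hf.unstable_uM μ hμ

theorem IsBistable.nlU_ne_zero (hf : IsBistable f uM uP) {u μ : ℝ} (hμ : μ ∈ Ioo (0 : ℝ) 1)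
    (hu : 0 ≤ u) (h : f u μ = 0) : nlU f (u, μ) ≠ 0 := by
  rcases (hf.roots μ (Ioo_subset_Icc_self hμ) u hu).1 h with rfl | rfl | rfl
  · exact (hf.nlU_zero_neg ⟨hμ.1, hμ.2.le⟩).ne
  · exact (hf.nlU_uM_pos hμ).ne'
  · exact (hf.nlU_uP_neg ⟨hμ.1.le, hμ.2⟩).ne

end LocalBounds

/-! ### Smooth parametrization of the arc of roots -/

section Profile

/-- The bifurcation parameter along the pitchfork–fold arc of roots, as a function of a
coordinate `σ ∈ [-1, 1]` on this arc. -/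
def par (σ : ℝ) : ℝ := (1 - σ ^ 2) ^ 2

theorem contDiff_par : ContDiff ℝ ∞ par := by unfold par; fun_prop

/-- The hypothesis allows |σ| slightly above 1, so the parameter stays in the domain of u_± on full
neighbourhoods of σ = ±1. -/
theorem par_mem {σ : ℝ} (h : σ ^ 2 ≤ 2) : par σ ∈ Icc (0 : ℝ) 1 := by
  unfold par
  exact ⟨by positivity, by nlinarith [sq_nonneg σ]⟩

theorem par_neg (σ : ℝ) : par (-σ) = par σ := by simp [par]

theorem par_zero : par 0 = 1 := by simp [par]

theorem par_one : par 1 = 0 := by simp [par]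

theorem par_neg_one : par (-1) = 0 := by simp [par]

theorem par_mem_Ioo {σ : ℝ} (h0 : σ ≠ 0) (h1 : σ ^ 2 < 1) : par σ ∈ Ioo (0 : ℝ) 1 := by
  unfold par
  have : 0 < σ ^ 2 := by positivity
  have h2 : 0 < 1 - σ ^ 2 := by linarith
  exact ⟨by positivity, by nlinarith⟩

theorem hasDerivAt_par (σ : ℝ) : HasDerivAt par (-4 * σ * (1 - σ ^ 2)) σ := by
  have h := ((((hasDerivAt_id σ).pow 2).const_sub 1).pow 2)
  refine h.congr_deriv ?_
  simp
  ring

variable {f : ℝ → ℝ → ℝ} {uM uP : ℝ → ℝ}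

/-- A continuous curve of nondegenerate roots is smooth. -/
theorem IsBistable.exists_smooth_root (hf : IsBistable f uM uP) {u : ℝ → ℝ} {μ₀ : ℝ}
    (hu : ContinuousWithinAt u (Icc 0 1) μ₀) (hroot : ∀ μ ∈ Icc (0 : ℝ) 1, f (u μ) μ = 0)
    (hμ₀ : μ₀ ∈ Icc (0 : ℝ) 1) (hne : nlU f (u μ₀, μ₀) ≠ 0) :
    ∃ ψ : ℝ → ℝ, ContDiffAt ℝ ∞ ψ μ₀ ∧ ∀ᶠ μ in 𝓝[Icc 0 1] μ₀, u μ = ψ μ := by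
  have hF := hf.contDiff_nl
  let Φ : ℝ × ℝ → ℝ := fun p => nl f (p.2, p.1)
  have hΦ : ContDiff ℝ ∞ Φ := by fun_prop
  have hinj : ∀ y : ℝ, fderiv ℝ Φ (μ₀, u μ₀) (0, y) = 0 → y = 0 := by
    intro y hy
    have h1 : HasDerivAt (fun t => Φ (μ₀, t))
        (fderiv ℝ Φ (μ₀, u μ₀) (1, 0) * 0 + fderiv ℝ Φ (μ₀, u μ₀) (0, 1) * 1) (u μ₀) :=
      hasDerivAt_comp_two (hΦ.differentiable (by simp)) (hasDerivAt_const _ μ₀) (hasDerivAt_id _)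
    have h2 := h1.unique (hf.hasDerivAt_left (u μ₀) μ₀)
    have h3 : ((0, y) : ℝ × ℝ) = y • (0, 1) := by simp
    rw [h3, map_smul, smul_eq_mul] at hy
    rcases mul_eq_zero.1 hy with h | h
    · exact h
    · rw [h] at h2
      exact absurd (by linarith) hne
  obtain ⟨ψ, hψ, -, hev⟩ := exists_implicit_function (u := (μ₀, u μ₀)) hΦ.contDiffAt
    (hroot μ₀ hμ₀) hinj
  refine ⟨ψ, hψ, ?_⟩
  have ht : Tendsto (fun μ => (μ, u μ)) (𝓝[Icc 0 1] μ₀) (𝓝 (μ₀, u μ₀)) :=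
    Tendsto.prodMk_nhds nhdsWithin_le_nhds hu
  filter_upwards [ht.eventually hev, self_mem_nhdsWithin] with μ h1 h2
  exact (h1.1 (hroot μ h2)).symm

end Profile

section Profile

variable {f : ℝ → ℝ → ℝ} {uM uP : ℝ → ℝ}

/-- A smooth solution `z` of `(z - c) L(σ, z) = r(σ)` near a point where `z = c`, `r = 0` and
`L > 0`. -/
theorem exists_smooth_solution {L : ℝ × ℝ → ℝ} {r : ℝ → ℝ} {σ₀ c r' : ℝ}
    (hL : ContDiffAt ℝ ∞ L (σ₀, c)) (hr : ContDiffAt ℝ ∞ r σ₀) (hLpos : 0 < L (σ₀, c))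
    (hr0 : r σ₀ = 0) (hr' : HasDerivAt r r' σ₀) :
    ∃ z : ℝ → ℝ, ContDiffAt ℝ ∞ z σ₀ ∧ z σ₀ = c ∧
      (∀ᶠ σ in 𝓝 σ₀, (z σ - c) * L (σ, z σ) = r σ) ∧ HasDerivAt z (r' / L (σ₀, c)) σ₀ := by
  let Φ : ℝ × ℝ → ℝ := fun p => (p.2 - c) * L p - r p.1
  have hΦ : ContDiffAt ℝ ∞ Φ (σ₀, c) := by
    have h1 : ContDiffAt ℝ ∞ (fun p : ℝ × ℝ => r p.1) (σ₀, c) :=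
      ContDiffAt.comp (σ₀, c) hr contDiffAt_fst
    exact ((contDiffAt_snd.sub contDiffAt_const).mul hL).sub h1
  have hLc : DifferentiableAt ℝ (fun t => L (σ₀, t)) c := by
    have h1 : DifferentiableAt ℝ L (σ₀, c) := hL.differentiableAt (by simp)
    exact h1.comp c (by fun_prop : DifferentiableAt ℝ (fun t : ℝ => (σ₀, t)) c)
  have hinj : ∀ y : ℝ, fderiv ℝ Φ (σ₀, c) (0, y) = 0 → y = 0 := by
    intro y hy
    have h1 : HasDerivAt (fun t => Φ (σ₀, t)) (fderiv ℝ Φ (σ₀, c) (0, 1)) c := by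
      have h2 : HasDerivAt (fun t : ℝ => ((σ₀, t) : ℝ × ℝ)) (0, 1) c :=
        (hasDerivAt_const c σ₀).prodMk (hasDerivAt_id c)
      exact (hΦ.differentiableAt (by simp)).hasFDerivAt.comp_hasDerivAt c h2
    have h2 : HasDerivAt (fun t => Φ (σ₀, t))
        (1 * L (σ₀, c) + (c - c) * deriv (fun t => L (σ₀, t)) c) c :=
      (((hasDerivAt_id c).sub_const c).mul hLc.hasDerivAt).sub_const (r σ₀)
    have h3 := h1.unique h2
    have h4 : ((0, y) : ℝ × ℝ) = y • (0, 1) := by simp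
    rw [h4, map_smul, smul_eq_mul, h3] at hy
    rcases mul_eq_zero.1 hy with h | h
    · exact h
    · simp at h
      exact absurd h hLpos.ne'
  obtain ⟨z, hz, hzc, hev⟩ := exists_implicit_function hΦ (by simp [Φ, hr0]) hinj
  simp only at hz hzc
  have ht : Tendsto (fun σ => (σ, z σ)) (𝓝 σ₀) (𝓝 (σ₀, c)) := by
    have : ContinuousAt (fun σ => (σ, z σ)) σ₀ := continuousAt_id.prodMk hz.continuousAt
    simpa [ContinuousAt, hzc] using this
  have heq : ∀ᶠ σ in 𝓝 σ₀, (z σ - c) * L (σ, z σ) = r σ := by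
    filter_upwards [ht.eventually hev] with σ h
    have := h.2 rfl
    simp only [Φ] at this
    linarith
  refine ⟨z, hz, hzc, heq, ?_⟩
  rw [hasDerivAt_iff_tendsto_slope]
  have hLt : Tendsto (fun σ => L (σ, z σ)) (𝓝 σ₀) (𝓝 (L (σ₀, c))) := hL.continuousAt.tendsto.comp ht
  -- The defining equation says that the slopes of z are those of r divided by L, so the derivative
  -- of z is a limit of quotients.
  have h1 : Tendsto (fun σ => slope r σ₀ σ / L (σ, z σ)) (𝓝[≠] σ₀) (𝓝 (r' / L (σ₀, c))) :=
    (hasDerivAt_iff_tendsto_slope.1 hr').div (hLt.mono_left nhdsWithin_le_nhds) hLpos.ne'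
  refine h1.congr' ?_
  filter_upwards [nhdsWithin_le_nhds heq, nhdsWithin_le_nhds (hLt.eventually_const_lt hLpos),
    self_mem_nhdsWithin] with σ e1 e2 e3
  rw [slope_def_field, slope_def_field, hzc, hr0, ← e1]
  have : σ - σ₀ ≠ 0 := sub_ne_zero.2 e3
  field_simp
  ring

/-- Parametrization of the arc of roots near the fold. -/
theorem IsBistable.exists_fold_profile (hf : IsBistable f uM uP) :
    ∃ z : ℝ → ℝ, ContDiffAt ℝ ∞ z 0 ∧ 0 < deriv z 0 ∧
      ∀ᶠ σ in 𝓝 (0 : ℝ), z σ = if σ ≤ 0 then uM (par σ) else uP (par σ) := by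
  obtain ⟨k, h, hk, hh, hform, hk1, hh1⟩ := hf.saddleNode_form
  have hpar := contDiff_par
  -- The equation f = 0 reads (u - 1)² (-k/h) = 1 - μ, and 1 - `par σ` = σ² (2 - σ²). The square
  -- root (u - 1) L = σ √(2 - σ²) is smooth in σ, and the sign of σ tells the two roots apart.
  let L : ℝ × ℝ → ℝ := fun p => √(-k p.2 / h (p.2, par p.1))
  have hpos : 0 < -k 1 / h (1, 1) := div_pos (by linarith) hh1
  have hL : ContDiffAt ℝ ∞ L (0, 1) := by
    refine ContDiffAt.sqrt (ContDiffAt.div ?_ ?_ ?_) ?_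
    · exact ContDiff.contDiffAt (by fun_prop)
    · exact ContDiff.contDiffAt (by fun_prop)
    · simpa [par_zero] using hh1.ne'
    · simpa [par_zero] using hpos.ne'
  have hr : ContDiffAt ℝ ∞ (fun σ : ℝ => σ * √(2 - σ ^ 2)) 0 := by
    refine contDiffAt_id.mul (ContDiffAt.sqrt (ContDiff.contDiffAt (by fun_prop)) (by simp))
  have hr' : HasDerivAt (fun σ : ℝ => σ * √(2 - σ ^ 2)) (√2) 0 := by
    have h1 : DifferentiableAt ℝ (fun σ : ℝ => √(2 - σ ^ 2)) 0 :=
      DifferentiableAt.sqrt (by fun_prop) (by simp)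
    exact ((hasDerivAt_id (0 : ℝ)).mul h1.hasDerivAt).congr_deriv (by simp)
  have hL0 : 0 < L (0, 1) := by simpa [L, par_zero] using hpos
  obtain ⟨z, hz, hz0, heq, hd⟩ := exists_smooth_solution hL hr hL0 (by simp) hr'
  have hdpos : 0 < √2 / L (0, 1) := by positivity
  refine ⟨z, hz, by rw [hd.deriv]; exact hdpos, ?_⟩
  have hzt : Tendsto z (𝓝 0) (𝓝 1) := by
    have := hz.continuousAt.tendsto
    rwa [hz0] at this
  have hpart : Tendsto par (𝓝 0) (𝓝 1) := by
    have := hpar.continuous.tendsto 0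
    rwa [par_zero] at this
  have e1 : ∀ᶠ σ in 𝓝 (0 : ℝ), k (z σ) < 0 :=
    ((hk.continuous.tendsto 1).comp hzt).eventually_lt_const hk1
  have e2 : ∀ᶠ σ in 𝓝 (0 : ℝ), 0 < h (z σ, par σ) :=
    ((hh.continuous.tendsto (1, 1)).comp (hzt.prodMk_nhds hpart)).eventually_const_lt hh1
  have e3 : ∀ᶠ σ in 𝓝 (0 : ℝ), 0 < z σ := hzt.eventually_const_lt one_pos
  have hsq : ∀ᶠ σ in 𝓝 (0 : ℝ), σ ^ 2 < 1 :=
    (show Continuous fun σ : ℝ => σ ^ 2 by fun_prop).continuousAt.eventually_lt_const (by simp)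
  have e4 : ∀ᶠ σ in 𝓝 (0 : ℝ), σ ≠ 0 → 0 < (z σ - 1) / σ := by
    have h1 := (hasDerivAt_iff_tendsto_slope.1 hd).eventually_const_lt hdpos
    rw [eventually_nhdsWithin_iff] at h1
    filter_upwards [h1] with σ h2 h3
    have := h2 h3
    rwa [slope_def_field, hz0, sub_zero] at this
  have hroot : ∀ᶠ σ in 𝓝 (0 : ℝ), f (z σ) (par σ) = 0 := by
    filter_upwards [e1, e2, heq, hsq] with σ h1 h2 h3 h4
    have h5 : ((z σ - 1) * L (σ, z σ)) ^ 2 = (σ * √(2 - σ ^ 2)) ^ 2 := by rw [h3]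
    have h6 : 0 ≤ -k (z σ) / h (z σ, par σ) := (div_pos (by linarith) h2).le
    rw [mul_pow, mul_pow, Real.sq_sqrt h6, Real.sq_sqrt (by linarith)] at h5
    have h7 : σ ^ 2 * (2 - σ ^ 2) = 1 - par σ := by unfold par; ring
    rw [h7] at h5
    have h8 : (z σ - 1) ^ 2 * (-k (z σ)) = (1 - par σ) * h (z σ, par σ) := by
      rw [← h5]; field_simp
    rw [hform]
    linarith
  have hneg : Tendsto (fun σ : ℝ => -σ) (𝓝 0) (𝓝 0) := by
    simpa using (continuous_neg.tendsto (0 : ℝ))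
  filter_upwards [hroot, hneg.eventually hroot, e3, hneg.eventually e3, e4, hneg.eventually e4, hsq]
    with σ r1 r2 p1 p2 q1 q2 hs
  rcases eq_or_ne σ 0 with rfl | hσ
  · simp [hz0, par_zero, hf.uM_one]
  have hμ := par_mem_Ioo hσ hs
  rw [par_neg] at r2
  have s1 := q1 hσ
  have s2 := q2 (neg_ne_zero.2 hσ)
  have o1 := (hf.roots _ (Ioo_subset_Icc_self hμ) _ p1.le).1 r1
  have o2 := (hf.roots _ (Ioo_subset_Icc_self hμ) _ p2.le).1 r2
  have ho := hf.order _ hμ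
  have o1' := o1.resolve_left p1.ne'
  have o2' := o2.resolve_left p2.ne'
  -- The values at σ and -σ are roots for the same μ on opposite sides of 1, so u_- < u₊ decides
  -- which is which.
  rcases lt_or_gt_of_ne hσ with hn | hp
  · have h1 : z σ - 1 < 0 := by
      by_contra hc
      exact absurd s1 (not_lt.2 (div_nonpos_of_nonneg_of_nonpos (not_lt.1 hc) hn.le))
    have h2 : 0 < z (-σ) - 1 := by
      by_contra hc
      exact absurd s2 (not_lt.2 (div_nonpos_of_nonpos_of_nonneg (not_lt.1 hc) (by linarith)))
    rw [if_pos hn.le]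
    rcases o1' with h | h
    · exact h
    · rcases o2' with h' | h' <;> linarith
  · have h1 : 0 < z σ - 1 := by
      by_contra hc
      exact absurd s1 (not_lt.2 (div_nonpos_of_nonpos_of_nonneg (not_lt.1 hc) hp.le))
    have h2 : z (-σ) - 1 < 0 := by
      by_contra hc
      exact absurd s2 (not_lt.2 (div_nonpos_of_nonneg_of_nonpos (not_lt.1 hc) (by linarith)))
    rw [if_neg (not_le.2 hp)]
    rcases o1' with h | h
    · rcases o2' with h' | h' <;> linarith
    · exact h

/-- Parametrization of the arc of roots near the pitchfork. -/
theorem IsBistable.exists_pitchfork_profile (hf : IsBistable f uM uP) :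
    ∃ z : ℝ → ℝ, ContDiffAt ℝ ∞ z (-1) ∧ 0 < deriv z (-1) ∧
      ∀ᶠ σ in 𝓝 (-1 : ℝ), -1 ≤ σ → z σ = uM (par σ) := by
  obtain ⟨q₀, q₂, h₀, h₂, hform, hneg, hpos⟩ := hf.pitchfork_form
  have hpar := contDiff_par
  -- For u ≠ 0 and μ = (1 - σ²)² the root equation is u² q₂ = (1 - σ²)² (-q₀). Its square root u √q₂
  -- = (1 - σ²) √(-q₀) has no singularity at σ = -1.
  let L : ℝ × ℝ → ℝ := fun p => √(q₂ (p.2, par p.1))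
  let r : ℝ → ℝ := fun σ => (1 - σ ^ 2) * √(-q₀ (par σ))
  have hL : ContDiffAt ℝ ∞ L (-1, 0) :=
    ContDiffAt.sqrt (ContDiff.contDiffAt (by fun_prop)) (by simpa [par_neg_one] using hpos.ne')
  have hs : ContDiffAt ℝ ∞ (fun σ : ℝ => √(-q₀ (par σ))) (-1) :=
    ContDiffAt.sqrt (ContDiff.contDiffAt (by fun_prop)) (by simpa [par_neg_one] using hneg.ne)
  have hr : ContDiffAt ℝ ∞ r (-1) := ContDiffAt.mul (ContDiff.contDiffAt (by fun_prop)) hs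
  have hr' : HasDerivAt r (2 * √(-q₀ 0)) (-1) := by
    have h1 : HasDerivAt (fun σ : ℝ => 1 - σ ^ 2) 2 (-1) := by
      have := ((hasDerivAt_id (-1 : ℝ)).pow 2).const_sub 1
      exact this.congr_deriv (by norm_num)
    exact (h1.mul (hs.differentiableAt (by simp)).hasDerivAt).congr_deriv (by simp [par_neg_one])
  have hL0 : 0 < L (-1, 0) := by simpa [L, par_neg_one] using hpos
  have hr0 : r (-1) = 0 := by simp [r]
  obtain ⟨z, hz, hz0, heq, hd⟩ := exists_smooth_solution hL hr hL0 hr0 hr'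
  have hdpos : 0 < 2 * √(-q₀ 0) / L (-1, 0) := by
    have : 0 < √(-q₀ 0) := Real.sqrt_pos.2 (by linarith)
    positivity
  refine ⟨z, hz, by rw [hd.deriv]; exact hdpos, ?_⟩
  have hzt : Tendsto z (𝓝 (-1)) (𝓝 0) := by
    have := hz.continuousAt.tendsto
    rwa [hz0] at this
  have hpart : Tendsto par (𝓝 (-1)) (𝓝 0) := by
    have := hpar.continuous.tendsto (-1)
    rwa [par_neg_one] at this
  have e1 : ∀ᶠ σ in 𝓝 (-1 : ℝ), q₀ (par σ) < 0 :=
    ((h₀.continuous.tendsto 0).comp hpart).eventually_lt_const hneg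
  have e2 : ∀ᶠ σ in 𝓝 (-1 : ℝ), 0 < q₂ (z σ, par σ) :=
    ((h₂.continuous.tendsto (0, 0)).comp (hzt.prodMk_nhds hpart)).eventually_const_lt hpos
  -- This excludes the root u₊, which stays near u₊(0) > 0 while z is near 0.
  have e3 : ∀ᶠ σ in 𝓝 (-1 : ℝ), z σ < uP (par σ) := by
    have hc : Tendsto uP (𝓝[Icc 0 1] 0) (𝓝 (uP 0)) := hf.continuousOn_uP 0 (by simp)
    have hp : Tendsto par (𝓝 (-1)) (𝓝[Icc 0 1] 0) := by
      refine tendsto_nhdsWithin_iff.2 ⟨hpart, ?_⟩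
      have : ∀ᶠ σ in 𝓝 (-1 : ℝ), σ ^ 2 < 2 :=
        (show Continuous fun σ : ℝ => σ ^ 2 by fun_prop).continuousAt.eventually_lt_const
          (by norm_num)
      filter_upwards [this] with σ h
      exact par_mem h.le
    exact hzt.eventually_lt (hc.comp hp) hf.uP_zero
  have e4 : ∀ᶠ σ in 𝓝 (-1 : ℝ), σ < 0 := Iio_mem_nhds (by norm_num)
  filter_upwards [e1, e2, e3, e4, heq] with σ h1 h2 h3 h4 h5 h6
  rcases eq_or_lt_of_le h6 with rfl | h6
  · simp [hz0, par_neg_one, hf.uM_zero]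
  have hs1 : σ ^ 2 < 1 := by nlinarith
  have hμ := par_mem_Ioo h4.ne hs1
  have hLp : 0 < L (σ, z σ) := Real.sqrt_pos.2 h2
  have hrp : 0 < r σ := mul_pos (by linarith) (Real.sqrt_pos.2 (by linarith))
  have hzp : 0 < z σ := by
    rw [← h5, sub_zero] at hrp
    exact pos_of_mul_pos_left hrp hLp.le
  have hroot : f (z σ) (par σ) = 0 := by
    have h7 : ((z σ - 0) * L (σ, z σ)) ^ 2 = ((1 - σ ^ 2) * √(-q₀ (par σ))) ^ 2 := by rw [h5]
    rw [mul_pow, mul_pow, Real.sq_sqrt h2.le, Real.sq_sqrt (by linarith), sub_zero] at h7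
    rw [hform, h7]
    simp only [par]
    ring
  rcases (hf.roots _ (Ioo_subset_Icc_self hμ) _ hzp.le).1 hroot with h | h | h
  · exact absurd h hzp.ne'
  · exact h
  · exact absurd h h3.ne

/-- A smooth parametrization `σ ↦ (w(σ), (1 - σ²)²)`, `σ ∈ [-1, 1]`, of the arc of roots that runs
from the pitchfork along `u_-` to the fold and back along `u_+`. -/
theorem IsBistable.exists_profile (hf : IsBistable f uM uP) :
    ∃ w : ℝ → ℝ, (∀ σ ∈ Icc (-1 : ℝ) 1, ContDiffAt ℝ ∞ w σ) ∧
      (∀ σ ∈ Icc (-1 : ℝ) 0, w σ = uM (par σ)) ∧ (∀ σ ∈ Icc (0 : ℝ) 1, w σ = uP (par σ)) ∧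
      0 < deriv w (-1) ∧ 0 < deriv w 0 := by
  obtain ⟨z₁, h₁, d₁, e₁⟩ := hf.exists_pitchfork_profile
  obtain ⟨z₂, h₂, d₂, e₂⟩ := hf.exists_fold_profile
  -- To the left of -1 the implicit solution is used only to have smoothness on a full neighbourhood
  -- of -1. At σ = 1 no extension is needed, since u₊(par σ) is smooth on both sides.
  let w : ℝ → ℝ := fun σ => if σ < -1 then z₁ σ else if σ ≤ 0 then uM (par σ) else uP (par σ)
  have w₁ : w =ᶠ[𝓝 (-1)] z₁ := by
    filter_upwards [e₁, Iio_mem_nhds (show (-1 : ℝ) < 0 by norm_num)] with σ h h'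
    by_cases hσ : σ < -1
    · simp [w, hσ]
    · have hσ0 : σ ≤ 0 := le_of_lt h'
      simp [w, hσ, hσ0, h (not_lt.1 hσ)]
  have w₂ : w =ᶠ[𝓝 0] z₂ := by
    filter_upwards [e₂, Ioi_mem_nhds (show (-1 : ℝ) < 0 by norm_num)] with σ h h'
    have hσ : ¬ σ < -1 := not_lt.2 (le_of_lt h')
    simp [w, hσ, h]
  have hM : ∀ σ ∈ Icc (-1 : ℝ) 0, w σ = uM (par σ) := by
    intro σ hσ
    simp [w, not_lt.2 hσ.1, hσ.2]
  have hP : ∀ σ ∈ Icc (0 : ℝ) 1, w σ = uP (par σ) := by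
    intro σ hσ
    rcases eq_or_lt_of_le hσ.1 with rfl | h
    · rw [hM 0 (by simp), par_zero, hf.uM_one, hf.uP_one]
    · have h1 : ¬ σ < -1 := by linarith
      simp [w, h1, not_le.2 h]
  have hparI : ∀ {σ : ℝ}, σ ∈ Icc (-1 : ℝ) 1 → Tendsto par (𝓝 σ) (𝓝[Icc 0 1] (par σ)) := by
    intro σ hσ
    refine tendsto_nhdsWithin_iff.2 ⟨contDiff_par.continuous.tendsto σ, ?_⟩
    have : ∀ᶠ τ in 𝓝 σ, τ ^ 2 < 2 :=
      (show Continuous fun σ : ℝ => σ ^ 2 by fun_prop).continuousAt.eventually_lt_const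
        (by nlinarith [hσ.1, hσ.2])
    filter_upwards [this] with τ h
    exact par_mem h.le
  refine ⟨w, fun σ hσ => ?_, hM, hP, by rw [w₁.deriv_eq]; exact d₁, by rw [w₂.deriv_eq]; exact d₂⟩
  rcases eq_or_lt_of_le hσ.1 with rfl | hσ1
  · exact h₁.congr_of_eventuallyEq w₁
  rcases lt_trichotomy σ 0 with hn | rfl | hp
  · have hμ := par_mem_Ioo hn.ne (show σ ^ 2 < 1 by nlinarith)
    have hμ' := Ioo_subset_Icc_self hμ
    obtain ⟨ψ, hψ, hev⟩ := hf.exists_smooth_root (hf.continuousOn_uM _ hμ')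
      (fun μ hμ => hf.root_uM hμ) hμ' (hf.nlU_uM_pos hμ).ne'
    refine (hψ.comp σ contDiff_par.contDiffAt).congr_of_eventuallyEq ?_
    filter_upwards [(hparI hσ).eventually hev, Ioo_mem_nhds hσ1 hn] with τ h1 h2
    rw [hM τ ⟨h2.1.le, h2.2.le⟩, h1]; rfl
  · exact h₂.congr_of_eventuallyEq w₂
  · have hμ : par σ ∈ Ico (0 : ℝ) 1 := by
      rcases eq_or_lt_of_le hσ.2 with rfl | h
      · simp [par_one]
      · exact Ioo_subset_Ico_self (par_mem_Ioo hp.ne' (by nlinarith))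
    have hμ' := Ico_subset_Icc_self hμ
    obtain ⟨ψ, hψ, hev⟩ := hf.exists_smooth_root (hf.continuousOn_uP _ hμ')
      (fun μ hμ => hf.root_uP hμ) hμ' (hf.nlU_uP_neg hμ).ne
    refine (hψ.comp σ contDiff_par.contDiffAt).congr_of_eventuallyEq ?_
    filter_upwards [(hparI hσ).eventually hev, Ioi_mem_nhds hp] with τ h1 h2
    have h3 : ¬ τ < -1 := by
      have : (0 : ℝ) < τ := h2
      linarith
    have h4 : ¬ τ ≤ 0 := not_le.2 h2
    simp [w, h3, h4, h1]

end Profile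

/-! ### The parametrized curve Γ and transversal directions -/

section Curve

/-- Symmetric states with `u₂ = u₃`, together with the parameter: `(u₁, u₂, u₄, μ)`. -/
abbrev Vec : Type := ℝ × ℝ × ℝ × ℝ

/-- The standard scalar product. -/
def dot (v y : Vec) : ℝ := v.1 * y.1 + v.2.1 * y.2.1 + v.2.2.1 * y.2.2.1 + v.2.2.2 * y.2.2.2

theorem dot_sub (v y z : Vec) : dot v (y - z) = dot v y - dot v z := by
  simp [dot]; ring

theorem dot_smul (v y : Vec) (r : ℝ) : dot v (r • y) = r * dot v y := by
  simp [dot]; ring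

theorem dot_self_pos {y : Vec} (hy : y ≠ 0) : 0 < dot y y := by
  obtain ⟨a, b, c, μ⟩ := y
  have ha := mul_self_nonneg a
  have hb := mul_self_nonneg b
  have hc := mul_self_nonneg c
  have hμ := mul_self_nonneg μ
  have h : 0 ≤ dot (a, b, c, μ) (a, b, c, μ) := by simp only [dot]; linarith
  refine lt_of_le_of_ne h fun h0 => hy ?_
  simp only [dot] at h0
  have ha : a = 0 := mul_self_eq_zero.1 (by linarith)
  have hb : b = 0 := mul_self_eq_zero.1 (by linarith)
  have hc : c = 0 := mul_self_eq_zero.1 (by linarith)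
  have hμ : μ = 0 := mul_self_eq_zero.1 (by linarith)
  simp [ha, hb, hc, hμ]

/-- What is used of the parametrization of the arc of roots. -/
structure IsProfile (uM uP w : ℝ → ℝ) : Prop where
  smooth : ∀ σ ∈ Icc (-1 : ℝ) 1, ContDiffAt ℝ ∞ w σ
  left : ∀ σ ∈ Icc (-1 : ℝ) 0, w σ = uM (par σ)
  right : ∀ σ ∈ Icc (0 : ℝ) 1, w σ = uP (par σ)
  deriv_pitchfork : 0 < deriv w (-1)
  deriv_fold : 0 < deriv w 0

/-- Smooth clock that runs from `0` to `1` on `[k, k + 1]`. -/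
def clock (k s : ℝ) : ℝ := Real.smoothTransition (s - k)

/-- Derivative of the clock. -/
def clock' (k s : ℝ) : ℝ := deriv Real.smoothTransition (s - k)

theorem clock_nonneg (k s : ℝ) : 0 ≤ clock k s := Real.smoothTransition.nonneg _

theorem clock_le_one (k s : ℝ) : clock k s ≤ 1 := Real.smoothTransition.le_one _

theorem clock_eq_zero {k s : ℝ} (h : s ≤ k) : clock k s = 0 :=
  Real.smoothTransition.zero_of_nonpos (by linarith)

theorem clock_eq_one {k s : ℝ} (h : k + 1 ≤ s) : clock k s = 1 :=
  Real.smoothTransition.one_of_one_le (by linarith)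

theorem clock_pos {k s : ℝ} (h : k < s) : 0 < clock k s :=
  Real.smoothTransition.pos_of_pos (by linarith)

theorem clock_lt_one {k s : ℝ} (h : s < k + 1) : clock k s < 1 :=
  Real.smoothTransition.lt_one_of_lt_one (by linarith)

theorem contDiff_clock (k : ℝ) : ContDiff ℝ ∞ (clock k) := by
  unfold clock
  exact Real.smoothTransition.contDiff.comp (by fun_prop)

theorem hasDerivAt_clock (k s : ℝ) : HasDerivAt (clock k) (clock' k s) s := by
  have h : DifferentiableAt ℝ Real.smoothTransition (s - k) :=
    (Real.smoothTransition.contDiff (n := 1)).differentiable (by simp) _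
  have h1 : HasDerivAt (clock k) _ s := h.hasDerivAt.comp s ((hasDerivAt_id s).sub_const k)
  exact h1.congr_deriv (by simp [clock'])

theorem clock'_pos {k s : ℝ} (h₀ : k < s) (h₁ : s < k + 1) : 0 < clock' k s :=
  deriv_smoothTransition_pos (by linarith) (by linarith)

/-- The clock attains its minimal value 0 at these times. -/
theorem clock'_eq_zero_left {k s : ℝ} (h : s ≤ k) : clock' k s = 0 := by
  have : IsLocalMin (clock k) s :=
    Eventually.of_forall fun t => by rw [clock_eq_zero h]; exact clock_nonneg k t
  exact this.hasDerivAt_eq_zero (hasDerivAt_clock k s)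

theorem clock'_eq_zero_right {k s : ℝ} (h : k + 1 ≤ s) : clock' k s = 0 := by
  have : IsLocalMax (clock k) s :=
    Eventually.of_forall fun t => by rw [clock_eq_one h]; exact clock_le_one k t
  exact this.hasDerivAt_eq_zero (hasDerivAt_clock k s)

theorem clock_strictMonoOn (k : ℝ) : StrictMonoOn (clock k) (Icc k (k + 1)) := by
  refine strictMonoOn_of_deriv_pos (convex_Icc _ _) (contDiff_clock k).continuous.continuousOn ?_
  intro s hs
  rw [interior_Icc] at hs
  rw [(hasDerivAt_clock k s).deriv]
  exact clock'_pos hs.1 hs.2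

/-- The curve `Γ` in the coordinates `(u₁, u₂, u₄, μ)`, parametrized by `[0, 4]`; its corners are at
`1, 2, 3`, where the parametrization stops to infinite order. -/
def curve (w : ℝ → ℝ) (s : ℝ) : Vec :=
  -- Each bracket is an increment that vanishes until its clock starts and is constant after it
  -- stops, so one smooth formula covers all four pieces. In the parameter the inactive summands
  -- vanish because `par` is 0 at ±1.
  (w (-1 + 2 * clock 0 s) + (w (1 - clock 1 s) - w 1) + (w (clock 2 s) - w 0) +
      (w (1 - clock 3 s) - w 1),
    w (-1 + clock 1 s + clock 2 s) + (w (1 - clock 3 s) - w 1),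
    w (-1 + clock 3 s),
    par (-1 + 2 * clock 0 s) + par (-1 + clock 1 s + clock 2 s) + par (-1 + clock 3 s))

/-- The velocity of `curve`. -/
def curve' (w : ℝ → ℝ) (s : ℝ) : Vec :=
  (deriv w (-1 + 2 * clock 0 s) * (2 * clock' 0 s) + deriv w (1 - clock 1 s) * (-clock' 1 s) +
      deriv w (clock 2 s) * clock' 2 s + deriv w (1 - clock 3 s) * (-clock' 3 s),
    deriv w (-1 + clock 1 s + clock 2 s) * (clock' 1 s + clock' 2 s) +
      deriv w (1 - clock 3 s) * (-clock' 3 s),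
    deriv w (-1 + clock 3 s) * clock' 3 s,
    (-4 * (-1 + 2 * clock 0 s) * (1 - (-1 + 2 * clock 0 s) ^ 2)) * (2 * clock' 0 s) +
      (-4 * (-1 + clock 1 s + clock 2 s) * (1 - (-1 + clock 1 s + clock 2 s) ^ 2)) *
        (clock' 1 s + clock' 2 s) +
      (-4 * (-1 + clock 3 s) * (1 - (-1 + clock 3 s) ^ 2)) * clock' 3 s)

variable {f : ℝ → ℝ → ℝ} {uM uP w : ℝ → ℝ}

theorem IsProfile.contDiff_comp (hw : IsProfile uM uP w) {κ : ℝ → ℝ} (hκ : ContDiff ℝ ∞ κ)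
    (h : ∀ s, κ s ∈ Icc (-1 : ℝ) 1) : ContDiff ℝ ∞ fun s => w (κ s) :=
  contDiff_iff_contDiffAt.2 fun s => (hw.smooth _ (h s)).comp s hκ.contDiffAt

theorem IsProfile.hasDerivAt_comp (hw : IsProfile uM uP w) {κ : ℝ → ℝ} {κ' s : ℝ}
    (hκ : HasDerivAt κ κ' s) (h : κ s ∈ Icc (-1 : ℝ) 1) :
    HasDerivAt (fun s => w (κ s)) (deriv w (κ s) * κ') s :=
  ((hw.smooth _ h).differentiableAt (by simp)).hasDerivAt.comp s hκ

theorem arg₀_mem (s : ℝ) : -1 + 2 * clock 0 s ∈ Icc (-1 : ℝ) 1 :=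
  ⟨by linarith [clock_nonneg 0 s], by linarith [clock_le_one 0 s]⟩

theorem arg₁_mem (s : ℝ) : -1 + clock 1 s + clock 2 s ∈ Icc (-1 : ℝ) 1 :=
  ⟨by linarith [clock_nonneg 1 s, clock_nonneg 2 s],
    by linarith [clock_le_one 1 s, clock_le_one 2 s]⟩

theorem arg₃_mem (s : ℝ) : -1 + clock 3 s ∈ Icc (-1 : ℝ) 1 :=
  ⟨by linarith [clock_nonneg 3 s], by linarith [clock_le_one 3 s]⟩

theorem clock_mem (k s : ℝ) : clock k s ∈ Icc (-1 : ℝ) 1 :=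
  ⟨by linarith [clock_nonneg k s], clock_le_one k s⟩

theorem one_sub_clock_mem (k s : ℝ) : 1 - clock k s ∈ Icc (-1 : ℝ) 1 :=
  ⟨by linarith [clock_le_one k s], by linarith [clock_nonneg k s]⟩

theorem IsProfile.contDiff_curve (hw : IsProfile uM uP w) : ContDiff ℝ ∞ (curve w) := by
  have c0 := contDiff_clock 0
  have c1 := contDiff_clock 1
  have c2 := contDiff_clock 2
  have c3 := contDiff_clock 3
  have := contDiff_par
  have h1 := hw.contDiff_comp (κ := fun s => -1 + 2 * clock 0 s) (by fun_prop) arg₀_mem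
  have h2 := hw.contDiff_comp (κ := fun s => 1 - clock 1 s) (by fun_prop) (one_sub_clock_mem 1)
  have h3 := hw.contDiff_comp (κ := fun s => clock 2 s) (by fun_prop) (clock_mem 2)
  have h4 := hw.contDiff_comp (κ := fun s => 1 - clock 3 s) (by fun_prop) (one_sub_clock_mem 3)
  have h5 := hw.contDiff_comp (κ := fun s => -1 + clock 1 s + clock 2 s) (by fun_prop) arg₁_mem
  have h6 := hw.contDiff_comp (κ := fun s => -1 + clock 3 s) (by fun_prop) arg₃_mem
  have p0 : ContDiff ℝ ∞ fun s => par (-1 + 2 * clock 0 s) := by fun_prop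
  have p1 : ContDiff ℝ ∞ fun s => par (-1 + clock 1 s + clock 2 s) := by fun_prop
  have p3 : ContDiff ℝ ∞ fun s => par (-1 + clock 3 s) := by fun_prop
  exact ((((h1.add (h2.sub contDiff_const)).add (h3.sub contDiff_const)).add
    (h4.sub contDiff_const))).prodMk ((h5.add (h4.sub contDiff_const)).prodMk
      (h6.prodMk ((p0.add p1).add p3)))

theorem IsProfile.hasDerivAt_curve (hw : IsProfile uM uP w) (s : ℝ) :
    HasDerivAt (curve w) (curve' w s) s := by
  have c0 := hasDerivAt_clock 0 s
  have c1 := hasDerivAt_clock 1 s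
  have c2 := hasDerivAt_clock 2 s
  have c3 := hasDerivAt_clock 3 s
  have k0 : HasDerivAt (fun s => -1 + 2 * clock 0 s) (2 * clock' 0 s) s :=
    (c0.const_mul 2).const_add _
  have k1 : HasDerivAt (fun s => -1 + clock 1 s + clock 2 s) (clock' 1 s + clock' 2 s) s :=
    (c1.const_add _).add c2
  have k3 : HasDerivAt (fun s => -1 + clock 3 s) (clock' 3 s) s := c3.const_add _
  have h1 := hw.hasDerivAt_comp k0 (arg₀_mem s)
  have h2 := hw.hasDerivAt_comp (c1.const_sub 1) (one_sub_clock_mem 1 s)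
  have h3 := hw.hasDerivAt_comp c2 (clock_mem 2 s)
  have h4 := hw.hasDerivAt_comp (c3.const_sub 1) (one_sub_clock_mem 3 s)
  have h5 := hw.hasDerivAt_comp k1 (arg₁_mem s)
  have h6 := hw.hasDerivAt_comp k3 (arg₃_mem s)
  have p0 : HasDerivAt (fun s => par (-1 + 2 * clock 0 s)) _ s := (hasDerivAt_par _).comp s k0
  have p1 : HasDerivAt (fun s => par (-1 + clock 1 s + clock 2 s)) _ s :=
    (hasDerivAt_par _).comp s k1
  have p3 : HasDerivAt (fun s => par (-1 + clock 3 s)) _ s := (hasDerivAt_par _).comp s k3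
  exact ((((h1.add (h2.sub_const _)).add (h3.sub_const _)).add (h4.sub_const _))).prodMk
    ((h5.add (h4.sub_const _)).prodMk (h6.prodMk ((p0.add p1).add p3)))

theorem IsProfile.deriv_curve (hw : IsProfile uM uP w) : deriv (curve w) = curve' w :=
  funext fun s => (hw.hasDerivAt_curve s).deriv

theorem IsProfile.contDiff_curve' (hw : IsProfile uM uP w) : ContDiff ℝ ∞ (curve' w) := by
  rw [← hw.deriv_curve]
  exact (contDiff_infty_iff_deriv.1 hw.contDiff_curve).2

theorem IsProfile.at_neg_one (hf : IsBistable f uM uP) (hw : IsProfile uM uP w) : w (-1) = 0 := by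
  rw [hw.left _ (by simp), par_neg_one, hf.uM_zero]

theorem IsProfile.at_zero (hf : IsBistable f uM uP) (hw : IsProfile uM uP w) : w 0 = 1 := by
  rw [hw.left _ (by simp), par_zero, hf.uM_one]

theorem IsProfile.at_one (hw : IsProfile uM uP w) : w 1 = uP 0 := by
  rw [hw.right _ (by simp), par_one]

theorem curve_of_le_one (hf : IsBistable f uM uP) (hw : IsProfile uM uP w) {s : ℝ} (h : s ≤ 1) :
    curve w s = (w (-1 + 2 * clock 0 s), 0, 0, par (-1 + 2 * clock 0 s)) := by
  simp [curve, clock_eq_zero h, clock_eq_zero (show s ≤ 2 by linarith),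
    clock_eq_zero (show s ≤ 3 by linarith), hw.at_neg_one hf, par_neg_one]

theorem curve_of_mem_Icc_one_two (hf : IsBistable f uM uP) (hw : IsProfile uM uP w) {s : ℝ}
    (h₁ : 1 ≤ s) (h₂ : s ≤ 2) :
    curve w s = (w (1 - clock 1 s), w (-1 + clock 1 s), 0, par (-1 + clock 1 s)) := by
  simp [curve, clock_eq_one (show (0 : ℝ) + 1 ≤ s by linarith), clock_eq_zero h₂,
    clock_eq_zero (show s ≤ 3 by linarith), hw.at_neg_one hf, par_neg_one]
  norm_num [par_one]

theorem curve_of_mem_Icc_two_three (hf : IsBistable f uM uP) (hw : IsProfile uM uP w) {s : ℝ}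
    (h₁ : 2 ≤ s) (h₂ : s ≤ 3) :
    curve w s = (w (clock 2 s), w (clock 2 s), 0, par (clock 2 s)) := by
  simp [curve, clock_eq_one (show (0 : ℝ) + 1 ≤ s by linarith),
    clock_eq_one (show (1 : ℝ) + 1 ≤ s by linarith),
    clock_eq_zero h₂, hw.at_neg_one hf, par_neg_one]
  norm_num [par_one]

theorem curve_of_three_le {s : ℝ} (h : 3 ≤ s) :
    curve w s =
      (w (1 - clock 3 s), w (1 - clock 3 s), w (-1 + clock 3 s), par (-1 + clock 3 s)) := by
  simp [curve, clock_eq_one (show (0 : ℝ) + 1 ≤ s by linarith),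
    clock_eq_one (show (1 : ℝ) + 1 ≤ s by linarith),
    clock_eq_one (show (2 : ℝ) + 1 ≤ s by linarith)]
  norm_num [par_one]

theorem IsProfile.root (hf : IsBistable f uM uP) (hw : IsProfile uM uP w) {σ : ℝ}
    (h : σ ∈ Icc (-1 : ℝ) 1) : f (w σ) (par σ) = 0 := by
  have hp : par σ ∈ Icc (0 : ℝ) 1 := par_mem (by nlinarith [h.1, h.2])
  rcases le_total σ 0 with h0 | h0
  · rw [hw.left σ ⟨h.1, h0⟩]; exact hf.root_uM hp
  · rw [hw.right σ ⟨h0, h.2⟩]; exact hf.root_uP hp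

theorem IsProfile.pos (hf : IsBistable f uM uP) (hw : IsProfile uM uP w) {σ : ℝ}
    (h : σ ∈ Ioc (-1 : ℝ) 1) : 0 < w σ := by
  have hp : par σ ∈ Icc (0 : ℝ) 1 := par_mem (by nlinarith [h.1, h.2])
  rcases lt_or_ge σ 0 with h0 | h0
  · rw [hw.left σ ⟨h.1.le, h0.le⟩]
    exact (hf.order _ (par_mem_Ioo h0.ne (by nlinarith [h.1]))).1
  · rw [hw.right σ ⟨h0, h.2⟩]; exact hf.uP_pos hp

theorem IsProfile.nonneg (hf : IsBistable f uM uP) (hw : IsProfile uM uP w) {σ : ℝ}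
    (h : σ ∈ Icc (-1 : ℝ) 1) : 0 ≤ w σ := by
  rcases eq_or_lt_of_le h.1 with rfl | h1
  · exact (hw.at_neg_one hf).ge
  · exact (hw.pos hf ⟨h1, h.2⟩).le

theorem IsProfile.root_symm (hf : IsBistable f uM uP) (hw : IsProfile uM uP w) {t : ℝ}
    (h : t ∈ Icc (0 : ℝ) 1) : f (w (1 - t)) (par (-1 + t)) = 0 := by
  have := hw.root hf (σ := 1 - t) ⟨by linarith [h.2], by linarith [h.1]⟩
  rwa [show par (1 - t) = par (-1 + t) by rw [← par_neg]; ring_nf] at this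

/-- All three entries of the curve are nonnegative roots. -/
theorem curve_roots (hf : IsBistable f uM uP) (hw : IsProfile uM uP w) (s : ℝ) :
    (f (curve w s).1 (curve w s).2.2.2 = 0 ∧ f (curve w s).2.1 (curve w s).2.2.2 = 0 ∧
      f (curve w s).2.2.1 (curve w s).2.2.2 = 0) ∧
    0 ≤ (curve w s).1 ∧ 0 ≤ (curve w s).2.1 ∧ 0 ≤ (curve w s).2.2.1 ∧
      (curve w s).2.2.2 ∈ Icc (0 : ℝ) 1 := by
  have hz := hf.zero_left
  have hpm : ∀ {σ : ℝ}, σ ∈ Icc (-1 : ℝ) 1 → par σ ∈ Icc (0 : ℝ) 1 := fun {σ} h =>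
    par_mem (by nlinarith [h.1, h.2])
  rcases le_total s 1 with h1 | h1
  · rw [curve_of_le_one hf hw h1]
    exact ⟨⟨hw.root hf (arg₀_mem s), hz _, hz _⟩, hw.nonneg hf (arg₀_mem s), le_rfl, le_rfl,
      hpm (arg₀_mem s)⟩
  have hc1 : clock 1 s ∈ Icc (0 : ℝ) 1 := ⟨clock_nonneg _ _, clock_le_one _ _⟩
  have hc3 : clock 3 s ∈ Icc (0 : ℝ) 1 := ⟨clock_nonneg _ _, clock_le_one _ _⟩
  rcases le_total s 2 with h2 | h2
  · rw [curve_of_mem_Icc_one_two hf hw h1 h2]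
    have hm : -1 + clock 1 s ∈ Icc (-1 : ℝ) 1 := ⟨by linarith [hc1.1], by linarith [hc1.2]⟩
    exact ⟨⟨hw.root_symm hf hc1, hw.root hf hm, hz _⟩, hw.nonneg hf (one_sub_clock_mem 1 s),
      hw.nonneg hf hm, le_rfl, hpm hm⟩
  rcases le_total s 3 with h3 | h3
  · rw [curve_of_mem_Icc_two_three hf hw h2 h3]
    have hm := clock_mem 2 s
    exact ⟨⟨hw.root hf hm, hw.root hf hm, hz _⟩, hw.nonneg hf hm, hw.nonneg hf hm, le_rfl, hpm hm⟩
  · rw [curve_of_three_le h3]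
    have hm := arg₃_mem s
    exact ⟨⟨hw.root_symm hf hc3, hw.root_symm hf hc3, hw.root hf hm⟩,
      hw.nonneg hf (one_sub_clock_mem 3 s), hw.nonneg hf (one_sub_clock_mem 3 s),
      hw.nonneg hf hm, hpm hm⟩

theorem curve'_corner {s : ℝ} (h : s = 1 ∨ s = 2 ∨ s = 3) : curve' w s = 0 := by
  have h0 : clock' 0 s = 0 := clock'_eq_zero_right (by rcases h with rfl | rfl | rfl <;> norm_num)
  have h3 : clock' 3 s = 0 := clock'_eq_zero_left (by rcases h with rfl | rfl | rfl <;> norm_num)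
  have h1 : clock' 1 s = 0 := by
    rcases h with rfl | rfl | rfl
    · exact clock'_eq_zero_left le_rfl
    · exact clock'_eq_zero_right (by norm_num)
    · exact clock'_eq_zero_right (by norm_num)
  have h2 : clock' 2 s = 0 := by
    rcases h with rfl | rfl | rfl
    · exact clock'_eq_zero_left (by norm_num)
    · exact clock'_eq_zero_left le_rfl
    · exact clock'_eq_zero_right (by norm_num)
  simp [curve', h0, h1, h2, h3]

/-- The fold of the first arc. -/
def foldTime : ℝ := 1 / 2

/-- The transition function equals 1/2 at 1/2, since numerator and complementary term agree there.
-/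
theorem arg_foldTime : -1 + 2 * clock 0 foldTime = 0 := by
  have : clock 0 foldTime = 1 / 2 := by
    have hp := Real.smoothTransition.pos_denom (1 / 2)
    rw [show (1 : ℝ) - 1 / 2 = 1 / 2 by norm_num] at hp
    simp only [clock, foldTime, Real.smoothTransition, sub_zero]
    rw [show (1 : ℝ) - 1 / 2 = 1 / 2 by norm_num]
    field_simp
    norm_num
  rw [this]; norm_num

theorem arg_foldTime_lt {s : ℝ} (h0 : 0 ≤ s) (h : s < foldTime) : -1 + 2 * clock 0 s < 0 := by
  have := clock_strictMonoOn 0 (a := s) (b := foldTime) ⟨h0, by unfold foldTime at h; linarith⟩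
    ⟨by norm_num [foldTime], by norm_num [foldTime]⟩ h
  linarith [arg_foldTime]

theorem lt_arg_foldTime {s : ℝ} (h : foldTime < s) (h1 : s ≤ 1) : 0 < -1 + 2 * clock 0 s := by
  have := clock_strictMonoOn 0 (a := foldTime) (b := s)
    ⟨by norm_num [foldTime], by norm_num [foldTime]⟩
    ⟨by unfold foldTime at h; linarith, by linarith⟩ h
  linarith [arg_foldTime]

theorem curve'_mem_Ioo_zero_one {s : ℝ} (h₁ : s < 1) :
    curve' w s = (deriv w (-1 + 2 * clock 0 s) * (2 * clock' 0 s), 0, 0,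
      (-4 * (-1 + 2 * clock 0 s) * (1 - (-1 + 2 * clock 0 s) ^ 2)) * (2 * clock' 0 s)) := by
  have a1 : clock' 1 s = 0 := clock'_eq_zero_left h₁.le
  have a2 : clock' 2 s = 0 := clock'_eq_zero_left (by linarith)
  have a3 : clock' 3 s = 0 := clock'_eq_zero_left (by linarith)
  simp [curve', a1, a2, a3]

theorem curve'_mem_Ioo_one_two {s : ℝ} (h₁ : 1 < s) (h₂ : s < 2) :
    curve' w s = (deriv w (1 - clock 1 s) * (-clock' 1 s), deriv w (-1 + clock 1 s) * clock' 1 s, 0,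
      (-4 * (-1 + clock 1 s) * (1 - (-1 + clock 1 s) ^ 2)) * clock' 1 s) := by
  have a0 : clock' 0 s = 0 := clock'_eq_zero_right (by linarith)
  have a2 : clock' 2 s = 0 := clock'_eq_zero_left h₂.le
  have b2 : clock 2 s = 0 := clock_eq_zero h₂.le
  have a3 : clock' 3 s = 0 := clock'_eq_zero_left (by linarith)
  simp [curve', a0, a2, b2, a3]

theorem curve'_mem_Ioo_two_three {s : ℝ} (h₁ : 2 < s) (h₂ : s < 3) :
    curve' w s = (deriv w (clock 2 s) * clock' 2 s, deriv w (clock 2 s) * clock' 2 s, 0,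
      (-4 * clock 2 s * (1 - clock 2 s ^ 2)) * clock' 2 s) := by
  have a0 : clock' 0 s = 0 := clock'_eq_zero_right (by linarith)
  have a1 : clock' 1 s = 0 := clock'_eq_zero_right (by linarith)
  have b1 : clock 1 s = 1 := clock_eq_one (by linarith)
  have a3 : clock' 3 s = 0 := clock'_eq_zero_left h₂.le
  simp [curve', a0, a1, b1, a3]

theorem curve'_mem_Ioo_three_four {s : ℝ} (h₁ : 3 < s) :
    curve' w s = (deriv w (1 - clock 3 s) * (-clock' 3 s), deriv w (1 - clock 3 s) * (-clock' 3 s),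
      deriv w (-1 + clock 3 s) * clock' 3 s,
      (-4 * (-1 + clock 3 s) * (1 - (-1 + clock 3 s) ^ 2)) * clock' 3 s) := by
  have a0 : clock' 0 s = 0 := clock'_eq_zero_right (by linarith)
  have a1 : clock' 1 s = 0 := clock'_eq_zero_right (by linarith)
  have a2 : clock' 2 s = 0 := clock'_eq_zero_right (by linarith)
  simp [curve', a0, a1, a2]

/-- Away from the corners and the first fold the parameter lies strictly between `0` and `1` and
moves with nonzero speed. -/
theorem curve_regular (hf : IsBistable f uM uP) (hw : IsProfile uM uP w) {s : ℝ}
    (hs : s ∈ Ioo (0 : ℝ) 4) (h1 : s ≠ 1) (h2 : s ≠ 2) (h3 : s ≠ 3) (hfold : s ≠ foldTime) :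
    (curve w s).2.2.2 ∈ Ioo (0 : ℝ) 1 ∧ (curve' w s).2.2.2 ≠ 0 := by
  have key : ∀ σ : ℝ, σ ≠ 0 → σ ^ 2 < 1 → -4 * σ * (1 - σ ^ 2) ≠ 0 := by
    intro σ h0 hlt
    have : 1 - σ ^ 2 ≠ 0 := by linarith
    positivity
  rcases lt_or_gt_of_ne h1 with h1 | h1
  · rw [curve_of_le_one hf hw h1.le, curve'_mem_Ioo_zero_one h1]
    have hne : -1 + 2 * clock 0 s ≠ 0 := by
      rcases lt_or_gt_of_ne hfold with h | h
      · exact (arg_foldTime_lt hs.1.le h).ne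
      · exact (lt_arg_foldTime h h1.le).ne'
    have hlt : (-1 + 2 * clock 0 s) ^ 2 < 1 := by
      nlinarith [clock_pos hs.1, clock_lt_one (show s < 0 + 1 by linarith)]
    exact ⟨par_mem_Ioo hne hlt, mul_ne_zero (key _ hne hlt)
      (by linarith [clock'_pos hs.1 (show s < 0 + 1 by linarith)])⟩
  rcases lt_or_gt_of_ne h2 with h2 | h2
  · rw [curve_of_mem_Icc_one_two hf hw h1.le h2.le, curve'_mem_Ioo_one_two h1 h2]
    have hc := clock_lt_one (show s < 1 + 1 by linarith)
    have hne : -1 + clock 1 s ≠ 0 := by linarith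
    have hlt : (-1 + clock 1 s) ^ 2 < 1 := by nlinarith [clock_pos h1]
    exact ⟨par_mem_Ioo hne hlt, mul_ne_zero (key _ hne hlt)
      (clock'_pos h1 (show s < 1 + 1 by linarith)).ne'⟩
  rcases lt_or_gt_of_ne h3 with h3 | h3
  · rw [curve_of_mem_Icc_two_three hf hw h2.le h3.le, curve'_mem_Ioo_two_three h2 h3]
    have hc := clock_lt_one (show s < 2 + 1 by linarith)
    have hne : clock 2 s ≠ 0 := (clock_pos h2).ne'
    have hlt : clock 2 s ^ 2 < 1 := by nlinarith [clock_pos h2]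
    exact ⟨par_mem_Ioo hne hlt, mul_ne_zero (key _ hne hlt)
      (clock'_pos h2 (show s < 2 + 1 by linarith)).ne'⟩
  · rw [curve_of_three_le h3.le, curve'_mem_Ioo_three_four h3]
    have hc := clock_lt_one (show s < 3 + 1 by linarith [hs.2])
    have hne : -1 + clock 3 s ≠ 0 := by linarith
    have hlt : (-1 + clock 3 s) ^ 2 < 1 := by nlinarith [clock_pos h3]
    exact ⟨par_mem_Ioo hne hlt, mul_ne_zero (key _ hne hlt)
      (clock'_pos h3 (show s < 3 + 1 by linarith [hs.2])).ne'⟩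

theorem curve_foldTime (hf : IsBistable f uM uP) (hw : IsProfile uM uP w) :
    curve w foldTime = (1, 0, 0, 1) := by
  rw [curve_of_le_one hf hw (by norm_num [foldTime]), arg_foldTime, hw.at_zero hf, par_zero]

theorem curve'_foldTime (hw : IsProfile uM uP w) :
    0 < (curve' w foldTime).1 ∧ (curve' w foldTime).2 = 0 := by
  rw [curve'_mem_Ioo_zero_one (by norm_num [foldTime]), arg_foldTime]
  refine ⟨mul_pos hw.deriv_fold ?_, by simp⟩
  have := clock'_pos (k := 0) (s := foldTime) (by norm_num [foldTime]) (by norm_num [foldTime])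
  linarith

/-- The set of regular times. -/
def regularTimes : Set ℝ := {s | s ∈ Ioo (0 : ℝ) 4 ∧ s ≠ 1 ∧ s ≠ 2 ∧ s ≠ 3}

/-- At the first fold μ is stationary but u₁ moves. At all other regular times μ itself moves. -/
theorem curve'_ne_zero (hf : IsBistable f uM uP) (hw : IsProfile uM uP w) {s : ℝ}
    (hs : s ∈ regularTimes) : curve' w s ≠ 0 := by
  by_cases h : s = foldTime
  · subst h
    intro h0
    have := (curve'_foldTime hw).1
    simp [h0] at this
  · intro h0
    exact (curve_regular hf hw hs.1 hs.2.1 hs.2.2.1 hs.2.2.2 h).2 (by simp [h0])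

/-- At regular times the kernel of the linearization at `d = 0` is spanned by the velocity. -/
theorem curve_kernel (hf : IsBistable f uM uP) (hw : IsProfile uM uP w) {s : ℝ}
    (hs : s ∈ regularTimes) {v y : Vec} (hv : 0 < dot v (curve' w s)) (hy : dot v y = 0)
    (ha : nlU f ((curve w s).1, (curve w s).2.2.2) * y.1 +
      nlM f ((curve w s).1, (curve w s).2.2.2) * y.2.2.2 = 0)
    (hb : nlU f ((curve w s).2.1, (curve w s).2.2.2) * y.2.1 +
      nlM f ((curve w s).2.1, (curve w s).2.2.2) * y.2.2.2 = 0)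
    (hc : nlU f ((curve w s).2.2.1, (curve w s).2.2.2) * y.2.2.1 +
      nlM f ((curve w s).2.2.1, (curve w s).2.2.2) * y.2.2.2 = 0) : y = 0 := by
  -- At the fold f_u vanishes for the first component while f_μ does not, which kills the μ-part of
  -- y. The stable components follow, and transversality removes what is left.
  by_cases hfold : s = foldTime
  · subst hfold
    rw [curve_foldTime hf hw] at ha hb hc
    obtain ⟨hpos, hzero⟩ := curve'_foldTime hw
    simp only at ha hb hc
    rw [hf.nlM_zero, zero_mul, add_zero] at hb hc
    have hU1 : nlU f (1, 1) = 0 := by rw [← hf.deriv_left]; exact hf.saddleNode_u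
    have hM1 : nlM f (1, 1) ≠ 0 := by
      rw [← (hf.hasDerivAt_right 1 1).deriv]; exact hf.saddleNode_μ
    rw [hU1, zero_mul, zero_add] at ha
    have hU0 := (hf.nlU_zero_neg (μ := 1) (by simp)).ne
    have y1 := (mul_eq_zero.1 ha).resolve_left hM1
    have y2 := (mul_eq_zero.1 hb).resolve_left hU0
    have y3 := (mul_eq_zero.1 hc).resolve_left hU0
    simp only [dot, y1, y2, y3, hzero, Prod.fst_zero, Prod.snd_zero, mul_zero, add_zero] at hy hv
    have hv1 : v.1 ≠ 0 := by
      rintro h0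
      simp [h0] at hv
    have y0 := (mul_eq_zero.1 hy).resolve_left hv1
    exact Prod.ext y0 (Prod.ext y2 (Prod.ext y3 y1))
  · obtain ⟨hμ, hμ'⟩ := curve_regular hf hw hs.1 hs.2.1 hs.2.2.1 hs.2.2.2 hfold
    obtain ⟨⟨ra, rb, rc⟩, pa, pb, pc, -⟩ := curve_roots hf hw s
    have na := hf.nlU_ne_zero hμ pa ra
    have nb := hf.nlU_ne_zero hμ pb rb
    have nc := hf.nlU_ne_zero hμ pc rc
    have hd := hw.hasDerivAt_curve s
    have da : HasDerivAt (fun s => (curve w s).1) (curve' w s).1 s := hd.fst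
    have db : HasDerivAt (fun s => (curve w s).2.1) (curve' w s).2.1 s := hd.snd.fst
    have dc : HasDerivAt (fun s => (curve w s).2.2.1) (curve' w s).2.2.1 s := hd.snd.snd.fst
    have dm : HasDerivAt (fun s => (curve w s).2.2.2) (curve' w s).2.2.2 s := hd.snd.snd.snd
    have za : (fun s => f (curve w s).1 (curve w s).2.2.2) = fun _ => 0 :=
      funext fun s => (curve_roots hf hw s).1.1
    have zb : (fun s => f (curve w s).2.1 (curve w s).2.2.2) = fun _ => 0 :=
      funext fun s => (curve_roots hf hw s).1.2.1
    have zc : (fun s => f (curve w s).2.2.1 (curve w s).2.2.2) = fun _ => 0 :=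
      funext fun s => (curve_roots hf hw s).1.2.2
    have ea := hf.hasDerivAt_comp da dm
    have eb := hf.hasDerivAt_comp db dm
    have ec := hf.hasDerivAt_comp dc dm
    rw [za] at ea
    rw [zb] at eb
    rw [zc] at ec
    have ea := ea.unique (hasDerivAt_const s 0)
    have eb := eb.unique (hasDerivAt_const s 0)
    have ec := ec.unique (hasDerivAt_const s 0)
    set g' := curve' w s
    -- Both y and the velocity lie in the kernel. Since f_u ≠ 0 in every component, a kernel vector
    -- is determined by its μ-part.
    have hsc : y = (y.2.2.2 / g'.2.2.2) • g' := by
      have solve : ∀ U M p q : ℝ, U ≠ 0 → U * p + M * y.2.2.2 = 0 → U * q + M * g'.2.2.2 = 0 →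
          p = y.2.2.2 / g'.2.2.2 * q := by
        intro U M p q hU h1 h2
        have : U * (p * g'.2.2.2 - y.2.2.2 * q) = 0 := by
          linear_combination g'.2.2.2 * h1 - y.2.2.2 * h2
        have := (mul_eq_zero.1 this).resolve_left hU
        field_simp
        linarith
      refine Prod.ext ?_ (Prod.ext ?_ (Prod.ext ?_ ?_))
      · exact solve _ _ _ _ na ha ea
      · exact solve _ _ _ _ nb hb eb
      · exact solve _ _ _ _ nc hc ec
      · simp only [Prod.smul_snd, smul_eq_mul]
        field_simp
    rw [hsc, dot_smul] at hy
    have h0 := (mul_eq_zero.1 hy).resolve_right hv.ne'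
    rw [h0, zero_smul] at hsc
    exact hsc

/-- Near the pitchfork u_- behaves like √μ and so moves faster than μ: the derivative of `par`
vanishes at -1 while that of w is positive. Thus u - μ increases along the arc. -/
theorem IsProfile.eventually_deriv_pitchfork (hw : IsProfile uM uP w) :
    ∀ᶠ σ in 𝓝 (-1 : ℝ), 0 < deriv w σ - -4 * σ * (1 - σ ^ 2) := by
  have h1 : ContinuousAt (deriv w) (-1) :=
    ((hw.smooth (-1) (by simp)).fderiv_right (m := 0) (by simp)).continuousAt.clm_apply
      continuousAt_const
  have h2 : ContinuousAt (fun σ : ℝ => deriv w σ - -4 * σ * (1 - σ ^ 2)) (-1) :=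
    h1.sub (Continuous.continuousAt (by fun_prop))
  refine h2.eventually_const_lt ?_
  simpa using hw.deriv_pitchfork

theorem IsProfile.eventually_deriv_fold (hw : IsProfile uM uP w) :
    ∀ᶠ σ in 𝓝 (0 : ℝ), 0 < deriv w σ := by
  have h1 : ContinuousAt (deriv w) 0 :=
    ((hw.smooth 0 (by simp)).fderiv_right (m := 0) (by simp)).continuousAt.clm_apply
      continuousAt_const
  exact h1.eventually_const_lt hw.deriv_fold

/-- A direction transversal to the curve near its corners. -/
def cornerDir (i : ℝ) : Vec := if i = 1 then (0, 1, 0, -1) else if i = 2 then (0, 1, 0, 0)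
  else (0, 0, 1, -1)

/-- Before the corner u₂ = 0 and μ decreases; after it u₂ = u_- grows faster than μ. So u₂ - μ
increases on both sides. -/
theorem eventually_cornerDir_one (hw : IsProfile uM uP w) :
    ∀ᶠ s in 𝓝 (1 : ℝ), s ∈ regularTimes → 0 < dot (cornerDir 1) (curve' w s) := by
  have hc : Tendsto (fun s => -1 + clock 1 s) (𝓝 1) (𝓝 (-1)) := by
    have := ((contDiff_clock 1).continuous.const_add (-1)).tendsto 1
    simpa [clock_eq_zero] using this
  filter_upwards [hc.eventually hw.eventually_deriv_pitchfork,
    Ioo_mem_nhds (show foldTime < 1 by norm_num [foldTime]) (show (1 : ℝ) < 2 by norm_num)]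
    with s h1 h2 hs
  rcases lt_or_gt_of_ne hs.2.1 with h | h
  · rw [curve'_mem_Ioo_zero_one h]
    have a1 := lt_arg_foldTime h2.1 h.le
    have a2 := clock'_pos hs.1.1 (show s < 0 + 1 by linarith)
    have a3 := clock_lt_one (show s < 0 + 1 by linarith)
    have a4 : 0 < 1 - (-1 + 2 * clock 0 s) ^ 2 := by nlinarith
    simp only [dot, cornerDir, if_true]
    have := mul_pos (mul_pos a1 a4) a2
    linarith
  · rw [curve'_mem_Ioo_one_two h h2.2]
    have a2 := clock'_pos h (show s < 1 + 1 by linarith [h2.2])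
    simp only [dot, cornerDir, if_true]
    have := mul_pos h1 a2
    linarith

/-- Here u₂ passes through the fold from u_- to u₊: it equals w at an argument that increases
through 0, where w has positive derivative. -/
theorem eventually_cornerDir_two (hw : IsProfile uM uP w) :
    ∀ᶠ s in 𝓝 (2 : ℝ), s ∈ regularTimes → 0 < dot (cornerDir 2) (curve' w s) := by
  have hc1 : Tendsto (fun s => -1 + clock 1 s) (𝓝 2) (𝓝 0) := by
    have := ((contDiff_clock 1).continuous.const_add (-1)).tendsto 2
    simpa [clock_eq_one (show (1 : ℝ) + 1 ≤ 2 by norm_num)] using this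
  have hc2 : Tendsto (fun s => clock 2 s) (𝓝 2) (𝓝 0) := by
    have := (contDiff_clock 2).continuous.tendsto 2
    simpa [clock_eq_zero] using this
  filter_upwards [hc1.eventually hw.eventually_deriv_fold, hc2.eventually hw.eventually_deriv_fold,
    Ioo_mem_nhds (show (1 : ℝ) < 2 by norm_num) (show (2 : ℝ) < 3 by norm_num)] with s h1 h2 h3 hs
  rcases lt_or_gt_of_ne hs.2.2.1 with h | h
  · rw [curve'_mem_Ioo_one_two h3.1 h]
    have := mul_pos h1 (clock'_pos h3.1 (show s < 1 + 1 by linarith))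
    norm_num [dot, cornerDir]
    simpa using this
  · rw [curve'_mem_Ioo_two_three h h3.2]
    have := mul_pos h2 (clock'_pos h (show s < 2 + 1 by linarith [h3.2]))
    norm_num [dot, cornerDir]
    simpa using this

/-- The mechanism of the first corner, with u₄ in the role of u₂. -/
theorem eventually_cornerDir_three (hw : IsProfile uM uP w) :
    ∀ᶠ s in 𝓝 (3 : ℝ), s ∈ regularTimes → 0 < dot (cornerDir 3) (curve' w s) := by
  have hc : Tendsto (fun s => -1 + clock 3 s) (𝓝 3) (𝓝 (-1)) := by
    have := ((contDiff_clock 3).continuous.const_add (-1)).tendsto 3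
    simpa [clock_eq_zero] using this
  filter_upwards [hc.eventually hw.eventually_deriv_pitchfork,
    Ioo_mem_nhds (show (2 : ℝ) < 3 by norm_num) (show (3 : ℝ) < 4 by norm_num)] with s h1 h2 hs
  have hd : cornerDir 3 = (0, 0, 1, -1) := by norm_num [cornerDir]
  rw [hd]
  rcases lt_or_gt_of_ne hs.2.2.2 with h | h
  · rw [curve'_mem_Ioo_two_three h2.1 h]
    have a1 := clock_pos h2.1
    have a2 := clock'_pos h2.1 (show s < 2 + 1 by linarith)
    have a3 := clock_lt_one (show s < 2 + 1 by linarith)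
    have a4 : 0 < 1 - clock 2 s ^ 2 := by nlinarith
    simp only [dot]
    have := mul_pos (mul_pos a1 a4) a2
    linarith
  · rw [curve'_mem_Ioo_three_four h]
    have a2 := clock'_pos h (show s < 3 + 1 by linarith [h2.2])
    simp only [dot]
    have := mul_pos h1 a2
    linarith

/-- Making a transversal direction constant near a point. -/
theorem exists_transversal_const {v γ : ℝ → Vec} (hv : ContDiff ℝ ∞ v) {S : Set ℝ}
    (hpos : ∀ s ∈ S, 0 < dot (v s) (γ s)) (c : ℝ) (e : Vec)
    (he : ∀ᶠ s in 𝓝 c, s ∈ S → 0 < dot e (γ s)) {ε : ℝ} (hε : 0 < ε) :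
    ∃ v' : ℝ → Vec, ContDiff ℝ ∞ v' ∧ (∀ s ∈ S, 0 < dot (v' s) (γ s)) ∧
      (∀ᶠ s in 𝓝 c, v' s = e) ∧ ∀ s, ε ≤ dist s c → v' s = v s := by
  obtain ⟨δ, hδ, hball⟩ := Metric.eventually_nhds_iff.1 he
  -- The support lies where e is already transversal, so the convex combination stays transversal.
  -- It also lies within ε of c, so the field is unchanged elsewhere.
  let χ : ContDiffBump c := ⟨min δ ε / 2, min δ ε, by positivity, by
    have : 0 < min δ ε := lt_min hδ hε
    linarith⟩
  refine ⟨fun s => (1 - χ s) • v s + χ s • e, ?_, fun s hs => ?_, ?_, fun s hs => ?_⟩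
  · have h1 : ContDiff ℝ ∞ fun s => χ s := χ.contDiff
    fun_prop
  · have h1 : dot ((1 - χ s) • v s + χ s • e) (γ s) =
        (1 - χ s) * dot (v s) (γ s) + χ s * dot e (γ s) := by
      simp [dot]; ring
    rw [h1]
    by_cases hd : dist s c < δ
    · have h2 := hball hd hs
      have h3 := hpos s hs
      have h4 := χ.nonneg (x := s)
      have h5 := χ.le_one (x := s)
      rcases eq_or_lt_of_le h4 with h6 | h6
      · rw [← h6]; simpa using h3
      · have := mul_pos h6 h2
        have := mul_nonneg (sub_nonneg.2 h5) h3.le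
        linarith
    · have : χ s = 0 := χ.zero_of_le_dist ((min_le_left _ _).trans (not_lt.1 hd))
      rw [this]; simpa using hpos s hs
  · filter_upwards [Metric.closedBall_mem_nhds c χ.rIn_pos] with s hs
    simp [χ.one_of_mem_closedBall hs]
  · have : χ s = 0 := χ.zero_of_le_dist ((min_le_right _ _).trans hs)
    simp [this]

/-- A smooth field of directions transversal to the curve, constant near the corners. -/
theorem exists_transversal (hf : IsBistable f uM uP) (hw : IsProfile uM uP w) :
    ∃ v : ℝ → Vec, ContDiff ℝ ∞ v ∧ (∀ s ∈ regularTimes, 0 < dot (v s) (curve' w s)) ∧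
      ∀ i : ℝ, i = 1 ∨ i = 2 ∨ i = 3 → ∀ᶠ s in 𝓝 i, v s = cornerDir i := by
  have hε : (0 : ℝ) < 1 / 2 := by norm_num
  -- The velocity itself is the initial field. Radius 1/2 keeps the modifications at the three
  -- corners from interfering.
  obtain ⟨v₁, s₁, p₁, e₁, -⟩ := exists_transversal_const hw.contDiff_curve'
    (S := regularTimes) (fun s hs => dot_self_pos (curve'_ne_zero hf hw hs)) 1 _
    (eventually_cornerDir_one hw) hε
  obtain ⟨v₂, s₂, p₂, e₂, o₂⟩ := exists_transversal_const s₁ p₁ 2 _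
    (eventually_cornerDir_two hw) hε
  obtain ⟨v₃, s₃, p₃, e₃, o₃⟩ := exists_transversal_const s₂ p₂ 3 _
    (eventually_cornerDir_three hw) hε
  have away : ∀ i j : ℝ, 1 ≤ dist i j → ∀ᶠ s in 𝓝 i, 1 / 2 ≤ dist s j := by
    intro i j hij
    filter_upwards [Metric.ball_mem_nhds i hε] with s hs
    have := dist_triangle_left i j s
    rw [Metric.mem_ball] at hs
    linarith
  refine ⟨v₃, s₃, p₃, ?_⟩
  rintro i (rfl | rfl | rfl)
  · filter_upwards [e₁, away 1 2 (by norm_num [Real.dist_eq]),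
      away 1 3 (by norm_num [Real.dist_eq])]
      with s h1 h2 h3
    rw [o₃ s h3, o₂ s h2, h1]
  · filter_upwards [e₂, away 2 3 (by norm_num [Real.dist_eq])] with s h1 h3
    rw [o₃ s h3, h1]
  · exact e₃

end Curve

/-! ### Scalar equations with a small source near the bifurcations -/

section LocalEstimates

variable {f : ℝ → ℝ → ℝ} {uM uP : ℝ → ℝ}

/-- A component at the pitchfork that is driven by a positive source `d κ`: only the branch with
`u > 0`, `μ > 0` survives, and its tangent is transversal to `u - μ = const`. -/
theorem IsBistable.driven_pitchfork (hf : IsBistable f uM uP) {κ₀ : ℝ} (hκ₀ : 0 < κ₀) :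
    ∃ K D : ℝ, 0 < K ∧ 0 < D ∧ ∀ E : ℝ, 0 < E →
      ∀ᶠ p : ℝ × ℝ in 𝓝 (0, 0), ∀ d κ : ℝ, 0 < d → κ₀ ≤ κ → 0 ≤ p.2 →
      0 ≤ p.1 + p.2 → d * κ + f p.1 p.2 = 0 →
      0 < p.1 ∧ 0 < p.2 ∧ d ≤ D * p.1 * p.2 ∧ p.1 ^ 2 ≤ D * p.2 ∧
      ∀ y m ρ : ℝ, |ρ| ≤ E * d * (|y| + |m|) → nlU f p * y + nlM f p * m + ρ = 0 →
        |y| + |m| ≤ K * |y - m| := by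
  obtain ⟨α, C, hα, hC, hev⟩ := hf.pitchfork_bounds
  set D : ℝ := C / κ₀ + C / α with hD
  have hDpos : 0 < D := by positivity
  -- K and D do not depend on E, which only shrinks the neighbourhood. This order is essential at
  -- the first corner, where E is chosen from a bound that depends on D.
  refine ⟨2 * (4 * C / α + 1) + 1, D, by positivity, hDpos, fun E hE => ?_⟩
  have e1 : ∀ᶠ p : ℝ × ℝ in 𝓝 (0, 0), C * p.1 < α / 2 :=
    (show Continuous fun p : ℝ × ℝ => C * p.1 by fun_prop).continuousAt.eventually_lt_const
      (by simp [hα])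
  have e2 : ∀ᶠ p : ℝ × ℝ in 𝓝 (0, 0), C * p.2 < α :=
    (show Continuous fun p : ℝ × ℝ => C * p.2 by fun_prop).continuousAt.eventually_lt_const
      (by simp [hα])
  have e3 : ∀ᶠ p : ℝ × ℝ in 𝓝 (0, 0), E * D * p.2 < α / 8 :=
    (show Continuous fun p : ℝ × ℝ => E * D * p.2 by fun_prop).continuousAt.eventually_lt_const
      (by simp [hα])
  filter_upwards [hev, e1, e2, e3] with p hp s1 s2 s3 d κ hd hκ hμ huμ heq
  obtain ⟨q₀, q₂, q₃, M, hfp, hU, hM, a1, a2, a3, a4, a5, a6, a7, a8⟩ := hp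
  obtain ⟨u, μ⟩ := p
  simp only at *
  have hdκ : 0 < d * κ := mul_pos hd (hκ₀.trans_le hκ)
  rw [hfp] at heq
  have hneg : u * (μ * q₀ + u ^ 2 * q₂) < 0 := by linarith
  -- For u ≤ 0 the sector gives |u| ≤ μ, so μ q₀ outweighs u² q₂ and f ≥ 0, against f = -dκ < 0.
  -- This excludes the branch near -u_-.
  have hupos : 0 < u := by
    by_contra hu
    have hu := not_lt.1 hu
    have h1 : u ^ 2 ≤ μ ^ 2 := by nlinarith
    have h2 : u ^ 2 * q₂ ≤ μ ^ 2 * C :=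
      mul_le_mul h1 a4 (by linarith) (by positivity)
    have h3 : μ * q₀ ≤ μ * (-α) := mul_le_mul_of_nonneg_left a2 hμ
    have h4 : μ * (C * μ) ≤ μ * α := mul_le_mul_of_nonneg_left s2.le hμ
    have h5 : μ * q₀ + u ^ 2 * q₂ ≤ 0 := by nlinarith
    have := mul_nonneg_of_nonpos_of_nonpos hu h5
    linarith
  have hneg' : μ * q₀ + u ^ 2 * q₂ < 0 := by
    by_contra hcon
    have := mul_nonneg hupos.le (not_lt.1 hcon)
    linarith
  have hu2 : 0 < u ^ 2 := by positivity
  have h1 : α * u ^ 2 ≤ C * μ := by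
    have h2 : u ^ 2 * α ≤ u ^ 2 * q₂ := mul_le_mul_of_nonneg_left a3 hu2.le
    have h3 : μ * (-C) ≤ μ * q₀ := mul_le_mul_of_nonneg_left a1 hμ
    linarith
  have hμpos : 0 < μ := by
    have : 0 < C * μ := lt_of_lt_of_le (by positivity) h1
    exact pos_of_mul_pos_right this hC.le
  have hd' : d ≤ D * u * μ := by
    have h2 : d * κ₀ ≤ d * κ := mul_le_mul_of_nonneg_left hκ hd.le
    have h3 : -(μ * q₀) ≤ μ * C := by nlinarith
    have h4 : 0 ≤ u ^ 2 * q₂ := mul_nonneg hu2.le (by linarith)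
    have h5 : d * κ ≤ u * (μ * C) := by
      have : u * (-(μ * q₀ + u ^ 2 * q₂)) ≤ u * (μ * C) :=
        mul_le_mul_of_nonneg_left (by linarith) hupos.le
      linarith
    have h6 : d ≤ C / κ₀ * u * μ := by
      have : d ≤ u * (μ * C) / κ₀ := (le_div_iff₀ hκ₀).2 (by linarith)
      calc d ≤ u * (μ * C) / κ₀ := this
        _ = C / κ₀ * u * μ := by ring
    have h7 : 0 ≤ C / α * u * μ := by positivity
    calc d ≤ C / κ₀ * u * μ + C / α * u * μ := by linarith
      _ = D * u * μ := by rw [hD]; ring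
  have hsq : u ^ 2 ≤ D * μ := by
    have h2 : u ^ 2 ≤ C / α * μ := by
      rw [div_mul_eq_mul_div, le_div_iff₀ hα]; linarith
    have h3 : 0 ≤ C / κ₀ * μ := by positivity
    calc u ^ 2 ≤ C / κ₀ * μ + C / α * μ := by linarith
      _ = D * μ := by rw [hD]; ring
  refine ⟨hupos, hμpos, hd', hsq, fun y m ρ hρ hlin => ?_⟩
  rw [hU, hM] at hlin
  set τ := y - m with hτ
  have hm : m = y - τ := by rw [hτ]; ring
  have hmabs : |m| ≤ |y| + |τ| := by rw [hm]; exact abs_sub y τ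
  -- `y (U + M) = M τ - ρ`
  have hy : y * ((-(μ * q₀ + u ^ 2 * q₃)) - u * M) = ρ - u * M * τ := by
    rw [hm] at hlin; linear_combination -hlin
  -- Everything in the identity scales with u: the factor of y is at least (α/2) u, that of τ at
  -- most C u, and ρ is small compared with u because d ≤ D u μ. Cancelling u leaves a bound
  -- independent of d.
  have hcoef : α / 2 * u ≤ (-(μ * q₀ + u ^ 2 * q₃)) - u * M := by
    have h2 : u * (u * q₃) ≤ u * (α / 2) := by
      refine mul_le_mul_of_nonneg_left ?_ hupos.le
      calc u * q₃ ≤ u * C := mul_le_mul_of_nonneg_left a6 hupos.le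
        _ ≤ α / 2 := by linarith
    have h3 : u * M ≤ u * (-α) := mul_le_mul_of_nonneg_left a8 hupos.le
    have h4 : μ * q₀ ≤ 0 := mul_nonpos_of_nonneg_of_nonpos hμ (by linarith)
    nlinarith
  have hMabs : |u * M * τ| ≤ u * C * |τ| := by
    rw [abs_mul, abs_mul, abs_of_pos hupos]
    have : |M| ≤ C := abs_le.2 ⟨by linarith, by linarith⟩
    gcongr
  have hρ' : |ρ| ≤ u * (α / 8) * (2 * |y| + |τ|) := by
    calc |ρ| ≤ E * d * (|y| + |m|) := hρ
      _ ≤ E * (D * u * μ) * (2 * |y| + |τ|) := by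
          have h2 : |y| + |m| ≤ 2 * |y| + |τ| := by linarith
          gcongr
      _ = u * (E * D * μ) * (2 * |y| + |τ|) := by ring
      _ ≤ u * (α / 8) * (2 * |y| + |τ|) := by gcongr
  have habs : α / 2 * u * |y| ≤ u * (α / 8) * (2 * |y| + |τ|) + u * C * |τ| := by
    have h2 : |y| * ((-(μ * q₀ + u ^ 2 * q₃)) - u * M) = |ρ - u * M * τ| := by
      rw [← hy, abs_mul, abs_of_nonneg (le_trans (by positivity) hcoef)]
    have h3 : α / 2 * u * |y| ≤ |y| * ((-(μ * q₀ + u ^ 2 * q₃)) - u * M) := by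
      rw [mul_comm |y|]; exact mul_le_mul_of_nonneg_right hcoef (abs_nonneg y)
    have h4 : |ρ - u * M * τ| ≤ |ρ| + |u * M * τ| := abs_sub _ _
    linarith
  have habs2 : α / 4 * |y| ≤ (C + α / 8) * |τ| := by
    have h2 : u * (α / 4 * |y|) ≤ u * ((C + α / 8) * |τ|) := by linarith
    exact le_of_mul_le_mul_left h2 hupos
  have hyb : |y| ≤ (4 * C / α + 1) * |τ| := by
    have h2 : |y| ≤ (C + α / 8) * |τ| / (α / 4) := (le_div_iff₀ (by positivity)).2 (by linarith)
    have h3 : (C + α / 8) * |τ| / (α / 4) = (4 * C / α + 1 / 2) * |τ| := by field_simp; ring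
    have := abs_nonneg τ
    linarith
  have := abs_nonneg τ
  linarith

/-- A stable component at the pitchfork that is coupled to a driven one: it is positive, stays
stable, and its tangent is controlled. -/
theorem IsBistable.slaved_pitchfork (hf : IsBistable f uM uP) {D : ℝ} (hD : 0 < D) :
    ∃ K : ℝ, 0 < K ∧ ∀ᶠ p : ℝ × ℝ in 𝓝 (0, 0), ∀ d b : ℝ, 0 < d → 0 < b → 0 < p.2 →
      d ≤ D * b * p.2 → b ^ 2 ≤ D * p.2 → 4 * d * (b - p.1) + f p.1 p.2 = 0 → nlU f p ≤ 0 →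
      0 < p.1 ∧ nlU f p < 0 ∧
      ∀ y r m : ℝ, 4 * d * (y - r) + nlU f p * r + nlM f p * m = 0 → |r| ≤ K * (|y| + |m|) := by
  obtain ⟨α, C, hα, hC, hev⟩ := hf.pitchfork_bounds
  set B : ℝ := 8 * D ^ 2 / α with hB
  have hBpos : 0 < B := by positivity
  refine ⟨1 + 2 * C * B / α, by positivity, ?_⟩
  have e1 : ∀ᶠ p : ℝ × ℝ in 𝓝 (0, 0), C * B ^ 2 * p.2 < α / 2 :=
    (show Continuous fun p : ℝ × ℝ => C * B ^ 2 * p.2 by fun_prop).continuousAt.eventually_lt_const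
      (by simp [hα])
  filter_upwards [hev, e1] with p hp s1 d b hd hb hμ hdb hb2 heq hUle
  obtain ⟨q₀, q₂, q₃, M, hfp, hU, hM, a1, a2, a3, a4, a5, a6, a7, a8⟩ := hp
  obtain ⟨c, μ⟩ := p
  simp only at *
  rw [hU] at hUle
  have hc2 : 0 ≤ c ^ 2 := sq_nonneg c
  -- From f_u ≤ 0 and 2 q₂ ≤ q₃ one gets c² q₂ ≤ -μ q₀/2, so at least half of the damping -μ q₀
  -- survives in -f/c.
  have hQ : α * μ / 2 ≤ -(μ * q₀ + c ^ 2 * q₂) := by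
    have h1 : c ^ 2 * (2 * q₂) ≤ c ^ 2 * q₃ := mul_le_mul_of_nonneg_left a5 hc2
    have h2 : μ * q₀ ≤ μ * (-α) := mul_le_mul_of_nonneg_left a2 hμ.le
    linarith
  set Q := -(μ * q₀ + c ^ 2 * q₂) with hQdef
  have hQpos : 0 < Q := lt_of_lt_of_le (by positivity) hQ
  have hcQ : c * (Q + 4 * d) = 4 * d * b := by rw [hfp] at heq; rw [hQdef]; linarith
  have hcpos : 0 < c := by
    have : 0 < c * (Q + 4 * d) := by rw [hcQ]; positivity
    exact pos_of_mul_pos_left this (by positivity)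
  -- The bounds on d and b make the source 4db at most 4D²μ². Dividing by the damping αμ/2 gives c =
  -- O(μ), which improves f_u ≤ 0 to f_u ≤ -αμ/2.
  have hcle : c ≤ B * μ := by
    have h1 : c * (α * μ / 2) ≤ 4 * d * b := by
      rw [← hcQ]; exact mul_le_mul_of_nonneg_left (by linarith) hcpos.le
    have h2 : 4 * d * b ≤ 4 * (D * b * μ) * b := by gcongr
    have h3 : 4 * (D * b * μ) * b = 4 * D * μ * b ^ 2 := by ring
    have h4 : 4 * D * μ * b ^ 2 ≤ 4 * D * μ * (D * μ) := by gcongr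
    have h5 : (c * α / 2) * μ ≤ (4 * D ^ 2 * μ) * μ := by linarith
    have h6 : c * α / 2 ≤ 4 * D ^ 2 * μ := le_of_mul_le_mul_right h5 hμ
    rw [hB, div_mul_eq_mul_div, le_div_iff₀ hα]
    linarith
  have hUneg : μ * q₀ + c ^ 2 * q₃ ≤ -(α * μ / 2) := by
    have h1 : c ^ 2 * q₃ ≤ (B * μ) ^ 2 * C := by
      have : 0 ≤ q₃ := by linarith
      gcongr
    have h2 : μ * q₀ ≤ μ * (-α) := mul_le_mul_of_nonneg_left a2 hμ.le
    have h3 : μ * (C * B ^ 2 * μ) ≤ μ * (α / 2) := mul_le_mul_of_nonneg_left s1.le hμ.le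
    nlinarith
  refine ⟨hcpos, ?_, fun y r m hlin => ?_⟩
  · rw [hU]
    have : 0 < α * μ / 2 := by positivity
    linarith
  rw [hU, hM] at hlin
  set A := 4 * d - (μ * q₀ + c ^ 2 * q₃) with hA
  have hAle : 4 * d + α * μ / 2 ≤ A := by rw [hA]; linarith
  have hAr : r * A = 4 * d * y + c * M * m := by rw [hA]; linear_combination -hlin
  have hApos : 0 < A := lt_of_lt_of_le (by positivity) hAle
  have hMabs : |M| ≤ C := abs_le.2 ⟨by linarith, by linarith⟩
  have h1 : |r| * A ≤ 4 * d * |y| + B * μ * C * |m| := by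
    calc |r| * A = |4 * d * y + c * M * m| := by rw [← hAr, abs_mul, abs_of_pos hApos]
      _ ≤ |4 * d * y| + |c * M * m| := abs_add_le _ _
      _ = 4 * d * |y| + c * |M| * |m| := by
          rw [abs_mul (4 * d), abs_mul (c * M), abs_mul c, abs_of_pos hcpos,
            abs_of_pos (by positivity : 0 < 4 * d)]
      _ ≤ 4 * d * |y| + B * μ * C * |m| := by gcongr
  have h2 : 4 * d * |y| ≤ |y| * A := by
    rw [mul_comm |y|]
    exact mul_le_mul_of_nonneg_right (by linarith [show 0 ≤ α * μ / 2 by positivity]) (abs_nonneg y)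
  -- The factor μ gained from c = O(μ) is absorbed by the damping, which is itself of order μ.
  have h3 : B * μ * C * |m| ≤ (2 * C * B / α * |m|) * A := by
    have : B * μ * C * |m| = (2 * C * B / α * |m|) * (α * μ / 2) := by field_simp
    rw [this]
    gcongr
    linarith
  have h4 : |r| * A ≤ (|y| + 2 * C * B / α * |m|) * A := by linarith
  have h5 := le_of_mul_le_mul_right h4 hApos
  have h6 : 0 ≤ 2 * C * B / α * |y| := by positivity
  have h7 := abs_nonneg m
  linarith

/-- The tangent of a linearly stable component. -/
theorem abs_le_of_stable {U M β C d y r m : ℝ} (hβ : 0 < β) (hU : U ≤ -β) (hM : |M| ≤ C)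
    (hd : 0 ≤ d) (h : 4 * d * (y - r) + U * r + M * m = 0) : |r| ≤ |y| + C / β * |m| := by
  have hC : 0 ≤ C := (abs_nonneg M).trans hM
  have hA : 0 < 4 * d - U := by linarith
  have hr : r * (4 * d - U) = 4 * d * y + M * m := by linear_combination -h
  have h1 : |r| * (4 * d - U) ≤ 4 * d * |y| + C * |m| := by
    calc |r| * (4 * d - U) = |4 * d * y + M * m| := by rw [← hr, abs_mul, abs_of_pos hA]
      _ ≤ |4 * d * y| + |M * m| := abs_add_le _ _
      _ = 4 * d * |y| + |M| * |m| := by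
          rw [abs_mul (4 * d), abs_mul M, abs_of_nonneg (by positivity : 0 ≤ 4 * d)]
      _ ≤ 4 * d * |y| + C * |m| := by gcongr
  have h2 : 4 * d * |y| ≤ |y| * (4 * d - U) := by
    rw [mul_comm |y|]; exact mul_le_mul_of_nonneg_right (by linarith) (abs_nonneg y)
  have h3 : C * |m| ≤ C / β * |m| * (4 * d - U) := by
    have : C * |m| = C / β * |m| * β := by field_simp
    rw [this]
    gcongr
    linarith
  have h4 : |r| * (4 * d - U) ≤ (|y| + C / β * |m|) * (4 * d - U) := by linarith
  exact le_of_mul_le_mul_right h4 hA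

/-- The tangent at the saddle-node, with `b` driven through the fold and `a` the upper root. -/
theorem abs_le_of_fold {Ua Ub Ma Mb α C K d ya yb yc m : ℝ} (hα : 0 < α) (hK : 0 < K)
    (hd : 0 < d) (hUa : Ua < 0) (hA : 4 * d - Ua ≤ 1) (hUb : |Ub| ≤ K * |Ua|)
    (hMa : Ma ≤ -α) (hMa' : |Ma| ≤ C) (hMb : Mb ≤ -α) {N : ℝ} (hdN : d * N ≤ α / 2)
    (hyc : |yc| ≤ |yb| + N * |m|) (h1 : 4 * d * (yb - ya) + Ua * ya + Ma * m = 0)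
    (h2 : d * (ya + yc - 2 * yb) + Ub * yb + Mb * m = 0) :
    |m| ≤ 2 / α * (1 + K) * |yb| ∧ |ya| ≤ (1 + C * (2 / α * (1 + K))) * |yb| := by
  set A := 4 * d - Ua with hAdef
  have hApos : 0 < A := by linarith
  have hya : ya * A = 4 * d * yb + Ma * m := by rw [hAdef]; linear_combination -h1
  have hya' : ya = (4 * d * yb + Ma * m) / A := by field_simp; linarith
  have hdA : 4 * d ≤ A := by linarith
  have hr : 4 * d / A ≤ 1 := (div_le_one hApos).2 hdA
  have hr0 : 0 ≤ 4 * d / A := by positivity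
  -- This eliminates ya. The two terms in the coefficient of m have the same sign, so it is at least
  -- α.
  have hm : m * (-Mb - Ma * (d / A)) = (d * (4 * d / A) - 2 * d + Ub) * yb + d * yc := by
    rw [hya'] at h2
    field_simp at h2 ⊢
    linear_combination -h2
  have hcoef : α ≤ -Mb - Ma * (d / A) := by
    have : 0 ≤ -Ma * (d / A) := mul_nonneg (by linarith) (by positivity)
    linarith
  have hmabs : α * |m| ≤ (3 * d + |Ub|) * |yb| + d * |yc| := by
    calc α * |m| ≤ |m| * (-Mb - Ma * (d / A)) := by
          rw [mul_comm]; exact mul_le_mul_of_nonneg_left hcoef (abs_nonneg m)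
      _ = |(d * (4 * d / A) - 2 * d + Ub) * yb + d * yc| := by
          rw [← hm, abs_mul, abs_of_pos (hα.trans_le hcoef)]
      _ ≤ |(d * (4 * d / A) - 2 * d + Ub) * yb| + |d * yc| := abs_add_le _ _
      _ = |d * (4 * d / A) - 2 * d + Ub| * |yb| + d * |yc| := by
          rw [abs_mul, abs_mul, abs_of_pos hd]
      _ ≤ (3 * d + |Ub|) * |yb| + d * |yc| := by
          have h3 : |d * (4 * d / A) - 2 * d + Ub| ≤ 3 * d + |Ub| := by
            have h4 : |d * (4 * d / A) - 2 * d| ≤ 3 * d := by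
              have := mul_le_mul_of_nonneg_left hr hd.le
              have := mul_nonneg hd.le hr0
              exact abs_le.2 ⟨by linarith, by linarith⟩
            exact (abs_add_le _ _).trans (by linarith)
          gcongr
  have hmabs2 : α / 2 * |m| ≤ (1 + K) * A * |yb| := by
    have h3 : d * |yc| ≤ d * |yb| + α / 2 * |m| := by
      calc d * |yc| ≤ d * (|yb| + N * |m|) := mul_le_mul_of_nonneg_left hyc hd.le
        _ = d * |yb| + d * N * |m| := by ring
        _ ≤ d * |yb| + α / 2 * |m| := by gcongr
    have h4 : 4 * d + |Ub| ≤ (1 + K) * A := by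
      rw [abs_of_neg hUa] at hUb
      have := mul_pos hK hd
      rw [hAdef]
      nlinarith
    have h5 := mul_le_mul_of_nonneg_right h4 (abs_nonneg yb)
    linarith
  -- The factor A has to be retained: the equation for ya carries the possibly tiny factor A on its
  -- left side, and the two cancel.
  have hm3 : |m| ≤ 2 / α * (1 + K) * A * |yb| := by
    have h3 : |m| ≤ (1 + K) * A * |yb| / (α / 2) := (le_div_iff₀ (by positivity)).2 (by linarith)
    calc |m| ≤ (1 + K) * A * |yb| / (α / 2) := h3
      _ = 2 / α * (1 + K) * A * |yb| := by field_simp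
  refine ⟨?_, ?_⟩
  · calc |m| ≤ 2 / α * (1 + K) * A * |yb| := hm3
      _ ≤ 2 / α * (1 + K) * 1 * |yb| := by gcongr
      _ = 2 / α * (1 + K) * |yb| := by ring
  · have hC : 0 ≤ C := (abs_nonneg Ma).trans hMa'
    have h3 : |ya| * A ≤ ((1 + C * (2 / α * (1 + K))) * |yb|) * A := by
      calc |ya| * A = |4 * d * yb + Ma * m| := by rw [← hya, abs_mul, abs_of_pos hApos]
        _ ≤ |4 * d * yb| + |Ma * m| := abs_add_le _ _
        _ = 4 * d * |yb| + |Ma| * |m| := by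
            rw [abs_mul (4 * d), abs_mul Ma, abs_of_pos (by positivity : 0 < 4 * d)]
        _ ≤ A * |yb| + C * (2 / α * (1 + K) * A * |yb|) := by gcongr
        _ = ((1 + C * (2 / α * (1 + K))) * |yb|) * A := by ring
    exact le_of_mul_le_mul_right h3 hApos

/-- Near a root with `f_u ≠ 0` there is at most one root for each `μ`. -/
theorem IsBistable.eventually_unique_root (hf : IsBistable f uM uP) {u₀ μ₀ : ℝ}
    (h0 : f u₀ μ₀ = 0) (hne : nlU f (u₀, μ₀) ≠ 0) :
    ∀ᶠ p : ℝ × ℝ × ℝ in 𝓝 (u₀, u₀, μ₀), f p.1 p.2.2 = 0 → f p.2.1 p.2.2 = 0 → p.1 = p.2.1 := by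
  have hF := hf.contDiff_nl
  let Φ : ℝ × ℝ → ℝ := fun p => nl f (p.2, p.1)
  have hΦ : ContDiff ℝ ∞ Φ := by fun_prop
  have hinj : ∀ y : ℝ, fderiv ℝ Φ (μ₀, u₀) (0, y) = 0 → y = 0 := by
    intro y hy
    have h1 : HasDerivAt (fun t => Φ (μ₀, t))
        (fderiv ℝ Φ (μ₀, u₀) (1, 0) * 0 + fderiv ℝ Φ (μ₀, u₀) (0, 1) * 1) u₀ :=
      hasDerivAt_comp_two (hΦ.differentiable (by simp)) (hasDerivAt_const _ μ₀) (hasDerivAt_id _)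
    have h2 := h1.unique (hf.hasDerivAt_left u₀ μ₀)
    have h3 : ((0, y) : ℝ × ℝ) = y • (0, 1) := by simp
    rw [h3, map_smul, smul_eq_mul] at hy
    rcases mul_eq_zero.1 hy with h | h
    · exact h
    · rw [h] at h2
      exact absurd (by linarith) hne
  obtain ⟨ψ, -, -, hev⟩ := exists_implicit_function (u := (μ₀, u₀)) hΦ.contDiffAt h0 hinj
  have t1 : Tendsto (fun p : ℝ × ℝ × ℝ => (p.2.2, p.1)) (𝓝 (u₀, u₀, μ₀)) (𝓝 (μ₀, u₀)) :=
    Continuous.tendsto (by fun_prop) _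
  have t2 : Tendsto (fun p : ℝ × ℝ × ℝ => (p.2.2, p.2.1)) (𝓝 (u₀, u₀, μ₀)) (𝓝 (μ₀, u₀)) :=
    Continuous.tendsto (by fun_prop) _
  filter_upwards [t1.eventually hev, t2.eventually hev] with p h1 h2 e1 e2
  exact (h1.1 e1).symm.trans (h2.1 e2)

/-- Near a root with `f_μ ≠ 0` there is at most one parameter for each `u`. -/
theorem IsBistable.eventually_unique_parameter (hf : IsBistable f uM uP) {u₀ μ₀ : ℝ}
    (h0 : f u₀ μ₀ = 0) (hne : nlM f (u₀, μ₀) ≠ 0) :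
    ∀ᶠ p : ℝ × ℝ × ℝ in 𝓝 (u₀, μ₀, μ₀), f p.1 p.2.1 = 0 → f p.1 p.2.2 = 0 → p.2.1 = p.2.2 := by
  have hF := hf.contDiff_nl
  have hinj : ∀ y : ℝ, fderiv ℝ (nl f) (u₀, μ₀) (0, y) = 0 → y = 0 := by
    intro y hy
    have h3 : ((0, y) : ℝ × ℝ) = y • (0, 1) := by simp
    rw [h3, map_smul, smul_eq_mul] at hy
    exact (mul_eq_zero.1 hy).resolve_right hne
  obtain ⟨ψ, -, -, hev⟩ := exists_implicit_function (u := (u₀, μ₀)) hF.contDiffAt h0 hinj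
  have t1 : Tendsto (fun p : ℝ × ℝ × ℝ => (p.1, p.2.1)) (𝓝 (u₀, μ₀, μ₀)) (𝓝 (u₀, μ₀)) :=
    Continuous.tendsto (by fun_prop) _
  have t2 : Tendsto (fun p : ℝ × ℝ × ℝ => (p.1, p.2.2)) (𝓝 (u₀, μ₀, μ₀)) (𝓝 (u₀, μ₀)) :=
    Continuous.tendsto (by fun_prop) _
  filter_upwards [t1.eventually hev, t2.eventually hev] with p h1 h2 e1 e2
  exact (h1.1 e1).symm.trans (h2.1 e2)

/-- A stable root near the pitchfork, for `μ ≥ 0`, is `0`. -/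
theorem IsBistable.eventually_stable_root_eq_zero (hf : IsBistable f uM uP) :
    ∀ᶠ p : ℝ × ℝ in 𝓝 (0, 0), f p.1 p.2 = 0 → nlU f p ≤ 0 → p.1 = 0 := by
  obtain ⟨α, C, hα, hC, hev⟩ := hf.pitchfork_bounds
  filter_upwards [hev] with p hp h0 hUle
  obtain ⟨q₀, q₂, q₃, M, hfp, hU, -, -, -, a3, -, a5, -⟩ := hp
  -- A root u ≠ 0 has μ q₀ = -u² q₂, hence f_u = u² (q₃ - q₂) > 0.
  by_contra hne
  rw [hfp] at h0
  have h1 := (mul_eq_zero.1 h0).resolve_left hne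
  rw [hU] at hUle
  have h2 : 0 < p.1 ^ 2 := by positivity
  have h3 : 0 < p.1 ^ 2 * (q₃ - q₂) := mul_pos h2 (by linarith)
  linarith

/-- Near the pitchfork a root in the admissible sector is determined by `u - μ`. -/
theorem IsBistable.eventually_unique_diagonal (hf : IsBistable f uM uP) :
    ∀ᶠ p : (ℝ × ℝ) × ℝ × ℝ in 𝓝 ((0, 0), 0, 0), f p.1.1 p.1.2 = 0 → f p.2.1 p.2.2 = 0 →
      0 ≤ p.1.2 → 0 ≤ p.2.2 → 0 ≤ p.1.1 + p.1.2 → 0 ≤ p.2.1 + p.2.2 →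
      p.1.1 - p.1.2 = p.2.1 - p.2.2 → p.1 = p.2 := by
  obtain ⟨α, C, hα, hC, hev⟩ := hf.pitchfork_bounds
  have e1 : ∀ᶠ p : ℝ × ℝ in 𝓝 (0, 0), C * p.1 < α :=
    (show Continuous fun p : ℝ × ℝ => C * p.1 by fun_prop).continuousAt.eventually_lt_const
      (by simp [hα])
  have e2 : ∀ᶠ p : ℝ × ℝ in 𝓝 (0, 0), C * p.2 < α :=
    (show Continuous fun p : ℝ × ℝ => C * p.2 by fun_prop).continuousAt.eventually_lt_const
      (by simp [hα])
  obtain ⟨r, hr, hball⟩ := Metric.eventually_nhds_iff.1 (hev.and (e1.and e2))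
  -- roots other than `0`
  have hroot : ∀ p : ℝ × ℝ, dist p (0, 0) < r → f p.1 p.2 = 0 → 0 ≤ p.2 → 0 ≤ p.1 + p.2 →
      p.1 ≠ 0 → 0 < p.1 ∧ 0 < p.1 - p.2 := by
    rintro ⟨u, μ⟩ hp h0 hμ huμ hne
    obtain ⟨⟨q₀, q₂, q₃, M, hfp, -, -, -, a2, a3, a4, -⟩, s1, s2⟩ := hball hp
    simp only at *
    rw [hfp] at h0
    have h1 := (mul_eq_zero.1 h0).resolve_left hne
    have hu2 : 0 < u ^ 2 := by positivity
    have h3 : μ * q₀ ≤ μ * (-α) := mul_le_mul_of_nonneg_left a2 hμ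
    have h2 : u ^ 2 * α ≤ u ^ 2 * q₂ := mul_le_mul_of_nonneg_left a3 hu2.le
    have h2' : u ^ 2 * q₂ ≤ u ^ 2 * C := mul_le_mul_of_nonneg_left a4 hu2.le
    have hpos : 0 < u := by
      by_contra hu
      have hu := not_lt.1 hu
      have hle : u ^ 2 ≤ μ ^ 2 := by nlinarith
      have hμ0 : 0 < μ := by
        rcases eq_or_lt_of_le hμ with h | h
        · rw [← h] at hle
          nlinarith
        · exact h
      have h4 : u ^ 2 * C ≤ μ ^ 2 * C := mul_le_mul_of_nonneg_right hle hC.le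
      have h5 : μ * (C * μ) < μ * α := mul_lt_mul_of_pos_left s2 hμ0
      nlinarith
    refine ⟨hpos, ?_⟩
    have h4 : α * μ ≤ u * (C * u) := by nlinarith
    have h5 : u * (C * u) < u * α := mul_lt_mul_of_pos_left s1 hpos
    have h6 : α * μ < α * u := by linarith
    linarith [lt_of_mul_lt_mul_left h6 hα.le]
  -- strict monotonicity of `f / u` along the diagonal
  have hmono : ∀ (u μ t : ℝ), dist ((u, μ) : ℝ × ℝ) (0, 0) < r →
      dist ((u + t, μ + t) : ℝ × ℝ) (0, 0) < r → 0 < u → 0 < t → f u μ = 0 →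
      f (u + t) (μ + t) = 0 → False := by
    intro u μ t h1 h2 hu ht z1 z2
    have hder : ∀ τ ∈ Icc 0 t, HasDerivAt (fun τ => f (u + τ) (μ + τ) / (u + τ))
        (((nlU f (u + τ, μ + τ) + nlM f (u + τ, μ + τ)) * (u + τ) - f (u + τ) (μ + τ)) /
          (u + τ) ^ 2) τ := by
      intro τ hτ
      have d1 : HasDerivAt (fun τ => u + τ) 1 τ := (hasDerivAt_id τ).const_add u
      have d2 : HasDerivAt (fun τ => μ + τ) 1 τ := (hasDerivAt_id τ).const_add μ
      refine ((hf.hasDerivAt_comp d1 d2).div d1 (by linarith [hτ.1])).congr_deriv ?_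
      ring
    have hanti : StrictAntiOn (fun τ => f (u + τ) (μ + τ) / (u + τ)) (Icc 0 t) := by
      refine strictAntiOn_of_deriv_neg (convex_Icc 0 t)
        (fun τ hτ => (hder τ hτ).continuousAt.continuousWithinAt) fun τ hτ => ?_
      rw [interior_Icc] at hτ
      have hτI := Ioo_subset_Icc_self hτ
      rw [(hder τ hτI).deriv]
      have hd : dist ((u + τ, μ + τ) : ℝ × ℝ) (0, 0) < r := by
        rw [Prod.dist_eq, max_lt_iff] at h1 h2 ⊢
        simp only [Real.dist_eq, sub_zero, abs_lt] at h1 h2 ⊢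
        exact ⟨⟨by linarith [hτ.1], by linarith [hτ.2]⟩, ⟨by linarith [hτ.1], by linarith [hτ.2]⟩⟩
      obtain ⟨⟨q₀, q₂, q₃, M, hfp, hU, hM, -, -, a3, -, a5, a6, -, a8⟩, s1, -⟩ := hball hd
      simp only at hfp hU hM s1
      have hv : 0 < u + τ := by linarith [hτ.1]
      refine div_neg_of_neg_of_pos ?_ (by positivity)
      -- The numerator equals u² (M + u (q₃ - q₂)) at the shifted point, and M ≤ -α dominates for
      -- small u.
      rw [hU, hM, hfp]
      have h3 : (u + τ) * (q₃ - q₂) < α := by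
        calc (u + τ) * (q₃ - q₂) ≤ (u + τ) * C :=
              mul_le_mul_of_nonneg_left (by linarith) hv.le
          _ < α := by linarith
      have h4 : M + (u + τ) * (q₃ - q₂) < 0 := by linarith
      have h5 := mul_neg_of_pos_of_neg (by positivity : 0 < (u + τ) ^ 2) h4
      nlinarith
    have := hanti (left_mem_Icc.2 ht.le) (right_mem_Icc.2 ht.le) ht
    simp [z1, z2] at this
  have hd : ∀ᶠ p : (ℝ × ℝ) × ℝ × ℝ in 𝓝 ((0, 0), 0, 0), dist p ((0, 0), 0, 0) < r :=
    Metric.ball_mem_nhds _ hr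
  filter_upwards [hd] with p hp z1 z2 m1 m2 s1 s2 heq
  obtain ⟨⟨u, μ⟩, u', μ'⟩ := p
  have hp1 : dist ((u, μ) : ℝ × ℝ) (0, 0) < r := (le_max_left _ _).trans_lt hp
  have hp2 : dist ((u', μ') : ℝ × ℝ) (0, 0) < r := (le_max_right _ _).trans_lt hp
  simp only at *
  -- The root 0 has u - μ ≤ 0 and nonzero roots in the sector have u - μ > 0. Equal values of u - μ
  -- thus force both roots to be of the same kind.
  by_cases h1 : u = 0
  · by_cases h2 : u' = 0
    · ext <;> simp only <;> linarith
    · have := hroot _ hp2 z2 m2 s2 h2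
      simp only at this
      linarith
  · have k1 := hroot _ hp1 z1 m1 s1 h1
    by_cases h2 : u' = 0
    · simp only at k1
      linarith
    · have k2 := hroot _ hp2 z2 m2 s2 h2
      simp only at k1 k2
      rcases lt_trichotomy u u' with h | h | h
      · have e1 : u + (u' - u) = u' := by ring
        have e2 : μ + (u' - u) = μ' := by linarith
        exact (hmono u μ (u' - u) hp1 (by rw [e1, e2]; exact hp2) k1.1 (by linarith) z1
          (by rw [e1, e2]; exact z2)).elim
      · ext <;> simp only <;> linarith
      · have e1 : u' + (u - u') = u := by ring
        have e2 : μ' + (u - u') = μ := by linarith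
        exact (hmono u' μ' (u - u') hp2 (by rw [e1, e2]; exact hp1) k2.1 (by linarith) z2
          (by rw [e1, e2]; exact z1)).elim

end LocalEstimates

/-! ### The reduced system and uniform tangent estimates at the corners -/

/-- The residual of the symmetric system. -/
def residual (f : ℝ → ℝ → ℝ) (d : ℝ) (x : Vec) : ℝ × ℝ × ℝ :=
  (4 * d * (x.2.1 - x.1) + f x.1 x.2.2.2,
    d * (x.1 + x.2.2.1 - 2 * x.2.1) + f x.2.1 x.2.2.2,
    4 * d * (x.2.1 - x.2.2.1) + f x.2.2.1 x.2.2.2)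

/-- The linearization of the symmetric system in the state and the parameter. -/
def linearized (f : ℝ → ℝ → ℝ) (d : ℝ) (x y : Vec) : ℝ × ℝ × ℝ :=
  (4 * d * (y.2.1 - y.1) + nlU f (x.1, x.2.2.2) * y.1 + nlM f (x.1, x.2.2.2) * y.2.2.2,
    d * (y.1 + y.2.2.1 - 2 * y.2.1) + nlU f (x.2.1, x.2.2.2) * y.2.1 +
      nlM f (x.2.1, x.2.2.2) * y.2.2.2,
    4 * d * (y.2.1 - y.2.2.1) + nlU f (x.2.2.1, x.2.2.2) * y.2.2.1 +
      nlM f (x.2.2.1, x.2.2.2) * y.2.2.2)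

section Corners

variable {f : ℝ → ℝ → ℝ} {uM uP : ℝ → ℝ}

theorem IsBistable.hasDerivAt_residual (hf : IsBistable f uM uP) {κ : ℝ → Vec} {y : Vec} {t : ℝ}
    (d : ℝ) (hκ : HasDerivAt κ y t) :
    HasDerivAt (fun t => residual f d (κ t)) (linearized f d (κ t) y) t := by
  have da : HasDerivAt (fun t => (κ t).1) y.1 t := hκ.fst
  have db : HasDerivAt (fun t => (κ t).2.1) y.2.1 t := hκ.snd.fst
  have dc : HasDerivAt (fun t => (κ t).2.2.1) y.2.2.1 t := hκ.snd.snd.fst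
  have dm : HasDerivAt (fun t => (κ t).2.2.2) y.2.2.2 t := hκ.snd.snd.snd
  have e1 := ((db.sub da).const_mul (4 * d)).add (hf.hasDerivAt_comp da dm)
  have e2 := (((da.add dc).sub (db.const_mul 2)).const_mul d).add (hf.hasDerivAt_comp db dm)
  have e3 := ((db.sub dc).const_mul (4 * d)).add (hf.hasDerivAt_comp dc dm)
  refine (e1.prodMk (e2.prodMk e3)).congr_deriv ?_
  simp only [linearized]
  refine Prod.ext ?_ (Prod.ext ?_ ?_) <;> simp only <;> ring

theorem vec_norm_le {y : Vec} {R : ℝ} (h1 : |y.1| ≤ R) (h2 : |y.2.1| ≤ R) (h3 : |y.2.2.1| ≤ R)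
    (h4 : |y.2.2.2| ≤ R) : ‖y‖ ≤ R :=
  max_le h1 (max_le h2 (max_le h3 h4))

theorem IsBistable.eventually_stable (hf : IsBistable f uM uP) {p₀ : ℝ × ℝ} (h : nlU f p₀ < 0) :
    ∃ β C : ℝ, 0 < β ∧ 0 < C ∧ ∀ᶠ p in 𝓝 p₀, nlU f p ≤ -β ∧ |nlM f p| ≤ C := by
  have c1 := hf.contDiff_nlU.continuous.continuousAt (x := p₀)
  have c2 := hf.contDiff_nlM.continuous.abs.continuousAt (x := p₀)
  refine ⟨-nlU f p₀ / 2, |nlM f p₀| + 1, by linarith, by positivity, ?_⟩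
  filter_upwards [c1.eventually_lt_const (show nlU f p₀ < nlU f p₀ / 2 by linarith),
    c2.eventually_lt_const (lt_add_one _)] with p h1 h2
  exact ⟨by linarith, h2.le⟩

/-- Near the corner `Ū⁽¹⁾(0) = W̄⁽²³⁾(0)` constrained solutions are nondegenerate. -/
theorem IsBistable.corner_one (hf : IsBistable f uM uP) :
    ∃ C : ℝ, 0 < C ∧ ∀ᶠ q : ℝ × Vec in 𝓝 (0, (uP 0, 0, 0, 0)), 0 < q.1 → residual f q.1 q.2 = 0 →
      0 ≤ q.2.2.2.2 → 0 ≤ q.2.2.1 + q.2.2.2.2 → nlU f (q.2.2.2.1, q.2.2.2.2) ≤ 0 →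
      0 < q.2.2.2.2 ∧ 0 < q.2.2.1 ∧ 0 < q.2.2.2.1 ∧ nlU f (q.2.1, q.2.2.2.2) < 0 ∧
      nlU f (q.2.2.2.1, q.2.2.2.2) < 0 ∧
      ∀ y, linearized f q.1 q.2 y = 0 → ‖y‖ ≤ C * |dot (cornerDir 1) y| := by
  have hu := hf.uP_zero
  obtain ⟨β, N, hβ, hN, hst⟩ := hf.eventually_stable (hf.nlU_uP_neg (μ := 0) (by simp))
  obtain ⟨K, D, hK, hD, hdr⟩ := hf.driven_pitchfork (κ₀ := uP 0 / 2) (by linarith)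
  obtain ⟨L, hL, hsl⟩ := hf.slaved_pitchfork hD
  have hNβ : 0 < N / β := by positivity
  -- The coupling term d (ya + yc - 2 yb) is at most d ((1 + N/β) + L + 2)(|yb| + |m|).
  have hdr := hdr (3 + N / β + L) (by positivity)
  refine ⟨K * (1 + N / β + L), by positivity, ?_⟩
  have t1 : Tendsto (fun q : ℝ × Vec => (q.2.1, q.2.2.2.2)) (𝓝 (0, (uP 0, 0, 0, 0)))
      (𝓝 (uP 0, 0)) := Continuous.tendsto' (by fun_prop) _ _ rfl
  have t2 : Tendsto (fun q : ℝ × Vec => (q.2.2.1, q.2.2.2.2)) (𝓝 (0, (uP 0, 0, 0, 0)))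
      (𝓝 (0, 0)) := Continuous.tendsto' (by fun_prop) _ _ rfl
  have t3 : Tendsto (fun q : ℝ × Vec => (q.2.2.2.1, q.2.2.2.2)) (𝓝 (0, (uP 0, 0, 0, 0)))
      (𝓝 (0, 0)) := Continuous.tendsto' (by fun_prop) _ _ rfl
  -- This is the source κ in the second equation. It is close to u₊(0) > 0.
  have t4 : Tendsto (fun q : ℝ × Vec => q.2.1 + q.2.2.2.1 - 2 * q.2.2.1)
      (𝓝 (0, (uP 0, 0, 0, 0))) (𝓝 (uP 0)) := Continuous.tendsto' (by fun_prop) _ _ (by simp)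
  filter_upwards [t1.eventually hst, t2.eventually hdr, t3.eventually hsl,
    t4.eventually_const_lt (show uP 0 / 2 < uP 0 by linarith)]
  rintro ⟨d, a, b, c, μ⟩ e1 e2 e3 e4 hd hres hμ hbμ hUc
  simp only [residual, Prod.mk_eq_zero] at *
  obtain ⟨ra, rb, rc⟩ := hres
  obtain ⟨hb, hμ, hdb, hb2, hlin⟩ := e2 d _ hd e4.le hμ hbμ rb
  obtain ⟨hc, hUc, hlinc⟩ := e3 d b hd hb hμ hdb hb2 rc hUc
  refine ⟨hμ, hb, hc, by linarith, hUc, ?_⟩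
  rintro ⟨ya, yb, yc, m⟩ hy
  simp only [linearized, Prod.mk_eq_zero] at hy
  obtain ⟨la, lb, lc⟩ := hy
  have hya := abs_le_of_stable hβ e1.1 e1.2 hd.le la
  have hyc := hlinc _ _ _ lc
  have hb0 := abs_nonneg yb
  have hm0 := abs_nonneg m
  have key : ∀ z : ℝ, 0 ≤ z → z * |yb| ≤ z * (|yb| + |m|) := fun z hz => by nlinarith
  have key' : ∀ z : ℝ, 0 ≤ z → z * |m| ≤ z * (|yb| + |m|) := fun z hz => by nlinarith
  have hya' : |ya| ≤ (1 + N / β) * (|yb| + |m|) := by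
    have := key' _ hNβ.le
    linarith
  have hτ : |yb| + |m| ≤ K * |yb - m| := by
    refine hlin yb m (d * (ya + yc - 2 * yb)) ?_ (by linarith)
    rw [abs_mul, abs_of_pos hd, mul_comm _ d, mul_assoc]
    refine mul_le_mul_of_nonneg_left ?_ hd.le
    have h1 : |ya + yc - 2 * yb| ≤ |ya| + |yc| + 2 * |yb| := by
      refine (abs_sub _ _).trans ?_
      rw [abs_mul 2, abs_two]
      linarith [abs_add_le ya yc]
    have := key 2 (by norm_num)
    linarith
  have hdot : dot (cornerDir 1) (ya, yb, yc, m) = yb - m := by simp [dot, cornerDir]; ring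
  rw [hdot]
  have hmul : ∀ z ≤ 1 + N / β + L, z * (|yb| + |m|) ≤ K * (1 + N / β + L) * |yb - m| := by
    intro z hz
    calc z * (|yb| + |m|) ≤ (1 + N / β + L) * (|yb| + |m|) := by gcongr
      _ ≤ (1 + N / β + L) * (K * |yb - m|) := by gcongr
      _ = _ := by ring
  have h1 := hmul 1 (by linarith)
  exact vec_norm_le (hya'.trans (hmul _ (by linarith))) (by simp only; linarith)
    (hyc.trans (hmul _ (by linarith))) (by simp only; linarith)

/-- Near the corner `Ū⁽³⁾(0) = V̄⁽⁴⁾(0)` constrained solutions are nondegenerate. -/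
theorem IsBistable.corner_three (hf : IsBistable f uM uP) :
    ∃ C : ℝ, 0 < C ∧ ∀ᶠ q : ℝ × Vec in 𝓝 (0, (uP 0, uP 0, 0, 0)), 0 < q.1 →
      residual f q.1 q.2 = 0 → 0 ≤ q.2.2.2.2 → 0 ≤ q.2.2.2.1 + q.2.2.2.2 →
      0 < q.2.2.2.2 ∧ 0 < q.2.2.1 ∧ 0 < q.2.2.2.1 ∧ nlU f (q.2.1, q.2.2.2.2) < 0 ∧
      ∀ y, linearized f q.1 q.2 y = 0 → ‖y‖ ≤ C * |dot (cornerDir 3) y| := by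
  have hu := hf.uP_zero
  obtain ⟨β, N, hβ, hN, hst⟩ := hf.eventually_stable (hf.nlU_uP_neg (μ := 0) (by simp))
  obtain ⟨K, D, hK, hD, hdr⟩ := hf.driven_pitchfork (κ₀ := uP 0 / 2) (by linarith)
  have hNβ : 0 < N / β := by positivity
  -- The coupling term is 4d (yb - yc), and |yb| + |yc| is at most (2 + 2 N/β)(|yc| + |m|).
  have hdr := hdr (8 + 8 * (N / β)) (by positivity)
  refine ⟨K * (1 + 3 * (N / β)), by positivity, ?_⟩
  have t1 : Tendsto (fun q : ℝ × Vec => (q.2.1, q.2.2.2.2)) (𝓝 (0, (uP 0, uP 0, 0, 0)))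
      (𝓝 (uP 0, 0)) := Continuous.tendsto' (by fun_prop) _ _ rfl
  have t2 : Tendsto (fun q : ℝ × Vec => (q.2.2.1, q.2.2.2.2)) (𝓝 (0, (uP 0, uP 0, 0, 0)))
      (𝓝 (uP 0, 0)) := Continuous.tendsto' (by fun_prop) _ _ rfl
  have t3 : Tendsto (fun q : ℝ × Vec => (q.2.2.2.1, q.2.2.2.2)) (𝓝 (0, (uP 0, uP 0, 0, 0)))
      (𝓝 (0, 0)) := Continuous.tendsto' (by fun_prop) _ _ rfl
  have t4 : Tendsto (fun q : ℝ × Vec => 4 * (q.2.2.1 - q.2.2.2.1))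
      (𝓝 (0, (uP 0, uP 0, 0, 0))) (𝓝 (4 * uP 0)) :=
    Continuous.tendsto' (by fun_prop) _ _ (by simp)
  have t5 : Tendsto (fun q : ℝ × Vec => q.2.2.1) (𝓝 (0, (uP 0, uP 0, 0, 0))) (𝓝 (uP 0)) :=
    Continuous.tendsto' (by fun_prop) _ _ rfl
  filter_upwards [t1.eventually hst, t2.eventually hst, t3.eventually hdr,
    t4.eventually_const_lt (show uP 0 / 2 < 4 * uP 0 by linarith), t5.eventually_const_lt hu]
  rintro ⟨d, a, b, c, μ⟩ e1 e2 e3 e4 e5 hd hres hμ hcμ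
  simp only [residual, Prod.mk_eq_zero] at *
  obtain ⟨ra, rb, rc⟩ := hres
  obtain ⟨hc, hμ, -, -, hlin⟩ := e3 d _ hd e4.le hμ hcμ (by linarith)
  refine ⟨hμ, e5, hc, by linarith, ?_⟩
  rintro ⟨ya, yb, yc, m⟩ hy
  simp only [linearized, Prod.mk_eq_zero] at hy
  obtain ⟨la, lb, lc⟩ := hy
  have hya := abs_le_of_stable hβ e1.1 e1.2 hd.le la
  have hc0 := abs_nonneg yc
  have hm0 := abs_nonneg m
  -- The tangents of the two stable components are coupled. Inserting the bound for ya costs d |yb|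
  -- of the damping 2d + β and leaves d + β.
  have hyb : |yb| ≤ |yc| + 2 * (N / β) * |m| := by
    set U := nlU f (b, μ)
    set M := nlM f (b, μ)
    have hA : 0 < 2 * d - U := by linarith
    have h1 : |yb| * (2 * d - U) ≤ d * (|ya| + |yc|) + N * |m| := by
      have h2 : yb * (2 * d - U) = d * (ya + yc) + M * m := by linear_combination -lb
      calc |yb| * (2 * d - U) = |d * (ya + yc) + M * m| := by rw [← h2, abs_mul, abs_of_pos hA]
        _ ≤ |d * (ya + yc)| + |M * m| := abs_add_le _ _
        _ = d * |ya + yc| + |M| * |m| := by rw [abs_mul d, abs_mul M, abs_of_pos hd]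
        _ ≤ _ := by
          have := abs_add_le ya yc
          have := e2.2
          gcongr
    have h3 : |yb| * (d + β) ≤ (|yc| + 2 * (N / β) * |m|) * (d + β) := by
      have h4 : |yb| * (2 * d + β) ≤ |yb| * (2 * d - U) :=
        mul_le_mul_of_nonneg_left (by linarith) (abs_nonneg yb)
      have h5 : d * |ya| ≤ d * (|yb| + N / β * |m|) := mul_le_mul_of_nonneg_left hya hd.le
      have h6 : N / β * β = N := by field_simp
      have h7 : N * |m| = N / β * β * |m| := by rw [h6]
      have h8 : 0 ≤ |yc| * β := by positivity
      have h9 : 0 ≤ d * (N / β * |m|) := by positivity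
      have h10 : 0 ≤ N * |m| := by positivity
      linarith
    exact le_of_mul_le_mul_right h3 (by linarith)
  have hτ : |yc| + |m| ≤ K * |yc - m| := by
    refine hlin yc m (4 * d * (yb - yc)) ?_ (by linarith)
    rw [abs_mul, abs_of_pos (by positivity : 0 < 4 * d)]
    have h1 : |yb - yc| ≤ |yb| + |yc| := abs_sub _ _
    have h2 : |yb| + |yc| ≤ (2 + 2 * (N / β)) * (|yc| + |m|) := by
      have : 0 ≤ N / β * |yc| := by positivity
      linarith
    calc 4 * d * |yb - yc| ≤ 4 * d * ((2 + 2 * (N / β)) * (|yc| + |m|)) := by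
          have := h1.trans h2
          gcongr
      _ = _ := by ring
  have hdot : dot (cornerDir 3) (ya, yb, yc, m) = yc - m := by norm_num [dot, cornerDir]; ring
  rw [hdot]
  have hmul : (1 + 3 * (N / β)) * (|yc| + |m|) ≤ K * (1 + 3 * (N / β)) * |yc - m| := by
    calc (1 + 3 * (N / β)) * (|yc| + |m|) ≤ (1 + 3 * (N / β)) * (K * |yc - m|) := by gcongr
      _ = _ := by ring
  have h1 : 0 ≤ N / β * |yc| := by positivity
  have h2 : 0 ≤ N / β * |m| := by positivity
  exact vec_norm_le (by simp only; linarith) (by simp only; linarith) (by simp only; linarith)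
    (by simp only; linarith)

/-- Near the corner `W̄⁽²³⁾(1) = Ū⁽³⁾(1)` constrained solutions are nondegenerate. -/
theorem IsBistable.corner_two (hf : IsBistable f uM uP) :
    ∃ C : ℝ, 0 < C ∧ ∀ᶠ q : ℝ × Vec in 𝓝 (0, (1, 1, 0, 1)), 0 < q.1 →
      residual f q.1 q.2 = 0 → nlU f (q.2.1, q.2.2.2.2) ≤ 0 →
      q.2.2.2.2 < 1 ∧ nlU f (q.2.1, q.2.2.2.2) < 0 ∧
      ∀ y, linearized f q.1 q.2 y = 0 → ‖y‖ ≤ C * |dot (cornerDir 2) y| := by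
  obtain ⟨β, N, hβ, hN, hst⟩ := hf.eventually_stable (hf.nlU_zero_neg (μ := 1) (by simp))
  obtain ⟨α, C, hα, hC, hexp, hM⟩ := hf.saddleNode_bounds
  have hU1 : nlU f (1, 1) = 0 := by rw [← hf.deriv_left]; exact hf.saddleNode_u
  have hNβ : 0 < N / β := by positivity
  have hUc := hf.contDiff_nlU.continuous
  set K := 1 + C / α with hK
  have hKpos : 0 < K := by positivity
  set L := 2 / α * (1 + K) with hL
  have hLpos : 0 < L := by positivity
  refine ⟨1 + C * L + L + N / β * L, by positivity, ?_⟩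
  have t1 : Tendsto (fun q : ℝ × Vec => (q.2.1, q.2.2.1, q.2.2.2.2)) (𝓝 (0, (1, 1, 0, 1)))
      (𝓝 (1, 1, 1)) := Continuous.tendsto' (by fun_prop) _ _ rfl
  have t2 : Tendsto (fun q : ℝ × Vec => (q.2.1, q.2.2.2.2)) (𝓝 (0, (1, 1, 0, 1)))
      (𝓝 (1, 1)) := Continuous.tendsto' (by fun_prop) _ _ rfl
  have t3 : Tendsto (fun q : ℝ × Vec => (q.2.2.1, q.2.2.2.2)) (𝓝 (0, (1, 1, 0, 1)))
      (𝓝 (1, 1)) := Continuous.tendsto' (by fun_prop) _ _ rfl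
  have t4 : Tendsto (fun q : ℝ × Vec => (q.2.2.2.1, q.2.2.2.2)) (𝓝 (0, (1, 1, 0, 1)))
      (𝓝 (0, 1)) := Continuous.tendsto' (by fun_prop) _ _ rfl
  have t5 : Tendsto (fun q : ℝ × Vec => 6 * q.2.2.1 - 5 * q.2.1 - q.2.2.2.1)
      (𝓝 (0, (1, 1, 0, 1))) (𝓝 1) := Continuous.tendsto' (by fun_prop) _ _ (by norm_num)
  have t6 : Tendsto (fun q : ℝ × Vec => 2 * q.2.2.1 - q.2.1 - q.2.2.2.1)
      (𝓝 (0, (1, 1, 0, 1))) (𝓝 1) := Continuous.tendsto' (by fun_prop) _ _ (by norm_num)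
  have t7 : Tendsto (fun q : ℝ × Vec => 4 * q.1 - nlU f (q.2.1, q.2.2.2.2))
      (𝓝 (0, (1, 1, 0, 1))) (𝓝 0) :=
    Continuous.tendsto' (by fun_prop) _ _ (by simp [hU1])
  have t8 : Tendsto (fun q : ℝ × Vec => q.1 * (N / β)) (𝓝 (0, (1, 1, 0, 1))) (𝓝 0) :=
    Continuous.tendsto' (by fun_prop) _ _ (by simp)
  filter_upwards [t1.eventually hexp, t2.eventually hM, t3.eventually hM, t4.eventually hst,
    t5.eventually_const_lt zero_lt_one, t6.eventually_const_lt zero_lt_one,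
    t7.eventually_lt_const zero_lt_one, t8.eventually_lt_const (half_pos hα)]
  rintro ⟨d, a, b, c, μ⟩ e1 e2 e3 e4 e5 e6 e7 e8 hd hres hUa
  simp only [residual, Prod.mk_eq_zero] at *
  obtain ⟨ra, rb, rc⟩ := hres
  obtain ⟨R, S, hR, hS, hRα, hSC⟩ := e1
  -- This is f(b, μ) - f(a, μ) = d (6b - 5a - c) > 0. With R ≤ -α and f_u(a, μ) ≤ 0 it forces b < a
  -- and α |b - a| ≤ |f_u(a, μ)|, so only b can cross the fold.
  have hdiff : 0 < (b - a) * nlU f (a, μ) + (b - a) ^ 2 * R := by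
    have := mul_pos hd e5
    linarith
  have hsq : (b - a) ^ 2 * R ≤ (b - a) ^ 2 * (-α) := mul_le_mul_of_nonneg_left hRα (sq_nonneg _)
  have hprod : α * (b - a) ^ 2 < (b - a) * nlU f (a, μ) := by linarith
  have hprod0 : 0 < (b - a) * nlU f (a, μ) := lt_of_le_of_lt (by positivity) hprod
  have hUa : nlU f (a, μ) < 0 := by
    refine lt_of_le_of_ne hUa fun h => ?_
    rw [h, mul_zero] at hprod0
    exact lt_irrefl _ hprod0
  have hab : b - a < 0 := by
    by_contra hcon
    have := mul_nonpos_of_nonneg_of_nonpos (not_lt.1 hcon) hUa.le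
    linarith
  have hab' : α * |b - a| ≤ |nlU f (a, μ)| := by
    rw [abs_of_neg hab, abs_of_neg hUa]
    have h1 : (-(b - a)) * (α * -(b - a)) ≤ (-(b - a)) * -nlU f (a, μ) := by nlinarith
    exact le_of_mul_le_mul_left h1 (by linarith)
  have hUb : |nlU f (b, μ)| ≤ K * |nlU f (a, μ)| := by
    rw [hS]
    calc |nlU f (a, μ) + (b - a) * S| ≤ |nlU f (a, μ)| + |(b - a) * S| := abs_add_le _ _
      _ ≤ |nlU f (a, μ)| + |nlU f (a, μ)| / α * C := by
          rw [abs_mul]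
          have : |b - a| ≤ |nlU f (a, μ)| / α := (le_div_iff₀ hα).2 (by linarith)
          gcongr
      _ = K * |nlU f (a, μ)| := by rw [hK]; ring
  -- Here f(b, μ) = d (2b - a - c) > 0, whereas f ≤ 0 near the saddle-node for μ ≥ 1.
  have hμ : μ < 1 := by
    by_contra hcon
    have h1 := e3.2.2 (not_lt.1 hcon)
    have := mul_pos hd e6
    linarith
  refine ⟨hμ, hUa, ?_⟩
  rintro ⟨ya, yb, yc, m⟩ hy
  simp only [linearized, Prod.mk_eq_zero] at hy
  obtain ⟨la, lb, lc⟩ := hy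
  have hyc := abs_le_of_stable hβ e4.1 e4.2 hd.le lc
  obtain ⟨hm, hya⟩ := abs_le_of_fold hα hKpos hd hUa e7.le hUb e2.2.1
    (abs_le.2 ⟨e2.1, by linarith [e2.2.1]⟩) e3.2.1 e8.le hyc la lb
  rw [← hL] at hm hya
  have hdot : dot (cornerDir 2) (ya, yb, yc, m) = yb := by norm_num [dot, cornerDir]
  rw [hdot]
  have h1 : N / β * |m| ≤ N / β * (L * |yb|) := mul_le_mul_of_nonneg_left hm hNβ.le
  have h2 : 0 ≤ C * L * |yb| := by positivity
  have h3 : 0 ≤ L * |yb| := by positivity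
  have h4 : 0 ≤ N / β * (L * |yb|) := by positivity
  have h5 := abs_nonneg yb
  exact vec_norm_le (by simp only; linarith) (by simp only; linarith) (by simp only; linarith)
    (by simp only; linarith)

end Corners

/-! ### The augmented system, its sector and its behaviour near Γ -/

/-- The symmetric system, augmented by a condition that selects the point of a solution branch
near the curve `g`. -/
def augmented (f : ℝ → ℝ → ℝ) (v g : ℝ → Vec) (z : (ℝ × ℝ) × Vec) : Vec :=
  ((residual f z.1.2 z.2).1, (residual f z.1.2 z.2).2.1, (residual f z.1.2 z.2).2.2,
    -- The shift d s makes the solution advance across a corner, where the curve has velocity zero.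
    dot (v z.1.1) (z.2 - g z.1.1) - z.1.2 * z.1.1)

/-- The sector in which solutions are continued. -/
def sector (f : ℝ → ℝ → ℝ) (Λ : ℝ) : Set (ℝ × Vec) :=
  -- The conditions u + μ ≥ 0 discard -u_-, which is of order √μ. Stability is demanded of u₄ while
  -- s ≤ 5/2 and of u₁ once s ≥ 3/2; the terms in Λ relax it continuously outside these ranges,
  -- which keeps the set closed.
  {q | 0 ≤ q.2.2.2.2 ∧ 0 ≤ q.2.2.1 + q.2.2.2.2 ∧ 0 ≤ q.2.2.2.1 + q.2.2.2.2 ∧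
    nlU f (q.2.2.2.1, q.2.2.2.2) ≤ Λ * max 0 (q.1 - 5 / 2) ∧
    nlU f (q.2.1, q.2.2.2.2) ≤ Λ * max 0 (3 / 2 - q.1)}

/-- The points that satisfy the constraints of the sector strictly. -/
def openSector (f : ℝ → ℝ → ℝ) (Λ : ℝ) : Set (ℝ × Vec) :=
  {q | 0 < q.2.2.2.2 ∧ 0 < q.2.2.1 + q.2.2.2.2 ∧ 0 < q.2.2.2.1 + q.2.2.2.2 ∧
    nlU f (q.2.2.2.1, q.2.2.2.2) < Λ * max 0 (q.1 - 5 / 2) ∧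
    nlU f (q.2.1, q.2.2.2.2) < Λ * max 0 (3 / 2 - q.1)}

/-- A transversal field along the curve, and a bound for `f_u`. -/
structure IsFrame (f : ℝ → ℝ → ℝ) (w : ℝ → ℝ) (v : ℝ → Vec) (Λ : ℝ) : Prop where
  contDiff : ContDiff ℝ ∞ v
  pos : ∀ s ∈ regularTimes, 0 < dot (v s) (curve' w s)
  corner : ∀ i : ℝ, i = 1 ∨ i = 2 ∨ i = 3 → ∀ᶠ s in 𝓝 i, v s = cornerDir i
  bound_pos : 0 < Λ
  -- Half of Λ is the allowance available when it is needed: 3/2 - s ≥ 1/2 for s ≤ 1, and likewise s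
  -- - 5/2 ≥ 1/2 for s ≥ 3 in the next field.
  bound_fst : ∀ s ∈ Icc (0 : ℝ) 4, nlU f ((curve w s).1, (curve w s).2.2.2) < Λ / 2
  bound_last : ∀ s ∈ Icc (0 : ℝ) 4, nlU f ((curve w s).2.2.1, (curve w s).2.2.2) < Λ / 2

section Frame

variable {f : ℝ → ℝ → ℝ} {uM uP w : ℝ → ℝ} {v : ℝ → Vec} {Λ : ℝ}

theorem augmented_eq_zero_iff {v g : ℝ → Vec} {z : (ℝ × ℝ) × Vec} :
    augmented f v g z = 0 ↔
      residual f z.1.2 z.2 = 0 ∧ dot (v z.1.1) (z.2 - g z.1.1) = z.1.2 * z.1.1 := by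
  simp only [augmented, Prod.ext_iff, Prod.fst_zero, Prod.snd_zero, sub_eq_zero, and_assoc]

theorem IsBistable.contDiff_residual (hf : IsBistable f uM uP) :
    ContDiff ℝ ∞ fun z : ℝ × Vec => residual f z.1 z.2 := by
  have h := hf.contDiff_nl
  change ContDiff ℝ ∞ fun z : ℝ × Vec => (4 * z.1 * (z.2.2.1 - z.2.1) + nl f (z.2.1, z.2.2.2.2),
    z.1 * (z.2.1 + z.2.2.2.1 - 2 * z.2.2.1) + nl f (z.2.2.1, z.2.2.2.2),
    4 * z.1 * (z.2.2.1 - z.2.2.2.1) + nl f (z.2.2.2.1, z.2.2.2.2))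
  fun_prop

theorem IsBistable.contDiff_augmented (hf : IsBistable f uM uP) {v g : ℝ → Vec}
    (hv : ContDiff ℝ ∞ v) (hg : ContDiff ℝ ∞ g) : ContDiff ℝ ∞ (augmented f v g) := by
  have h : ContDiff ℝ ∞ fun z : (ℝ × ℝ) × Vec => residual f z.1.2 z.2 :=
    hf.contDiff_residual.comp (g := fun z : ℝ × Vec => residual f z.1 z.2)
      (f := fun z : (ℝ × ℝ) × Vec => (z.1.2, z.2)) (by fun_prop)
  have h' : ContDiff ℝ ∞ fun z : (ℝ × ℝ) × Vec =>
      dot (v z.1.1) (z.2 - g z.1.1) - z.1.2 * z.1.1 := by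
    unfold dot
    fun_prop
  exact h.fst.prodMk (h.snd.fst.prodMk (h.snd.snd.prodMk h'))

/-- Along the line t ↦ x + t y the first three components differentiate to the linearization and the
last, affine in t, to the pairing with v. -/
theorem IsBistable.fderiv_augmented (hf : IsBistable f uM uP) {v g : ℝ → Vec}
    (hv : ContDiff ℝ ∞ v) (hg : ContDiff ℝ ∞ g) {z : (ℝ × ℝ) × Vec} {y : Vec}
    (h : fderiv ℝ (augmented f v g) z (0, y) = 0) :
    linearized f z.1.2 z.2 y = 0 ∧ dot (v z.1.1) y = 0 := by
  have hκ : HasDerivAt (fun t : ℝ => z.2 + t • y) y 0 := by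
    have := ((hasDerivAt_id (0 : ℝ)).smul_const y).const_add z.2
    simpa using this
  have h1 : HasDerivAt (fun t : ℝ => augmented f v g (z.1, z.2 + t • y))
      (fderiv ℝ (augmented f v g) z (0, y)) 0 := by
    have hd := ((hf.contDiff_augmented hv hg).differentiable (by simp) z).hasFDerivAt
    have hz : z = (z.1, z.2 + (0 : ℝ) • y) := by simp
    rw [hz] at hd
    have := hd.comp_hasDerivAt 0 ((hasDerivAt_const (0 : ℝ) z.1).prodMk hκ)
    simp only [zero_smul, add_zero, Prod.mk.eta] at this
    exact this
  have h2 := hf.hasDerivAt_residual z.1.2 hκ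
  have h3 : HasDerivAt (fun t : ℝ => dot (v z.1.1) (z.2 + t • y - g z.1.1) - z.1.2 * z.1.1)
      (dot (v z.1.1) y) 0 := by
    have e : (fun t : ℝ => dot (v z.1.1) (z.2 + t • y - g z.1.1) - z.1.2 * z.1.1) =
        fun t : ℝ => t * dot (v z.1.1) y +
          (dot (v z.1.1) (z.2 - g z.1.1) - z.1.2 * z.1.1) := by
      funext t
      simp [dot]; ring
    rw [e]
    simpa using ((hasDerivAt_id (0 : ℝ)).mul_const (dot (v z.1.1) y)).add_const
      (dot (v z.1.1) (z.2 - g z.1.1) - z.1.2 * z.1.1)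
  rw [zero_smul, add_zero] at h2
  have k1 : HasDerivAt (fun t : ℝ => (residual f z.1.2 (z.2 + t • y)).1)
      (linearized f z.1.2 z.2 y).1 0 := h2.fst
  have k2 : HasDerivAt (fun t : ℝ => (residual f z.1.2 (z.2 + t • y)).2.1)
      (linearized f z.1.2 z.2 y).2.1 0 := h2.snd.fst
  have k3 : HasDerivAt (fun t : ℝ => (residual f z.1.2 (z.2 + t • y)).2.2)
      (linearized f z.1.2 z.2 y).2.2 0 := h2.snd.snd
  have h4 := h1.unique (k1.prodMk (k2.prodMk (k3.prodMk h3)))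
  rw [h] at h4
  simp only [Prod.ext_iff, Prod.fst_zero, Prod.snd_zero] at h4 ⊢
  exact ⟨⟨h4.1.symm, h4.2.1.symm, h4.2.2.1.symm⟩, h4.2.2.2.symm⟩

theorem IsBistable.isClosed_sector (hf : IsBistable f uM uP) (Λ : ℝ) :
    IsClosed (sector f Λ) := by
  have hU := hf.contDiff_nlU.continuous
  simp only [sector, ofPred_and]
  refine (isClosed_le ?_ ?_).inter ((isClosed_le ?_ ?_).inter ((isClosed_le ?_ ?_).inter
    ((isClosed_le ?_ ?_).inter (isClosed_le ?_ ?_)))) <;> fun_prop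

theorem IsBistable.isOpen_openSector (hf : IsBistable f uM uP) (Λ : ℝ) :
    IsOpen (openSector f Λ) := by
  have hU := hf.contDiff_nlU.continuous
  simp only [openSector, ofPred_and]
  refine (isOpen_lt ?_ ?_).inter ((isOpen_lt ?_ ?_).inter ((isOpen_lt ?_ ?_).inter
    ((isOpen_lt ?_ ?_).inter (isOpen_lt ?_ ?_)))) <;> fun_prop

theorem IsBistable.openSector_subset (hf : IsBistable f uM uP) (Λ : ℝ) :
    openSector f Λ ⊆ interior (sector f Λ) :=
  interior_maximal (fun _ h => ⟨h.1.le, h.2.1.le, h.2.2.1.le, h.2.2.2.1.le, h.2.2.2.2.le⟩)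
    (hf.isOpen_openSector Λ)

theorem exists_frame (hf : IsBistable f uM uP) (hw : IsProfile uM uP w) :
    ∃ v Λ, IsFrame f w v Λ := by
  obtain ⟨v, h1, h2, h3⟩ := exists_transversal hf hw
  have hU := hf.contDiff_nlU.continuous
  have hc := hw.contDiff_curve.continuous
  have c1 : Continuous fun s => nlU f ((curve w s).1, (curve w s).2.2.2) :=
    hU.comp (hc.fst.prodMk hc.snd.snd.snd)
  have c2 : Continuous fun s => nlU f ((curve w s).2.2.1, (curve w s).2.2.2) :=
    hU.comp (hc.snd.snd.fst.prodMk hc.snd.snd.snd)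
  obtain ⟨B₁, hB₁⟩ := isCompact_Icc.exists_bound_of_continuousOn (s := Icc (0 : ℝ) 4)
    c1.continuousOn
  obtain ⟨B₂, hB₂⟩ := isCompact_Icc.exists_bound_of_continuousOn (s := Icc (0 : ℝ) 4)
    c2.continuousOn
  refine ⟨v, 2 * (|B₁| + |B₂| + 1), h1, h2, h3, by positivity, fun s hs => ?_, fun s hs => ?_⟩
  · have := (le_abs_self _).trans (hB₁ s hs)
    linarith [le_abs_self B₁, abs_nonneg B₂]
  · have := (le_abs_self _).trans (hB₂ s hs)
    linarith [le_abs_self B₂, abs_nonneg B₁]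

theorem IsBistable.nlU_zero_nonpos (hf : IsBistable f uM uP) {μ : ℝ} (hμ : μ ∈ Icc (0 : ℝ) 1) :
    nlU f (0, μ) ≤ 0 := by
  rcases eq_or_lt_of_le hμ.1 with rfl | h
  · rw [← hf.deriv_left, hf.pitchfork_u]
  · exact (hf.nlU_zero_neg ⟨h, hμ.2⟩).le

theorem IsBistable.nlU_uP_nonpos (hf : IsBistable f uM uP) {μ : ℝ} (hμ : μ ∈ Icc (0 : ℝ) 1) :
    nlU f (uP μ, μ) ≤ 0 := by
  rcases eq_or_lt_of_le hμ.2 with rfl | h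
  · rw [hf.uP_one, ← hf.deriv_left, hf.saddleNode_u]
  · exact (hf.nlU_uP_neg ⟨hμ.1, h⟩).le

theorem curve_last_eq_zero (hf : IsBistable f uM uP) (hw : IsProfile uM uP w) {s : ℝ}
    (h : s ≤ 3) : (curve w s).2.2.1 = 0 := by
  simp [curve, clock_eq_zero h, hw.at_neg_one hf]

theorem curve_fst_eq (hf : IsBistable f uM uP) (hw : IsProfile uM uP w) {s : ℝ} (h : 1 ≤ s) :
    (curve w s).1 = uP (curve w s).2.2.2 := by
  have par_symm : ∀ t : ℝ, par (1 - t) = par (-1 + t) := fun t => by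
    rw [← par_neg]; ring_nf
  rcases le_total s 2 with h2 | h2
  · rw [curve_of_mem_Icc_one_two hf hw h h2]
    simp only
    rw [hw.right _ ⟨by linarith [clock_le_one 1 s], by linarith [clock_nonneg 1 s]⟩, par_symm]
  rcases le_total s 3 with h3 | h3
  · rw [curve_of_mem_Icc_two_three hf hw h2 h3]
    simp only
    rw [hw.right _ ⟨clock_nonneg 2 s, clock_le_one 2 s⟩]
  · rw [curve_of_three_le h3]
    simp only
    rw [hw.right _ ⟨by linarith [clock_le_one 3 s], by linarith [clock_nonneg 3 s]⟩, par_symm]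

theorem IsFrame.curve_mem_sector (hf : IsBistable f uM uP) (hw : IsProfile uM uP w)
    (hF : IsFrame f w v Λ) {s : ℝ} (hs : s ∈ Icc (0 : ℝ) 4) : (s, curve w s) ∈ sector f Λ := by
  obtain ⟨-, pa, pb, pc, hμ⟩ := curve_roots hf hw s
  have hΛ := hF.bound_pos
  refine ⟨hμ.1, add_nonneg pb hμ.1, add_nonneg pc hμ.1, ?_, ?_⟩
  · simp only
    rcases le_total s 3 with h | h
    · rw [curve_last_eq_zero hf hw h]
      exact (hf.nlU_zero_nonpos hμ).trans (by positivity)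
    · refine (hF.bound_last s hs).le.trans ?_
      have : s - 5 / 2 ≤ max 0 (s - 5 / 2) := le_max_right _ _
      nlinarith
  · simp only
    rcases le_total s 1 with h | h
    · refine (hF.bound_fst s hs).le.trans ?_
      have : 3 / 2 - s ≤ max 0 (3 / 2 - s) := le_max_right _ _
      nlinarith
    · rw [curve_fst_eq hf hw h]
      exact (hf.nlU_uP_nonpos hμ).trans (by positivity)

theorem curve_parameter_pos (hf : IsBistable f uM uP) (hw : IsProfile uM uP w) {s : ℝ}
    (hs : s ∈ regularTimes) : 0 < (curve w s).2.2.2 := by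
  by_cases h : s = foldTime
  · rw [h, curve_foldTime hf hw]
    exact one_pos
  · exact (curve_regular hf hw hs.1 hs.2.1 hs.2.2.1 hs.2.2.2 h).1.1

/-- Strictness comes from μ > 0, which makes the zero component stable, and from μ < 1 where u₁ =
u₊. The first fold has μ = 1, but it occurs where the allowance Λ is active. -/
theorem IsFrame.curve_mem_openSector (hf : IsBistable f uM uP) (hw : IsProfile uM uP w)
    (hF : IsFrame f w v Λ) {s : ℝ} (hs : s ∈ regularTimes) :
    (s, curve w s) ∈ openSector f Λ := by
  obtain ⟨-, pa, pb, pc, hμ⟩ := curve_roots hf hw s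
  have hΛ := hF.bound_pos
  have hμ0 := curve_parameter_pos hf hw hs
  have hsI : s ∈ Icc (0 : ℝ) 4 := Ioo_subset_Icc_self hs.1
  refine ⟨hμ0, add_pos_of_nonneg_of_pos pb hμ0, add_pos_of_nonneg_of_pos pc hμ0, ?_, ?_⟩
  · simp only
    rcases le_total s 3 with h | h
    · rw [curve_last_eq_zero hf hw h]
      exact (hf.nlU_zero_neg ⟨hμ0, hμ.2⟩).trans_le (by positivity)
    · refine (hF.bound_last s hsI).trans_le ?_
      have : s - 5 / 2 ≤ max 0 (s - 5 / 2) := le_max_right _ _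
      nlinarith
  · simp only
    rcases lt_or_gt_of_ne hs.2.1 with h | h
    · refine (hF.bound_fst s hsI).trans_le ?_
      have : 3 / 2 - s ≤ max 0 (3 / 2 - s) := le_max_right _ _
      nlinarith
    · have hfold : s ≠ foldTime := by
        rintro rfl
        norm_num [foldTime] at h
      have hμ1 := (curve_regular hf hw hs.1 hs.2.1 hs.2.2.1 hs.2.2.2 hfold).1.2
      rw [curve_fst_eq hf hw h.le]
      exact (hf.nlU_uP_neg ⟨hμ.1, hμ1⟩).trans_le (by positivity)

theorem residual_curve (hf : IsBistable f uM uP) (hw : IsProfile uM uP w) (s : ℝ) :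
    residual f 0 (curve w s) = 0 := by
  obtain ⟨⟨ra, rb, rc⟩, -⟩ := curve_roots hf hw s
  simp [residual, ra, rb, rc]

theorem augmented_curve (hf : IsBistable f uM uP) (hw : IsProfile uM uP w) (s : ℝ) :
    augmented f v (curve w) ((s, 0), curve w s) = 0 :=
  augmented_eq_zero_iff.2 ⟨residual_curve hf hw s, by simp [dot]⟩

theorem IsFrame.kernel (hf : IsBistable f uM uP) (hw : IsProfile uM uP w)
    (hF : IsFrame f w v Λ) {s : ℝ} (hs : s ∈ regularTimes) (y : Vec)
    (hy : fderiv ℝ (augmented f v (curve w)) ((s, 0), curve w s) (0, y) = 0) : y = 0 := by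
  obtain ⟨h1, h2⟩ := hf.fderiv_augmented hF.contDiff hw.contDiff_curve hy
  simp only [linearized, mul_zero, zero_mul, zero_add, Prod.mk_eq_zero] at h1
  exact curve_kernel hf hw hs (hF.pos s hs) h2 h1.1 h1.2.1 h1.2.2

theorem curve_one (hf : IsBistable f uM uP) (hw : IsProfile uM uP w) :
    curve w 1 = (uP 0, 0, 0, 0) := by
  rw [curve_of_mem_Icc_one_two hf hw le_rfl (by norm_num), clock_eq_zero le_rfl]
  simp [hw.at_one, hw.at_neg_one hf, par_neg_one]

theorem curve_two (hf : IsBistable f uM uP) (hw : IsProfile uM uP w) :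
    curve w 2 = (1, 1, 0, 1) := by
  rw [curve_of_mem_Icc_two_three hf hw le_rfl (by norm_num), clock_eq_zero le_rfl]
  simp [hw.at_zero hf, par_zero]

theorem curve_three (hf : IsBistable f uM uP) (hw : IsProfile uM uP w) :
    curve w 3 = (uP 0, uP 0, 0, 0) := by
  rw [curve_of_three_le le_rfl, clock_eq_zero le_rfl]
  simp [hw.at_one, hw.at_neg_one hf, par_neg_one]

/-- Near a corner, solutions in the sector are nondegenerate. -/
theorem IsFrame.corner_regular (hf : IsBistable f uM uP) (hw : IsProfile uM uP w)
    (hF : IsFrame f w v Λ) {i : ℝ} (hi : i = 1 ∨ i = 2 ∨ i = 3) :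
    ∃ C : ℝ, 0 < C ∧ ∀ᶠ z : (ℝ × ℝ) × Vec in 𝓝 ((i, 0), curve w i), 0 < z.1.2 →
      residual f z.1.2 z.2 = 0 → (z.1.1, z.2) ∈ sector f Λ →
      (z.1.1, z.2) ∈ openSector f Λ ∧ z.2.2.2.2 < 1 ∧
        ∀ y, linearized f z.1.2 z.2 y = 0 → ‖y‖ ≤ C * |dot (cornerDir i) y| := by
  have hΛ := hF.bound_pos
  have hU := hf.contDiff_nlU.continuous
  have t0 : ∀ x, Tendsto (fun z : (ℝ × ℝ) × Vec => (z.1.2, z.2)) (𝓝 ((i, 0), x)) (𝓝 (0, x)) :=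
    fun x => Continuous.tendsto' (by fun_prop) _ _ rfl
  have t1 : ∀ x, Tendsto (fun z : (ℝ × ℝ) × Vec => z.1.1) (𝓝 ((i, 0), x)) (𝓝 i) :=
    fun x => Continuous.tendsto' (by fun_prop) _ _ rfl
  have t2 : ∀ x : Vec, Tendsto (fun z : (ℝ × ℝ) × Vec => z.2.2.2.2) (𝓝 ((i, 0), x))
      (𝓝 x.2.2.2) := fun x => Continuous.tendsto' (by fun_prop) _ _ rfl
  rcases hi with rfl | rfl | rfl
  · obtain ⟨C, hC, hev⟩ := hf.corner_one
    refine ⟨C, hC, ?_⟩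
    rw [curve_one hf hw]
    filter_upwards [(t0 _).eventually hev,
      (t1 _).eventually_lt_const (by norm_num : (1 : ℝ) < 5 / 2),
      (t2 _).eventually_lt_const (one_pos : (0 : ℝ) < 1)] with z hz hs hμ hd hres hT
    obtain ⟨h1, h2, h3, h4, h5⟩ := hT
    simp only at *
    rw [max_eq_left (by linarith), mul_zero] at h4
    obtain ⟨k1, k2, k3, k4, k5, k6⟩ := hz hd hres h1 h2 h4
    exact ⟨⟨k1, add_pos k2 k1, add_pos k3 k1, k5.trans_le (by positivity),
      k4.trans_le (by positivity)⟩, hμ, k6⟩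
  · obtain ⟨C, hC, hev⟩ := hf.corner_two
    refine ⟨C, hC, ?_⟩
    rw [curve_two hf hw]
    have t3 : Tendsto (fun z : (ℝ × ℝ) × Vec => nlU f (z.2.2.2.1, z.2.2.2.2))
        (𝓝 ((2, 0), ((1, 1, 0, 1) : Vec))) (𝓝 (nlU f (0, 1))) :=
      Continuous.tendsto' (by fun_prop) _ _ rfl
    have t4 : Tendsto (fun z : (ℝ × ℝ) × Vec => z.2.2.1 + z.2.2.2.2)
        (𝓝 ((2, 0), ((1, 1, 0, 1) : Vec))) (𝓝 (1 + 1)) :=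
      Continuous.tendsto' (by fun_prop) _ _ rfl
    have t5 : Tendsto (fun z : (ℝ × ℝ) × Vec => z.2.2.2.1 + z.2.2.2.2)
        (𝓝 ((2, 0), ((1, 1, 0, 1) : Vec))) (𝓝 (0 + 1)) :=
      Continuous.tendsto' (by fun_prop) _ _ rfl
    filter_upwards [(t0 _).eventually hev,
      (t1 _).eventually_const_lt (by norm_num : (3 / 2 : ℝ) < 2),
      (t2 _).eventually_const_lt (one_pos : (0 : ℝ) < 1),
      t3.eventually_lt_const (hf.nlU_zero_neg (μ := 1) (by simp)),
      t4.eventually_const_lt (by norm_num : (0 : ℝ) < 1 + 1),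
      t5.eventually_const_lt (by norm_num : (0 : ℝ) < 0 + 1)] with z hz hs hμ hUc hb hc hd hres hT
    obtain ⟨h1, h2, h3, h4, h5⟩ := hT
    simp only at *
    rw [max_eq_left (by linarith), mul_zero] at h5
    obtain ⟨k1, k2, k3⟩ := hz hd hres h5
    exact ⟨⟨hμ, hb, hc, hUc.trans_le (by positivity), k2.trans_le (by positivity)⟩, k1, k3⟩
  · obtain ⟨C, hC, hev⟩ := hf.corner_three
    refine ⟨C, hC, ?_⟩
    rw [curve_three hf hw]
    have t3 : Tendsto (fun z : (ℝ × ℝ) × Vec => nlU f (z.2.2.2.1, z.2.2.2.2))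
        (𝓝 ((3, 0), ((uP 0, uP 0, 0, 0) : Vec))) (𝓝 (nlU f (0, 0))) :=
      Continuous.tendsto' (by fun_prop) _ _ rfl
    have t4 : Tendsto (fun z : (ℝ × ℝ) × Vec => Λ * max 0 (z.1.1 - 5 / 2))
        (𝓝 ((3, 0), ((uP 0, uP 0, 0, 0) : Vec))) (𝓝 (Λ * max 0 (3 - 5 / 2))) :=
      Continuous.tendsto' (by fun_prop) _ _ rfl
    have h00 : nlU f (0, 0) < Λ * max 0 (3 - 5 / 2) := by
      rw [← hf.deriv_left, hf.pitchfork_u, max_eq_right (by norm_num)]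
      norm_num
      exact hΛ
    filter_upwards [(t0 _).eventually hev, t3.eventually_lt t4 h00,
      (t2 _).eventually_lt_const (one_pos : (0 : ℝ) < 1)] with z hz hUc hμ hd hres hT
    obtain ⟨h1, h2, h3, h4, h5⟩ := hT
    simp only at *
    obtain ⟨k1, k2, k3, k4, k5⟩ := hz hd hres h1 h3
    exact ⟨⟨k1, add_pos k2 k1, add_pos k3 k1, hUc, k4.trans_le (by positivity)⟩, hμ, k5⟩

/-- Near a corner, the curve contains all solutions in the sector for `d = 0`. -/
theorem IsFrame.corner_limit (hf : IsBistable f uM uP) (hw : IsProfile uM uP w)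
    (hF : IsFrame f w v Λ) {i : ℝ} (hi : i = 1 ∨ i = 2 ∨ i = 3) :
    ∀ᶠ q : ℝ × Vec in 𝓝 (i, curve w i), augmented f v (curve w) ((q.1, 0), q.2) = 0 →
      q ∈ sector f Λ → q.2 = curve w q.1 := by
  have hg := hw.contDiff_curve.continuous
  have hv := hF.corner i hi
  have t1 : Tendsto (fun q : ℝ × Vec => q.1) (𝓝 (i, curve w i)) (𝓝 i) :=
    Continuous.tendsto' (by fun_prop) _ _ rfl
  have t0 : Tendsto (fun q : ℝ × Vec => (q.2, curve w q.1)) (𝓝 (i, curve w i))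
      (𝓝 (curve w i, curve w i)) :=
    (continuous_snd.prodMk (hg.comp continuous_fst)).tendsto _
  have ta : Tendsto (fun q : ℝ × Vec => (q.2.1, (curve w q.1).1, q.2.2.2.2))
      (𝓝 (i, curve w i)) (𝓝 ((curve w i).1, (curve w i).1, (curve w i).2.2.2)) :=
    (Continuous.tendsto' (f := fun p : Vec × Vec => (p.1.1, p.2.1, p.1.2.2.2)) (by fun_prop) _ _
      rfl).comp t0
  have tb : Tendsto (fun q : ℝ × Vec => (q.2.2.1, (curve w q.1).2.1, q.2.2.2.2))
      (𝓝 (i, curve w i)) (𝓝 ((curve w i).2.1, (curve w i).2.1, (curve w i).2.2.2)) :=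
    (Continuous.tendsto' (f := fun p : Vec × Vec => (p.1.2.1, p.2.2.1, p.1.2.2.2)) (by fun_prop) _ _
      rfl).comp t0
  have tc : Tendsto (fun q : ℝ × Vec => (q.2.2.2.1, (curve w q.1).2.2.1, q.2.2.2.2))
      (𝓝 (i, curve w i)) (𝓝 ((curve w i).2.2.1, (curve w i).2.2.1, (curve w i).2.2.2)) :=
    (Continuous.tendsto' (f := fun p : Vec × Vec => (p.1.2.2.1, p.2.2.2.1, p.1.2.2.2))
      (by fun_prop) _ _
      rfl).comp t0
  have hroots : ∀ q : ℝ × Vec, augmented f v (curve w) ((q.1, 0), q.2) = 0 →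
      (f q.2.1 q.2.2.2.2 = 0 ∧ f q.2.2.1 q.2.2.2.2 = 0 ∧ f q.2.2.2.1 q.2.2.2.2 = 0) ∧
        dot (v q.1) (q.2 - curve w q.1) = 0 := by
    intro q hq
    have := augmented_eq_zero_iff.1 hq
    simpa [residual] using this
  rcases hi with rfl | rfl | rfl
  · rw [curve_one hf hw] at *
    have td : Tendsto (fun q : ℝ × Vec =>
        ((q.2.2.1, q.2.2.2.2), ((curve w q.1).2.1, (curve w q.1).2.2.2)))
        (𝓝 (1, (uP 0, 0, 0, 0))) (𝓝 ((0, 0), (0, 0))) :=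
      (Continuous.tendsto' (f := fun p : Vec × Vec => ((p.1.2.1, p.1.2.2.2), (p.2.2.1, p.2.2.2.2)))
        (by fun_prop) _ _
      rfl).comp t0
    have te : Tendsto (fun q : ℝ × Vec => (q.2.2.2.1, q.2.2.2.2))
        (𝓝 (1, (uP 0, 0, 0, 0))) (𝓝 (0, 0)) := Continuous.tendsto' (by fun_prop) _ _ rfl
    filter_upwards [t1.eventually hv, t1.eventually_lt_const (by norm_num : (1 : ℝ) < 5 / 2),
      td.eventually hf.eventually_unique_diagonal,
      te.eventually hf.eventually_stable_root_eq_zero,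
      ta.eventually (hf.eventually_unique_root (hf.root_uP (by simp))
        (hf.nlU_uP_neg (μ := 0) (by simp)).ne)]
    rintro ⟨s, a, b, c, μ⟩ e1 e2 e3 e4 e5 hq ⟨h1, h2, h3, h4, h5⟩
    obtain ⟨⟨ra, rb, rc⟩, hdot⟩ := hroots _ hq
    obtain ⟨⟨ga, gb, gc⟩, -, pb, pc, hμ⟩ := curve_roots hf hw s
    simp only at *
    rw [max_eq_left (by linarith), mul_zero] at h4
    have hc := e4 rc h4
    have hg0 := curve_last_eq_zero hf hw (show s ≤ 3 by linarith)
    -- Near the corner v is constant, so at d = 0 the selecting condition says that u₂ - μ agrees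
    -- with its value on the curve.
    have hdiag := e3 rb gb h1 hμ.1 h2 (add_nonneg pb hμ.1) (by
      rw [e1] at hdot
      simp [dot, cornerDir] at hdot
      linarith)
    obtain ⟨hb, hm⟩ := Prod.ext_iff.1 hdiag
    simp only at hb hm
    have ha := e5 ra (by rw [hm]; exact ga)
    exact Prod.ext ha (Prod.ext hb (Prod.ext (hc.trans hg0.symm) hm))
  · rw [curve_two hf hw] at *
    obtain ⟨α, C, hα, -, hexp, hM⟩ := hf.saddleNode_bounds
    have td : Tendsto (fun q : ℝ × Vec => (q.2.2.1, q.2.2.2.2, (curve w q.1).2.2.2))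
        (𝓝 (2, (1, 1, 0, 1))) (𝓝 (1, 1, 1)) :=
      (Continuous.tendsto' (f := fun p : Vec × Vec => (p.1.2.1, p.1.2.2.2, p.2.2.2.2))
        (by fun_prop) _ _
      rfl).comp t0
    have te : Tendsto (fun q : ℝ × Vec => ((curve w q.1).1, q.2.1, q.2.2.2.2))
        (𝓝 (2, (1, 1, 0, 1))) (𝓝 (1, 1, 1)) :=
      (Continuous.tendsto' (f := fun p : Vec × Vec => (p.2.1, p.1.1, p.1.2.2.2)) (by fun_prop) _ _
      rfl).comp t0
    have hf1 : f 1 1 = 0 := by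
      have := hf.root_uP (μ := 1) (by simp)
      rwa [hf.uP_one] at this
    have hM1 : nlM f (1, 1) ≠ 0 := by
      have := hM.self_of_nhds.2.1
      linarith
    filter_upwards [t1.eventually hv, t1.eventually (Ioo_mem_nhds (by norm_num : (3 / 2 : ℝ) < 2)
        (by norm_num : (2 : ℝ) < 5 / 2)),
      td.eventually (hf.eventually_unique_parameter hf1 hM1), te.eventually hexp,
      ta.eventually hexp, tc.eventually (hf.eventually_unique_root (hf.zero_left 1)
        (hf.nlU_zero_neg (μ := 1) (by simp)).ne)]
    rintro ⟨s, a, b, c, μ⟩ e1 e2 e3 e4 e5 e6 hq ⟨h1, h2, h3, h4, h5⟩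
    obtain ⟨⟨ra, rb, rc⟩, hdot⟩ := hroots _ hq
    obtain ⟨⟨ga, gb, gc⟩, -, pb, pc, hμ⟩ := curve_roots hf hw s
    have hUg := (hF.curve_mem_sector hf hw (s := s)
      ⟨by linarith [e2.1], by linarith [e2.2]⟩).2.2.2.2
    simp only at *
    rw [max_eq_left (by linarith [e2.1]), mul_zero] at h5 hUg
    have hb : b = (curve w s).2.1 := by
      rw [e1] at hdot
      norm_num [dot, cornerDir] at hdot
      linarith
    have hm : μ = (curve w s).2.2.2 := e3 rb (by rw [hb]; exact gb)
    have hc := e6 rc (by rw [hm]; exact gc)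
    rw [← hm] at hUg ga
    obtain ⟨R, -, x1, -, x2, -⟩ := e4
    obtain ⟨R', -, y1, -, y2, -⟩ := e5
    rw [ra, ga, zero_add] at x1 y1
    -- Two distinct roots at the same μ, both with f_u ≤ 0, contradict strict concavity: expanding
    -- at either one places the other strictly to its left.
    have ha : a = (curve w s).1 := by
      by_contra hne
      have hsq : 0 < (a - (curve w s).1) ^ 2 := by
        have := sub_ne_zero.2 hne
        positivity
      have z1 : 0 < (a - (curve w s).1) * nlU f ((curve w s).1, μ) := by
        have := mul_pos_of_neg_of_neg (show R < 0 by linarith) (neg_lt_zero.2 hsq)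
        linarith
      have z2 : 0 < ((curve w s).1 - a) * nlU f (a, μ) := by
        have := mul_pos_of_neg_of_neg (show R' < 0 by linarith) (neg_lt_zero.2 hsq)
        linarith
      have k1 := neg_of_mul_pos_left z1 hUg
      have k2 := neg_of_mul_pos_left z2 h5
      linarith
    exact Prod.ext ha (Prod.ext hb (Prod.ext hc hm))
  · rw [curve_three hf hw] at *
    have td : Tendsto (fun q : ℝ × Vec =>
        ((q.2.2.2.1, q.2.2.2.2), ((curve w q.1).2.2.1, (curve w q.1).2.2.2)))
        (𝓝 (3, (uP 0, uP 0, 0, 0))) (𝓝 ((0, 0), (0, 0))) :=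
      (Continuous.tendsto'
        (f := fun p : Vec × Vec => ((p.1.2.2.1, p.1.2.2.2), (p.2.2.2.1, p.2.2.2.2)))
        (by fun_prop) _ _
      rfl).comp t0
    have huniq := hf.eventually_unique_root (hf.root_uP (by simp))
        (hf.nlU_uP_neg (μ := 0) (by simp)).ne
    filter_upwards [t1.eventually hv, td.eventually hf.eventually_unique_diagonal,
      ta.eventually huniq, tb.eventually huniq]
    rintro ⟨s, a, b, c, μ⟩ e1 e3 e4 e5 hq ⟨h1, h2, h3, h4, h5⟩
    obtain ⟨⟨ra, rb, rc⟩, hdot⟩ := hroots _ hq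
    obtain ⟨⟨ga, gb, gc⟩, -, pb, pc, hμ⟩ := curve_roots hf hw s
    simp only at *
    have hdiag := e3 rc gc h1 hμ.1 h3 (add_nonneg pc hμ.1) (by
      rw [e1] at hdot
      norm_num [dot, cornerDir] at hdot
      linarith)
    obtain ⟨hc, hm⟩ := Prod.ext_iff.1 hdiag
    simp only at hc hm
    have ha := e4 ra (by rw [hm]; exact ga)
    have hb := e5 rb (by rw [hm]; exact gb)
    exact Prod.ext ha (Prod.ext hb (Prod.ext hc hm))

end Frame

/-! ### The branch: C¹ convergence, transversality and injectivity -/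

/-- A branch of solutions of the augmented system over the parameter interval `[a, b]` that
converges to the curve. -/
structure IsBranch (f : ℝ → ℝ → ℝ) (w : ℝ → ℝ) (v : ℝ → Vec) (Λ a b dstar : ℝ)
    (x : ℝ × ℝ → Vec) : Prop where
  pos : 0 < dstar
  left_pos : 0 < a
  right_lt : b < 4
  sol : ∀ s ∈ Icc a b, ∀ d ∈ Ioo 0 dstar, augmented f v (curve w) ((s, d), x (s, d)) = 0 ∧
    (s, x (s, d)) ∈ sector f Λ
  smooth : ∀ s ∈ Ioo a b, ∀ d ∈ Ioo 0 dstar, ContDiffAt ℝ ∞ x (s, d)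
  conv : ∀ ε : ℝ, 0 < ε → ∀ᶠ d in 𝓝[>] (0 : ℝ), ∀ s ∈ Icc a b, ‖x (s, d) - curve w s‖ < ε

/-- The derivative of a branch along the curve. -/
def velocity (x : ℝ × ℝ → Vec) (p : ℝ × ℝ) : Vec := deriv (fun s => x (s, p.2)) p.1

section Branch

variable {f : ℝ → ℝ → ℝ} {uM uP w : ℝ → ℝ} {v : ℝ → Vec} {Λ a b dstar : ℝ} {x : ℝ × ℝ → Vec}

theorem continuous_dot (v : Vec) : Continuous (dot v) := by
  unfold dot
  fun_prop

/-- At a corner this follows from ‖y‖ ≤ C |ℓ·y|, whose right side is zero for a kernel vector. At a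
regular time the linearization is already injective at d = 0. The bound μ < 1 keeps solutions in the
parameter range. -/
theorem IsFrame.eventually_regular (hf : IsBistable f uM uP) (hw : IsProfile uM uP w)
    (hF : IsFrame f w v Λ) {s : ℝ} (hs : s ∈ Ioo (0 : ℝ) 4) :
    ∀ᶠ z : (ℝ × ℝ) × Vec in 𝓝 ((s, 0), curve w s), 0 < z.1.2 →
      augmented f v (curve w) z = 0 → (z.1.1, z.2) ∈ sector f Λ →
      (z.1.1, z.2) ∈ openSector f Λ ∧ z.2.2.2.2 < 1 ∧
        ∀ y, fderiv ℝ (augmented f v (curve w)) z (0, y) = 0 → y = 0 := by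
  by_cases hi : s = 1 ∨ s = 2 ∨ s = 3
  · obtain ⟨C, -, hev⟩ := hF.corner_regular hf hw hi
    have t1 : Tendsto (fun z : (ℝ × ℝ) × Vec => z.1.1) (𝓝 ((s, 0), curve w s)) (𝓝 s) :=
      Continuous.tendsto' (by fun_prop) _ _ rfl
    filter_upwards [hev, t1.eventually (hF.corner s hi)] with z hz hv hd h0 hT
    obtain ⟨h1, h2, h3⟩ := hz hd (augmented_eq_zero_iff.1 h0).1 hT
    refine ⟨h1, h2, fun y hy => ?_⟩
    obtain ⟨h4, h5⟩ := hf.fderiv_augmented hF.contDiff hw.contDiff_curve hy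
    have := h3 y h4
    rw [← hv, h5, abs_zero, mul_zero] at this
    exact norm_le_zero_iff.1 this
  · have hr : s ∈ regularTimes := by
      push Not at hi
      exact ⟨hs, hi.1, hi.2.1, hi.2.2⟩
    have hsm := hf.contDiff_augmented hF.contDiff hw.contDiff_curve
    have h1 := eventually_injective_fderiv hsm (hF.kernel hf hw hr)
    have t1 : Tendsto (fun z : (ℝ × ℝ) × Vec => (z.1.1, z.2)) (𝓝 ((s, 0), curve w s))
      (𝓝 (s, curve w s)) := Continuous.tendsto' (by fun_prop) _ _ rfl
    have h2 := t1.eventually ((hf.isOpen_openSector Λ).mem_nhds (hF.curve_mem_openSector hf hw hr))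
    have h3 : ∀ᶠ z : (ℝ × ℝ) × Vec in 𝓝 ((s, 0), curve w s), 0 < z.1.2 →
        augmented f v (curve w) z = 0 → z.2.2.2.2 < 1 := by
      by_cases hfold : s = foldTime
      · obtain ⟨α, C, -, -, -, hM⟩ := hf.saddleNode_bounds
        rw [hfold, curve_foldTime hf hw]
        have t2 : Tendsto (fun z : (ℝ × ℝ) × Vec => (z.2.1, z.2.2.2.2))
          (𝓝 ((foldTime, 0), ((1, 0, 0, 1) : Vec))) (𝓝 (1, 1)) :=
          Continuous.tendsto' (by fun_prop) _ _ rfl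
        have t3 : Tendsto (fun z : (ℝ × ℝ) × Vec => z.2.1 - z.2.2.1)
          (𝓝 ((foldTime, 0), ((1, 0, 0, 1) : Vec))) (𝓝 1) :=
          Continuous.tendsto' (by fun_prop) _ _ (by simp)
        filter_upwards [t2.eventually hM, t3.eventually_const_lt one_pos] with z hz hab hd h0
        have hres := (Prod.ext_iff.1 (augmented_eq_zero_iff.1 h0).1).1
        simp only [residual, Prod.fst_zero] at hres
        -- At the first fold f(a, μ) = 4d (a - b) > 0, while f ≤ 0 nearby for μ ≥ 1.
        by_contra hcon
        have h4 := hz.2.2 (not_lt.1 hcon)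
        have := mul_pos hd hab
        linarith
      · have hμ := (curve_regular hf hw hs hr.2.1 hr.2.2.1 hr.2.2.2 hfold).1.2
        have t2 : Tendsto (fun z : (ℝ × ℝ) × Vec => z.2.2.2.2) (𝓝 ((s, 0), curve w s))
          (𝓝 (curve w s).2.2.2) := Continuous.tendsto' (by fun_prop) _ _ rfl
        filter_upwards [t2.eventually_lt_const hμ] with z hz _ _
        exact hz
    filter_upwards [h1, h2, h3] with z k1 k2 k3 hd h0 _
    exact ⟨k2, k3 hd h0, k1⟩

/-- Away from the corners the implicit function theorem applies at d = 0 itself, so the local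
solution is smooth across d = 0. -/
theorem IsFrame.exists_extension (hf : IsBistable f uM uP) (hw : IsProfile uM uP w)
    (hF : IsFrame f w v Λ) {s : ℝ} (hs : s ∈ regularTimes) :
    ∃ φ : ℝ × ℝ → Vec, ContDiffAt ℝ ∞ φ (s, 0) ∧ (∀ᶠ t in 𝓝 s, φ (t, 0) = curve w t) ∧
      ∀ᶠ z : (ℝ × ℝ) × Vec in 𝓝 ((s, 0), curve w s), augmented f v (curve w) z = 0 →
        φ z.1 = z.2 := by
  obtain ⟨φ, h1, -, h3⟩ := exists_implicit_function (u := ((s, (0 : ℝ)), curve w s))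
    (hf.contDiff_augmented hF.contDiff hw.contDiff_curve).contDiffAt (augmented_curve hf hw s)
    (hF.kernel hf hw hs)
  refine ⟨φ, h1, ?_, h3.mono fun z hz => hz.1⟩
  have hc := hw.contDiff_curve.continuous
  have t : Tendsto (fun t : ℝ => ((t, (0 : ℝ)), curve w t)) (𝓝 s) (𝓝 ((s, 0), curve w s)) :=
    ((continuous_id.prodMk continuous_const).prodMk hc).tendsto _
  filter_upwards [t.eventually h3] with t ht
  exact ht.1 (augmented_curve hf hw t)

theorem IsFrame.eventually_limit (hf : IsBistable f uM uP) (hw : IsProfile uM uP w)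
    (hF : IsFrame f w v Λ) {s : ℝ} (hs : s ∈ Ioo (0 : ℝ) 4) :
    ∀ᶠ q : ℝ × Vec in 𝓝 (s, curve w s), augmented f v (curve w) ((q.1, 0), q.2) = 0 →
      q ∈ sector f Λ → q.2 = curve w q.1 := by
  by_cases hi : s = 1 ∨ s = 2 ∨ s = 3
  · exact hF.corner_limit hf hw hi
  · push Not at hi
    obtain ⟨φ, -, h1, h2⟩ := hF.exists_extension hf hw (s := s) ⟨hs, hi.1, hi.2.1, hi.2.2⟩
    have t1 : Tendsto (fun q : ℝ × Vec => q.1) (𝓝 (s, curve w s)) (𝓝 s) :=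
      Continuous.tendsto' (by fun_prop) _ _ rfl
    have t2 : Tendsto (fun q : ℝ × Vec => ((q.1, (0 : ℝ)), q.2)) (𝓝 (s, curve w s))
      (𝓝 ((s, 0), curve w s)) := Continuous.tendsto' (by fun_prop) _ _ rfl
    filter_upwards [t1.eventually h1, t2.eventually h2] with q k1 k2 h0 _
    exact (k2 h0).symm.trans k1

/-- Only the starting time has to be regular, as continuation needs a nondegenerate solution at d =
0 there; the interval may contain corners. -/
theorem IsFrame.exists_branch (hf : IsBistable f uM uP) (hw : IsProfile uM uP w)
    (hF : IsFrame f w v Λ) (ha : a ∈ regularTimes) (hab : a ≤ b) (hb : b < 4) :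
    ∃ dstar x, IsBranch f w v Λ a b dstar x := by
  have hI : ∀ s ∈ Icc a b, s ∈ Ioo (0 : ℝ) 4 := fun s hs =>
    ⟨ha.1.1.trans_le hs.1, hs.2.trans_lt hb⟩
  obtain ⟨dstar, h1, x, h2, h3, h4⟩ := exists_branch_of_constraint
    (hf.contDiff_augmented hF.contDiff hw.contDiff_curve) hw.contDiff_curve.continuous
    (hf.isClosed_sector Λ) hab (augmented_curve hf hw a)
    (fun s hs => hF.eventually_limit hf hw (hI s hs))
    (fun s hs => (hF.eventually_regular hf hw (hI s hs)).mono fun z hz hd h0 hT =>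
      ⟨hf.openSector_subset Λ (hz hd h0 hT).1, (hz hd h0 hT).2.2⟩)
    (hF.kernel hf hw ha) (hf.openSector_subset Λ (hF.curve_mem_openSector hf hw ha))
  exact ⟨dstar, x, h1, ha.1.1, hb, h2, h3, h4⟩

theorem IsBranch.mem_Ioo (hB : IsBranch f w v Λ a b dstar x) {s : ℝ} (hs : s ∈ Ioo a b) :
    s ∈ Ioo (0 : ℝ) 4 :=
  ⟨hB.left_pos.trans hs.1, hs.2.trans hB.right_lt⟩

theorem IsBranch.eventually_mem (hB : IsBranch f w v Λ a b dstar x) {s : ℝ} (hs : s ∈ Ioo a b) :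
    ∀ᶠ p : ℝ × ℝ in 𝓝 (s, 0), p.1 ∈ Ioo a b ∧ p.2 < dstar := by
  have t1 : Tendsto (fun p : ℝ × ℝ => p.1) (𝓝 (s, 0)) (𝓝 s) :=
    Continuous.tendsto' (by fun_prop) _ _ rfl
  have t2 : Tendsto (fun p : ℝ × ℝ => p.2) (𝓝 (s, 0)) (𝓝 0) :=
    Continuous.tendsto' (by fun_prop) _ _ rfl
  exact (t1.eventually (Ioo_mem_nhds hs.1 hs.2)).and (t2.eventually_lt_const hB.pos)

/-- Uniform convergence to the curve puts the points of the branch into any given neighbourhood of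
(s, 0, Γ(s)), so local statements about solutions transfer to the branch. -/
theorem IsBranch.eventually (hB : IsBranch f w v Λ a b dstar x) (hw : IsProfile uM uP w) {s : ℝ}
    (hs : s ∈ Ioo a b) {P : (ℝ × ℝ) × Vec → Prop}
    (hP : ∀ᶠ z in 𝓝 ((s, (0 : ℝ)), curve w s), P z) :
    ∀ᶠ p : ℝ × ℝ in 𝓝 (s, 0), 0 < p.2 → P (p, x p) := by
  obtain ⟨r, hr, hball⟩ := Metric.eventually_nhds_iff.1 hP
  have hc := hw.contDiff_curve.continuous
  have t2 : Tendsto (fun p : ℝ × ℝ => p.2) (𝓝 (s, 0)) (𝓝 0) :=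
    Continuous.tendsto' (by fun_prop) _ _ rfl
  have t3 : Tendsto (fun p : ℝ × ℝ => curve w p.1) (𝓝 (s, 0)) (𝓝 (curve w s)) :=
    (hc.comp continuous_fst).tendsto _
  have hconv := eventually_nhdsWithin_iff.1 (hB.conv (r / 2) (by positivity))
  filter_upwards [hB.eventually_mem hs, t2.eventually hconv,
    t3.eventually (Metric.ball_mem_nhds _ (half_pos hr)), Metric.ball_mem_nhds (s, (0 : ℝ)) hr]
    with p h1 h2 h3 h4 hd
  refine hball ?_
  rw [Prod.dist_eq, max_lt_iff]
  refine ⟨h4, ?_⟩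
  have h5 := h2 hd p.1 (Ioo_subset_Icc_self h1.1)
  rw [← dist_eq_norm] at h5
  calc dist (x p) (curve w s) ≤ dist (x p) (curve w p.1) + dist (curve w p.1) (curve w s) :=
        dist_triangle _ _ _
    _ < r / 2 + r / 2 := add_lt_add h5 h3
    _ = r := add_halves r

theorem IsBranch.hasDerivAt (hB : IsBranch f w v Λ a b dstar x) {s d : ℝ} (hs : s ∈ Ioo a b)
    (hd : d ∈ Ioo 0 dstar) : HasDerivAt (fun s => x (s, d)) (velocity x (s, d)) s := by
  have h1 : DifferentiableAt ℝ x (s, d) := (hB.smooth s hs d hd).differentiableAt (by simp)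
  have h2 : DifferentiableAt ℝ (fun s : ℝ => (s, d)) s := by fun_prop
  exact (h1.comp s h2).hasDerivAt

theorem IsBranch.linearized_velocity (hf : IsBistable f uM uP)
    (hB : IsBranch f w v Λ a b dstar x) {s d : ℝ} (hs : s ∈ Ioo a b) (hd : d ∈ Ioo 0 dstar) :
    linearized f d (x (s, d)) (velocity x (s, d)) = 0 := by
  have h1 := hf.hasDerivAt_residual d (hB.hasDerivAt hs hd)
  refine (h1.congr_of_eventuallyEq ?_).unique (hasDerivAt_const s (0 : ℝ × ℝ × ℝ))
  filter_upwards [Ioo_mem_nhds hs.1 hs.2] with t ht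
  exact (augmented_eq_zero_iff.1 (hB.sol t (Ioo_subset_Icc_self ht) d hd).1).1.symm

theorem hasDerivAt_dot {κ : ℝ → Vec} {y : Vec} {t : ℝ} (u : Vec) (hκ : HasDerivAt κ y t) :
    HasDerivAt (fun t => dot u (κ t)) (dot u y) t := by
  have da : HasDerivAt (fun t => (κ t).1) y.1 t := hκ.fst
  have db : HasDerivAt (fun t => (κ t).2.1) y.2.1 t := hκ.snd.fst
  have dc : HasDerivAt (fun t => (κ t).2.2.1) y.2.2.1 t := hκ.snd.snd.fst
  have dm : HasDerivAt (fun t => (κ t).2.2.2) y.2.2.2 t := hκ.snd.snd.snd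
  exact (((da.const_mul u.1).add (db.const_mul u.2.1)).add (dc.const_mul u.2.2.1)).add
    (dm.const_mul u.2.2.2)

/-- Near a corner, the velocity in the transversal direction. -/
theorem IsBranch.dot_velocity (hw : IsProfile uM uP w) (hF : IsFrame f w v Λ)
    (hB : IsBranch f w v Λ a b dstar x) {i : ℝ} (hi : i = 1 ∨ i = 2 ∨ i = 3) (hiI : i ∈ Ioo a b) :
    ∀ᶠ p : ℝ × ℝ in 𝓝 (i, 0), 0 < p.2 →
      dot (cornerDir i) (velocity x p) = dot (cornerDir i) (curve' w p.1) + p.2 := by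
  have t1 : Tendsto (fun p : ℝ × ℝ => p.1) (𝓝 (i, 0)) (𝓝 i) :=
    Continuous.tendsto' (by fun_prop) _ _ rfl
  filter_upwards [t1.eventually (hF.corner i hi).eventually_nhds, hB.eventually_mem hiI]
  rintro ⟨s, d⟩ hv ⟨hs, hdd⟩ hd
  have hdI : d ∈ Ioo 0 dstar := ⟨hd, hdd⟩
  -- As v is constant near the corner, differentiating the selecting condition produces no term with
  -- the derivative of v.
  have h1 := hasDerivAt_dot (cornerDir i) ((hB.hasDerivAt hs hdI).sub (hw.hasDerivAt_curve s))
  have h2 : HasDerivAt (fun t : ℝ => d * t) d s := by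
    simpa using (hasDerivAt_id s).const_mul d
  have h3 := (h2.congr_of_eventuallyEq (f₁ := fun t => dot (cornerDir i) (x (t, d) - curve w t)) (by
    filter_upwards [hv, Ioo_mem_nhds hs.1 hs.2] with t ht htI
    have := (augmented_eq_zero_iff.1 (hB.sol t (Ioo_subset_Icc_self htI) d hdI).1).2
    simp only at this ht
    rw [← ht, this]))
  have := h1.unique h3
  rw [dot_sub] at this
  simp only
  linarith

theorem IsBranch.exists_extension (hf : IsBistable f uM uP) (hw : IsProfile uM uP w)
    (hF : IsFrame f w v Λ) (hB : IsBranch f w v Λ a b dstar x) {s : ℝ} (hs : s ∈ regularTimes)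
    (hsI : s ∈ Ioo a b) :
    ∃ φ : ℝ × ℝ → Vec, ContDiffAt ℝ ∞ φ (s, 0) ∧ (∀ᶠ t in 𝓝 s, φ (t, 0) = curve w t) ∧
      ∀ᶠ p : ℝ × ℝ in 𝓝 (s, 0), 0 < p.2 → x p = φ p := by
  obtain ⟨φ, h1, h2, h3⟩ := hF.exists_extension hf hw hs
  refine ⟨φ, h1, h2, ?_⟩
  filter_upwards [hB.eventually hw hsI h3, hB.eventually_mem hsI] with p k1 k2 hd
  exact (k1 hd (hB.sol p.1 (Ioo_subset_Icc_self k2.1) p.2 ⟨hd, k2.2⟩).1).symm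

/-- At a corner the velocity is a tangent, so it is bounded by C |ℓ·Γ' + d|, which tends to zero
together with Γ'. At regular times the extension across d = 0 is continuously differentiable. -/
theorem IsBranch.eventually_velocity (hf : IsBistable f uM uP) (hw : IsProfile uM uP w)
    (hF : IsFrame f w v Λ) (hB : IsBranch f w v Λ a b dstar x) {s : ℝ}
    (hsI : s ∈ Ioo a b) {ε : ℝ} (hε : 0 < ε) :
    ∀ᶠ p : ℝ × ℝ in 𝓝 (s, 0), 0 < p.2 → ‖velocity x p - curve' w p.1‖ < ε := by
  have hc' := hw.contDiff_curve'.continuous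
  by_cases hi : s = 1 ∨ s = 2 ∨ s = 3
  · obtain ⟨C, hC, hev⟩ := hF.corner_regular hf hw hi
    have h0 := curve'_corner (w := w) hi
    have hcont : Continuous fun p : ℝ × ℝ =>
        C * |dot (cornerDir s) (curve' w p.1) + p.2| + ‖curve' w p.1‖ := by
      have h1 : Continuous fun p : ℝ × ℝ => curve' w p.1 := hc'.comp continuous_fst
      have h2 := (continuous_dot (cornerDir s)).comp h1
      exact (((h2.add continuous_snd).abs).const_mul C).add h1.norm
    have t : Tendsto (fun p : ℝ × ℝ =>
        C * |dot (cornerDir s) (curve' w p.1) + p.2| + ‖curve' w p.1‖) (𝓝 (s, 0)) (𝓝 0) :=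
      hcont.tendsto' _ _ (by simp [h0, dot])
    filter_upwards [hB.eventually hw hsI hev, hB.dot_velocity hw hF hi hsI,
      hB.eventually_mem hsI, t.eventually_lt_const hε] with p k1 k2 k3 k4 hd
    have hdI : p.2 ∈ Ioo 0 dstar := ⟨hd, k3.2⟩
    obtain ⟨h5, h6⟩ := hB.sol p.1 (Ioo_subset_Icc_self k3.1) p.2 hdI
    have h7 :=
      (k1 hd hd (augmented_eq_zero_iff.1 h5).1 h6).2.2 _ (hB.linearized_velocity hf k3.1 hdI)
    rw [Prod.mk.eta, k2 hd] at h7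
    calc ‖velocity x p - curve' w p.1‖ ≤ ‖velocity x p‖ + ‖curve' w p.1‖ := norm_sub_le _ _
      _ ≤ _ := by gcongr
      _ < ε := k4
  · have hr : s ∈ regularTimes := by
      push Not at hi
      exact ⟨hB.mem_Ioo hsI, hi.1, hi.2.1, hi.2.2⟩
    obtain ⟨φ, h1, h2, h3⟩ := hB.exists_extension hf hw hF hr hsI
    have hd1 : ∀ᶠ p in 𝓝 (s, (0 : ℝ)), ContDiffAt ℝ 1 φ p :=
      (h1.of_le (by simp)).eventually (by simp)
    have hline : ∀ p : ℝ × ℝ, DifferentiableAt ℝ φ p →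
        HasDerivAt (fun t => φ (t, p.2)) (fderiv ℝ φ p (1, 0)) p.1 := fun p hp =>
      (show HasFDerivAt φ (fderiv ℝ φ p) (p.1, p.2) from hp.hasFDerivAt).comp_hasDerivAt p.1
        ((hasDerivAt_id p.1).prodMk (hasDerivAt_const p.1 p.2))
    have hval : fderiv ℝ φ (s, 0) (1, 0) = curve' w s := by
      have k1 := hline (s, 0) (h1.differentiableAt (by simp))
      have k2 : HasDerivAt (fun t => φ (t, 0)) (curve' w s) s :=
        (hw.hasDerivAt_curve s).congr_of_eventuallyEq h2
      exact k1.unique k2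
    have hcont : ContinuousAt (fun p : ℝ × ℝ => ‖fderiv ℝ φ p (1, 0) - curve' w p.1‖) (s, 0) :=
      (((h1.fderiv_right (m := 0) (by simp)).continuousAt.clm_apply continuousAt_const).sub
        (hc'.comp continuous_fst).continuousAt).norm
    have t := hcont.eventually_lt_const (u := ε) (by
      change ‖fderiv ℝ φ (s, 0) (1, 0) - curve' w s‖ < ε
      rw [hval, sub_self, norm_zero]
      exact hε)
    filter_upwards [h3.eventually_nhds, hd1, t] with p k1 k2 k3 hd
    have hd2 : ∀ᶠ t in 𝓝 p.1, x (t, p.2) = φ (t, p.2) := by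
      have hm : Tendsto (fun t : ℝ => (t, p.2)) (𝓝 p.1) (𝓝 p) :=
        Continuous.tendsto' (by fun_prop) _ _ rfl
      filter_upwards [hm.eventually k1] with t ht
      exact ht hd
    have k4 : velocity x p = fderiv ℝ φ p (1, 0) := by
      have h5 : (fun t => x (t, p.2)) =ᶠ[𝓝 p.1] fun t => φ (t, p.2) := hd2
      exact h5.deriv_eq.trans (hline p (k2.differentiableAt (by simp))).deriv
    rw [k4]
    exact k3

/-- Near regular times the distance from the curve is of order `d`. -/
theorem IsBranch.exists_linear_bound (hf : IsBistable f uM uP) (hw : IsProfile uM uP w)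
    (hF : IsFrame f w v Λ) (hB : IsBranch f w v Λ a b dstar x) {s : ℝ} (hs : s ∈ regularTimes)
    (hsI : s ∈ Ioo a b) :
    ∃ K : ℝ, 0 < K ∧ ∀ᶠ p : ℝ × ℝ in 𝓝 (s, 0), 0 < p.2 → ‖x p - curve w p.1‖ ≤ K * p.2 := by
  obtain ⟨φ, h1, h2, h3⟩ := hB.exists_extension hf hw hF hs hsI
  obtain ⟨K, U, hU, hK⟩ := (h1.of_le (m := 1) (by simp)).exists_lipschitzOnWith
  refine ⟨K + 1, by positivity, ?_⟩
  have t1 : Tendsto (fun p : ℝ × ℝ => p.1) (𝓝 (s, 0)) (𝓝 s) :=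
    Continuous.tendsto' (by fun_prop) _ _ rfl
  have t2 : Tendsto (fun p : ℝ × ℝ => (p.1, (0 : ℝ))) (𝓝 (s, 0)) (𝓝 (s, 0)) :=
    Continuous.tendsto' (by fun_prop) _ _ rfl
  filter_upwards [t1.eventually h2, h3, hU, t2.eventually hU] with p k1 k2 k3 k4 hd
  have h4 := hK.dist_le_mul p k3 _ k4
  have h5 : dist p (p.1, 0) = p.2 := by
    rw [Prod.dist_eq, dist_self, Real.dist_eq, sub_zero, abs_of_pos hd, max_eq_right hd.le]
  rw [k2 hd, ← k1, ← dist_eq_norm]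
  rw [h5] at h4
  linarith

/-- Near each time the branch moves strictly in a fixed direction. -/
theorem IsBranch.eventually_dot_pos (hf : IsBistable f uM uP) (hw : IsProfile uM uP w)
    (hF : IsFrame f w v Λ) (hB : IsBranch f w v Λ a b dstar x) {s : ℝ} (hsI : s ∈ Ioo a b) :
    ∀ᶠ p : ℝ × ℝ in 𝓝 (s, 0), 0 < p.2 → 0 < dot (v s) (velocity x p) := by
  have hc' := hw.contDiff_curve'.continuous
  by_cases hi : s = 1 ∨ s = 2 ∨ s = 3
  · have t1 : Tendsto (fun p : ℝ × ℝ => p.1) (𝓝 (s, 0)) (𝓝 s) :=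
      Continuous.tendsto' (by fun_prop) _ _ rfl
    have hvs := (hF.corner s hi).self_of_nhds
    filter_upwards [hB.dot_velocity hw hF hi hsI, t1.eventually (hF.corner s hi),
      hB.eventually_mem hsI] with p k1 k2 k3 hd
    rw [hvs, k1 hd]
    -- The curve contributes a nonnegative amount that vanishes at the corner; the summand d makes
    -- the total positive.
    have h4 : 0 ≤ dot (cornerDir s) (curve' w p.1) := by
      by_cases hp : p.1 = 1 ∨ p.1 = 2 ∨ p.1 = 3
      · rw [curve'_corner hp]
        simp [dot]
      · push Not at hp
        rw [← k2]
        exact (hF.pos p.1 ⟨hB.mem_Ioo k3.1, hp.1, hp.2.1, hp.2.2⟩).le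
    linarith
  · have hr : s ∈ regularTimes := by
      push Not at hi
      exact ⟨hB.mem_Ioo hsI, hi.1, hi.2.1, hi.2.2⟩
    have hpos := hF.pos s hr
    have hU : {y | 0 < dot (v s) y} ∈ 𝓝 (curve' w s) :=
      (isOpen_lt continuous_const (continuous_dot _)).mem_nhds hpos
    obtain ⟨r, hr0, hball⟩ := Metric.mem_nhds_iff.1 hU
    have t3 : Tendsto (fun p : ℝ × ℝ => curve' w p.1) (𝓝 (s, 0)) (𝓝 (curve' w s)) :=
      (hc'.comp continuous_fst).tendsto _
    filter_upwards [hB.eventually_velocity hf hw hF hsI (half_pos hr0),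
      t3.eventually (Metric.ball_mem_nhds _ (half_pos hr0))] with p k1 k2 hd
    refine hball ?_
    have k3 := k1 hd
    rw [← dist_eq_norm] at k3
    calc dist (velocity x p) (curve' w s) ≤
          dist (velocity x p) (curve' w p.1) + dist (curve' w p.1) (curve' w s) :=
          dist_triangle _ _ _
      _ < r / 2 + r / 2 := add_lt_add k3 k2
      _ = r := add_halves r

/-- A locally uniform statement along a compact interval holds uniformly for small `d`. -/
theorem eventually_forall_Icc {P : ℝ → ℝ → Prop} {s₀ s₁ : ℝ}
    (h : ∀ s ∈ Icc s₀ s₁, ∀ᶠ p : ℝ × ℝ in 𝓝 (s, 0), 0 < p.2 → P p.1 p.2) :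
    ∀ᶠ d in 𝓝[>] (0 : ℝ), ∀ s ∈ Icc s₀ s₁, P s d := by
  have := isCompact_Icc.eventually_forall_of_forall_eventually (x₀ := (0 : ℝ)) (K := Icc s₀ s₁)
    (P := fun d s => 0 < d → P s d) fun s hs =>
      (continuous_swap.tendsto ((0 : ℝ), s)).eventually (h s hs)
  exact eventually_nhdsWithin_iff.2 (this.mono fun d hd h0 s hs => hd s hs h0)

/-- Compactness over pairs (s, t) reduces this to two local cases. Near the diagonal the branch
moves strictly in the direction v(s); off the diagonal it stays near two distinct points of the
injective curve. -/
theorem IsBranch.eventually_injOn (hf : IsBistable f uM uP) (hw : IsProfile uM uP w)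
    (hF : IsFrame f w v Λ) (hB : IsBranch f w v Λ a b dstar x) (hinj : InjOn (curve w) (Icc 0 4))
    {s₀ s₁ : ℝ} (h₀ : a < s₀) (h₁ : s₁ < b) :
    ∀ᶠ d in 𝓝[>] (0 : ℝ), InjOn (fun s => x (s, d)) (Icc s₀ s₁) := by
  have hc := hw.contDiff_curve.continuous
  have key : ∀ st ∈ Icc s₀ s₁ ×ˢ Icc s₀ s₁, ∀ᶠ z : ℝ × ℝ × ℝ in 𝓝 ((0 : ℝ), st), 0 < z.1 →
      x (z.2.1, z.1) = x (z.2.2, z.1) → z.2.1 = z.2.2 := by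
    rintro ⟨s, t⟩ ⟨hs, ht⟩
    simp only at hs ht
    have hsI : s ∈ Ioo a b := ⟨h₀.trans_le hs.1, hs.2.trans_lt h₁⟩
    have htI : t ∈ Ioo a b := ⟨h₀.trans_le ht.1, ht.2.trans_lt h₁⟩
    have m1 : Tendsto (fun z : ℝ × ℝ × ℝ => (z.2.1, z.1)) (𝓝 (0, s, t)) (𝓝 (s, 0)) :=
      Continuous.tendsto' (by fun_prop) _ _ rfl
    have m2 : Tendsto (fun z : ℝ × ℝ × ℝ => (z.2.2, z.1)) (𝓝 (0, s, t)) (𝓝 (t, 0)) :=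
      Continuous.tendsto' (by fun_prop) _ _ rfl
    by_cases hst : s = t
    · subst hst
      obtain ⟨r, hr, hball⟩ := Metric.eventually_nhds_iff.1
        ((hB.eventually_dot_pos hf hw hF hsI).and (hB.eventually_mem hsI))
      have hlt : ∀ d s' t' : ℝ, 0 < d → s' < t' → dist (s', d) (s, (0 : ℝ)) < r →
          dist (t', d) (s, (0 : ℝ)) < r → x (s', d) ≠ x (t', d) := by
        intro d s' t' hd hlt e1 e2 heq
        have hin : ∀ τ ∈ Icc s' t', dist (τ, d) (s, (0 : ℝ)) < r := by
          intro τ hτ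
          rw [Prod.dist_eq, max_lt_iff] at e1 e2 ⊢
          simp only [Real.dist_eq, abs_lt] at e1 e2 ⊢
          exact ⟨⟨by linarith [hτ.1], by linarith [hτ.2]⟩, e1.2⟩
        have hder : ∀ τ ∈ Icc s' t', HasDerivAt (fun τ => dot (v s) (x (τ, d)))
            (dot (v s) (velocity x (τ, d))) τ := fun τ hτ =>
          hasDerivAt_dot _ (hB.hasDerivAt (hball (hin τ hτ)).2.1 ⟨hd, (hball (hin τ hτ)).2.2⟩)
        have hmono : StrictMonoOn (fun τ => dot (v s) (x (τ, d))) (Icc s' t') := by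
          refine strictMonoOn_of_deriv_pos (convex_Icc _ _)
            (fun τ hτ => (hder τ hτ).continuousAt.continuousWithinAt) fun τ hτ => ?_
          have hτI := interior_subset hτ
          rw [(hder τ hτI).deriv]
          exact (hball (hin τ hτI)).1 hd
        have := hmono (left_mem_Icc.2 hlt.le) (right_mem_Icc.2 hlt.le) hlt
        simp only [heq, lt_irrefl] at this
      filter_upwards [m1.eventually (Metric.ball_mem_nhds _ hr),
        m2.eventually (Metric.ball_mem_nhds _ hr)] with z e1 e2 hd heq
      rcases lt_trichotomy z.2.1 z.2.2 with h | h | h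
      · exact (hlt _ _ _ hd h e1 e2 heq).elim
      · exact h
      · exact (hlt _ _ _ hd h e2 e1 heq.symm).elim
    · have hne : curve w s ≠ curve w t := fun h =>
        hst (hinj (Ioo_subset_Icc_self (hB.mem_Ioo hsI)) (Ioo_subset_Icc_self (hB.mem_Ioo htI)) h)
      obtain ⟨U, V, hU, hV, hsU, htV, hUV⟩ := t2_separation hne
      have tU : Tendsto (fun z : (ℝ × ℝ) × Vec => z.2) (𝓝 ((s, 0), curve w s)) (𝓝 (curve w s)) :=
        Continuous.tendsto' (by fun_prop) _ _ rfl
      have tV : Tendsto (fun z : (ℝ × ℝ) × Vec => z.2) (𝓝 ((t, 0), curve w t)) (𝓝 (curve w t)) :=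
        Continuous.tendsto' (by fun_prop) _ _ rfl
      have e1 := hB.eventually hw hsI (tU.eventually (hU.mem_nhds hsU))
      have e2 := hB.eventually hw htI (tV.eventually (hV.mem_nhds htV))
      filter_upwards [m1.eventually e1, m2.eventually e2] with z k1 k2 hd heq
      have k1 := k1 hd
      have k2 := k2 hd
      change x (z.2.1, z.1) ∈ U at k1
      change x (z.2.2, z.1) ∈ V at k2
      rw [heq] at k1
      exact (disjoint_left.1 hUV k1 k2).elim
  have := (isCompact_Icc.prod isCompact_Icc).eventually_forall_of_forall_eventually
    (P := fun d st => 0 < d → x (st.1, d) = x (st.2, d) → st.1 = st.2) key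
  refine eventually_nhdsWithin_iff.2 (this.mono fun d hd h0 s hs t ht heq => ?_)
  exact hd (s, t) ⟨hs, ht⟩ h0 heq

/-- For small `d`, the branch consists of solutions with `μ ∈ [0, 1]`. -/
theorem IsBranch.eventually_sol (hf : IsBistable f uM uP) (hw : IsProfile uM uP w)
    (hF : IsFrame f w v Λ) (hB : IsBranch f w v Λ a b dstar x) {s₀ s₁ : ℝ} (h₀ : a < s₀)
    (h₁ : s₁ < b) :
    ∀ᶠ d in 𝓝[>] (0 : ℝ), ∀ s ∈ Icc s₀ s₁, residual f d (x (s, d)) = 0 ∧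
      (x (s, d)).2.2.2 ∈ Icc (0 : ℝ) 1 := by
  refine eventually_forall_Icc fun s hs => ?_
  have hsI : s ∈ Ioo a b := ⟨h₀.trans_le hs.1, hs.2.trans_lt h₁⟩
  filter_upwards [hB.eventually hw hsI (hF.eventually_regular hf hw (hB.mem_Ioo hsI)),
    hB.eventually_mem hsI] with p k1 k2 hd
  obtain ⟨h5, h6⟩ := hB.sol p.1 (Ioo_subset_Icc_self k2.1) p.2 ⟨hd, k2.2⟩
  exact ⟨(augmented_eq_zero_iff.1 h5).1, h6.1, (k1 hd hd h5 h6).2.1.le⟩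

end Branch

/-! ### Symmetric states on the ring and the set Γ -/

theorem flipIndex_six (n : ZMod 6) :
    flipIndex n = 1 ∨ flipIndex n = 2 ∨ flipIndex n = 3 ∨ flipIndex n = 4 := by
  revert n; decide

/-- The embedding of the reduced state space, as a linear map. -/
def embedLinear : Vec →ₗ[ℝ] Point 6 where
  toFun x := mkPoint (symmExtend 6 fun n => if n = 1 then x.1 else if n = 4 then x.2.2.1 else x.2.1)
    x.2.2.2
  map_add' x y := by
    refine WithLp.ofLp_injective 2 (Prod.ext ?_ rfl)
    ext n
    simp only [mkPoint, symmExtend, WithLp.ofLp_add, Prod.fst_add, Prod.snd_add, PiLp.add_apply]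
    split_ifs <;> rfl
  map_smul' r x := by
    refine WithLp.ofLp_injective 2 (Prod.ext ?_ rfl)
    ext n
    simp only [mkPoint, symmExtend, WithLp.ofLp_smul, Prod.smul_fst, Prod.smul_snd,
      PiLp.smul_apply, RingHom.id_apply]
    split_ifs <;> rfl

theorem continuous_embedLinear : Continuous embedLinear := by
  refine (WithLp.prod_continuous_toLp 2 _ _).comp (Continuous.prodMk ?_ (by fun_prop))
  refine (PiLp.continuous_toLp 2 _).comp (continuous_pi fun n => ?_)
  change Continuous fun x : Vec =>
    if flipIndex n = 1 then x.1 else if flipIndex n = 4 then x.2.2.1 else x.2.1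
  split_ifs <;> fun_prop

/-- The symmetric state on the ring with six nodes given by its values at the nodes `1`, `2`, `4`
and the parameter. -/
def embed : Vec →L[ℝ] Point 6 := ⟨embedLinear, continuous_embedLinear⟩

instance : ContinuousSMul ℝ (Point 6) := IsBoundedSMul.continuousSMul

theorem hasDerivAt_embed {κ : ℝ → Vec} {y : Vec} {t : ℝ} (h : HasDerivAt κ y t) :
    HasDerivAt (fun t => embed (κ t)) (embed y) t :=
  embed.hasFDerivAt.comp_hasDerivAt t h

theorem contDiff_embed : ContDiff ℝ ∞ embed := embed.contDiff

theorem embed_eq {u : ℕ → ℝ} {x : Vec} (h1 : u 1 = x.1) (h2 : u 2 = x.2.1) (h3 : u 3 = x.2.1)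
    (h4 : u 4 = x.2.2.1) : mkPoint (symmExtend 6 u) x.2.2.2 = embed x := by
  change mkPoint _ _ = mkPoint _ _
  congr 1
  ext n
  rcases flipIndex_six n with h | h | h | h <;> simp [symmExtend, h, h1, h2, h3, h4]

theorem embed_snd (x : Vec) : (embed x).snd = x.2.2.2 := rfl

theorem embed_fst (x : Vec) (n : ZMod 6) : (embed x).fst n =
    if flipIndex n = 1 then x.1 else if flipIndex n = 4 then x.2.2.1 else x.2.1 := rfl

theorem embed_injective : Function.Injective embed := by
  intro x y h
  have h1 : (embed x).fst 1 = (embed y).fst 1 := by rw [h]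
  have h2 : (embed x).fst 2 = (embed y).fst 2 := by rw [h]
  have h4 : (embed x).fst 4 = (embed y).fst 4 := by rw [h]
  have h5 : (embed x).snd = (embed y).snd := by rw [h]
  exact Prod.ext h1 (Prod.ext h2 (Prod.ext h4 h5))

theorem isFlipSymmetric_embed (x : Vec) : IsFlipSymmetric (embed x).fst := by
  intro n
  have h : flipIndex (2 - n) = flipIndex n := by revert n; decide
  rw [embed_fst, embed_fst, h]

theorem norm_sq_embed (x : Vec) :
    ‖embed x‖ ^ 2 = x.1 ^ 2 + 4 * x.2.1 ^ 2 + x.2.2.1 ^ 2 + x.2.2.2 ^ 2 := by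
  rw [WithLp.prod_norm_sq_eq_of_L2, EuclideanSpace.norm_sq_eq]
  have : ∑ i : ZMod 6, ‖(embed x).fst i‖ ^ 2 = ∑ i : Fin 6, ‖(embed x).fst (i : ZMod 6)‖ ^ 2 := rfl
  rw [this, Fin.sum_univ_six]
  change ‖x.2.1‖ ^ 2 + ‖x.1‖ ^ 2 + ‖x.2.1‖ ^ 2 + ‖x.2.1‖ ^ 2 + ‖x.2.2.1‖ ^ 2 + ‖x.2.1‖ ^ 2 +
    ‖x.2.2.2‖ ^ 2 = _
  simp only [Real.norm_eq_abs, sq_abs]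
  ring

theorem coupling_six (U : Config 6) (n : ZMod 6) :
    coupling 2 U n = U (n + 2) + U (n + 1) + U (n + 5) + U (n + 4) - 4 * U n := by
  have h : Finset.Icc (-((2 : ℕ) : ℤ)) ((2 : ℕ) : ℤ) = {-2, -1, 0, 1, 2} := by decide
  rw [coupling, if_pos (by norm_num), h]
  have e1 : ((-2 : ℤ) : ZMod 6) = 4 := by decide
  have e2 : ((-1 : ℤ) : ZMod 6) = 5 := by decide
  have e3 : ((0 : ℤ) : ZMod 6) = 0 := by decide
  have e4 : ((1 : ℤ) : ZMod 6) = 1 := by decide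
  have e5 : ((2 : ℤ) : ZMod 6) = 2 := by decide
  rw [Finset.sum_insert (by decide), Finset.sum_insert (by decide), Finset.sum_insert (by decide),
    Finset.sum_insert (by decide), Finset.sum_singleton, e1, e2, e3, e4, e5, add_zero]
  push_cast
  ring

/-- Every node is coupled to all others except its antipode n + 3. Nodes 1 and 4 thus see four
copies of u₂, and each of the nodes 2, 3, 5, 6 sees u₁, u₄ and two copies of u₂. -/
theorem isSteadyState_embed {f : ℝ → ℝ → ℝ} {d : ℝ} {x : Vec} (h : residual f d x = 0) :
    IsSteadyState f 2 d (embed x) := by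
  simp only [residual, Prod.mk_eq_zero] at h
  obtain ⟨ha, hb, hc⟩ := h
  intro n
  rw [rhs, coupling_six, embed_snd]
  fin_cases n
  · change d * (x.2.1 + x.1 + x.2.1 + x.2.2.1 - 4 * x.2.1) + f x.2.1 x.2.2.2 = 0
    linarith
  · change d * (x.2.1 + x.2.1 + x.2.1 + x.2.1 - 4 * x.1) + f x.1 x.2.2.2 = 0
    linarith
  · change d * (x.2.2.1 + x.2.1 + x.1 + x.2.1 - 4 * x.2.1) + f x.2.1 x.2.2.2 = 0
    linarith
  · change d * (x.2.1 + x.2.2.1 + x.2.1 + x.1 - 4 * x.2.1) + f x.2.1 x.2.2.2 = 0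
    linarith
  · change d * (x.2.1 + x.2.1 + x.2.1 + x.2.1 - 4 * x.2.2.1) + f x.2.2.1 x.2.2.2 = 0
    linarith
  · change d * (x.1 + x.2.1 + x.2.2.1 + x.2.1 - 4 * x.2.1) + f x.2.1 x.2.2.2 = 0
    linarith

section Gamma

variable {f : ℝ → ℝ → ℝ} {uM uP w : ℝ → ℝ}

theorem mkPoint_barV_one (μ : ℝ) :
    mkPoint (barV 6 uM uP 1 μ) μ = embed (uM μ, 0, 0, μ) :=
  embed_eq (x := (uM μ, 0, 0, μ)) (by simp) (by simp) (by simp) (by simp)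

theorem mkPoint_barU_one (μ : ℝ) : mkPoint (barU 6 uP 1 μ) μ = embed (uP μ, 0, 0, μ) :=
  embed_eq (x := (uP μ, 0, 0, μ)) (by simp) (by simp) (by simp) (by simp)

theorem mkPoint_barW23 (μ : ℝ) :
    mkPoint (barW23 uM uP μ) μ = embed (uP μ, uM μ, 0, μ) :=
  embed_eq (x := (uP μ, uM μ, 0, μ)) (by simp) (by simp) (by simp) (by simp)

theorem mkPoint_barU_three (μ : ℝ) :
    mkPoint (barU 6 uP 3 μ) μ = embed (uP μ, uP μ, 0, μ) :=
  embed_eq (x := (uP μ, uP μ, 0, μ)) (by simp) (by simp) (by simp) (by simp)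

theorem mkPoint_barV_four (μ : ℝ) :
    mkPoint (barV 6 uM uP 4 μ) μ = embed (uP μ, uP μ, uM μ, μ) :=
  embed_eq (x := (uP μ, uP μ, uM μ, μ)) (by simp) (by simp) (by simp) (by simp)

theorem exists_clock_eq (k : ℝ) {t : ℝ} (ht : t ∈ Icc (0 : ℝ) 1) :
    ∃ s ∈ Icc k (k + 1), clock k s = t := by
  have := intermediate_value_Icc (show k ≤ k + 1 by linarith)
    (contDiff_clock k).continuous.continuousOn
  rw [clock_eq_zero le_rfl, clock_eq_one le_rfl] at this
  exact this ht

theorem exists_par_eq {μ : ℝ} (hμ : μ ∈ Icc (0 : ℝ) 1) : ∃ τ ∈ Icc (0 : ℝ) 1, par τ = μ := by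
  have := intermediate_value_Icc' (zero_le_one (α := ℝ)) contDiff_par.continuous.continuousOn
  rw [par_zero, par_one] at this
  exact this hμ

theorem gamma_eq_image (hf : IsBistable f uM uP) (hw : IsProfile uM uP w) :
    Gamma62 uM uP = (fun s => embed (curve w s)) '' Icc 0 4 := by
  have hpar : ∀ {σ : ℝ}, σ ∈ Icc (-1 : ℝ) 1 → par σ ∈ Icc (0 : ℝ) 1 := fun {σ} h =>
    par_mem (by nlinarith [h.1, h.2])
  have hpar' : ∀ t : ℝ, par (1 - t) = par (-1 + t) := fun t => by
    rw [← par_neg]; ring_nf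
  simp only [Gamma62, mkPoint_barV_one, mkPoint_barU_one, mkPoint_barW23, mkPoint_barU_three,
    mkPoint_barV_four]
  apply Subset.antisymm
  · intro p hp
    simp only [mem_iUnion, mem_insert_iff, mem_singleton_iff] at hp
    obtain ⟨μ, hμ, hp⟩ := hp
    -- With μ = `par τ` and τ in [0, 1] the roots are u_- = w(-τ) and u₊ = w(τ); each pattern fixes
    -- the clock value at which it is met.
    obtain ⟨τ, hτ, rfl⟩ := exists_par_eq hμ
    have hl : w (-τ) = uM (par τ) := by
      rw [hw.left _ ⟨by linarith [hτ.2], by linarith [hτ.1]⟩, par_neg]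
    have hr : w τ = uP (par τ) := hw.right _ hτ
    rw [← hl, ← hr] at hp
    rcases hp with rfl | rfl | rfl | rfl | rfl
    · obtain ⟨s, hs, he⟩ := exists_clock_eq 0 (t := (1 - τ) / 2)
        ⟨by linarith [hτ.2], by linarith [hτ.1]⟩
      refine ⟨s, ⟨hs.1, by linarith [hs.2]⟩, ?_⟩
      simp only
      rw [curve_of_le_one hf hw (by linarith [hs.2]), he, ← par_neg τ]
      ring_nf
    · obtain ⟨s, hs, he⟩ := exists_clock_eq 0 (t := (1 + τ) / 2)
        ⟨by linarith [hτ.1], by linarith [hτ.2]⟩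
      refine ⟨s, ⟨hs.1, by linarith [hs.2]⟩, ?_⟩
      simp only
      rw [curve_of_le_one hf hw (by linarith [hs.2]), he]
      ring_nf
    · obtain ⟨s, hs, he⟩ := exists_clock_eq 1 (t := 1 - τ)
        ⟨by linarith [hτ.2], by linarith [hτ.1]⟩
      refine ⟨s, ⟨by linarith [hs.1], by linarith [hs.2]⟩, ?_⟩
      simp only
      rw [curve_of_mem_Icc_one_two hf hw hs.1 (by linarith [hs.2]), he, ← par_neg τ]
      ring_nf
    · obtain ⟨s, hs, he⟩ := exists_clock_eq 2 hτ
      refine ⟨s, ⟨by linarith [hs.1], by linarith [hs.2]⟩, ?_⟩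
      simp only
      rw [curve_of_mem_Icc_two_three hf hw hs.1 (by linarith [hs.2]), he]
    · obtain ⟨s, hs, he⟩ := exists_clock_eq 3 (t := 1 - τ)
        ⟨by linarith [hτ.2], by linarith [hτ.1]⟩
      refine ⟨s, ⟨by linarith [hs.1], by linarith [hs.2]⟩, ?_⟩
      simp only
      rw [curve_of_three_le hs.1, he, ← par_neg τ]
      ring_nf
  · rintro _ ⟨s, hs, rfl⟩
    simp only [mem_iUnion, mem_insert_iff, mem_singleton_iff]
    refine ⟨(curve w s).2.2.2, (curve_roots hf hw s).2.2.2.2, ?_⟩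
    have c1 := clock_nonneg 1 s
    have c1' := clock_le_one 1 s
    have c3 := clock_nonneg 3 s
    have c3' := clock_le_one 3 s
    rcases le_total s 1 with h1 | h1
    · rw [curve_of_le_one hf hw h1]
      simp only
      have hm := arg₀_mem s
      rcases le_total (-1 + 2 * clock 0 s) 0 with h0 | h0
      · left; rw [hw.left _ ⟨hm.1, h0⟩]
      · right; left; rw [hw.right _ ⟨h0, hm.2⟩]
    rcases le_total s 2 with h2 | h2
    · rw [curve_of_mem_Icc_one_two hf hw h1 h2]
      right; right; left
      simp only
      rw [hw.left (-1 + clock 1 s) ⟨by linarith, by linarith⟩,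
        hw.right (1 - clock 1 s) ⟨by linarith, by linarith⟩, hpar']
    rcases le_total s 3 with h3 | h3
    · rw [curve_of_mem_Icc_two_three hf hw h2 h3]
      right; right; right; left
      simp only
      rw [hw.right _ ⟨clock_nonneg 2 s, clock_le_one 2 s⟩]
    · rw [curve_of_three_le h3]
      right; right; right; right
      simp only
      rw [hw.left (-1 + clock 3 s) ⟨by linarith, by linarith⟩,
        hw.right (1 - clock 3 s) ⟨by linarith, by linarith⟩, hpar']

/-- Equal parameters leave only τ = ±σ, and off the fold the two signs are separated by u_- < u₊. -/
theorem IsProfile.injective (hf : IsBistable f uM uP) (hw : IsProfile uM uP w) {σ τ : ℝ}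
    (hσ : σ ∈ Icc (-1 : ℝ) 1) (hτ : τ ∈ Icc (-1 : ℝ) 1) (h1 : w σ = w τ) (h2 : par σ = par τ) :
    σ = τ := by
  have hne : ∀ t ∈ Ioc (0 : ℝ) 1, w t ≠ w (-t) := by
    intro t ht h
    rw [hw.right t ⟨ht.1.le, ht.2⟩, hw.left (-t) ⟨by linarith [ht.2], by linarith [ht.1]⟩,
      par_neg] at h
    rcases eq_or_lt_of_le ht.2 with rfl | h3
    · rw [par_one, hf.uM_zero] at h
      exact hf.uP_zero.ne' h
    · exact (hf.order _ (par_mem_Ioo ht.1.ne' (by nlinarith [ht.1]))).2.ne' h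
  have hsq : (1 - σ ^ 2) = (1 - τ ^ 2) := by
    unfold par at h2
    exact (pow_left_inj₀ (by nlinarith [hσ.1, hσ.2]) (by nlinarith [hτ.1, hτ.2]) two_ne_zero).1 h2
  rcases sq_eq_sq_iff_eq_or_eq_neg.1 (show σ ^ 2 = τ ^ 2 by linarith) with h | h
  · exact h
  · rcases lt_trichotomy 0 τ with h0 | h0 | h0
    · rw [h] at h1
      exact (hne τ ⟨h0, hτ.2⟩ h1.symm).elim
    · rw [h, ← h0, neg_zero]
    · have h3 : τ = -σ := by linarith
      rw [h3] at h1
      exact (hne σ ⟨by linarith, hσ.2⟩ h1).elim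

/-- On [0, 1], (1, 3] and (3, 4] the pairs (u₁, μ), (u₂, μ) and (u₄, μ) run injectively along the
arc of roots; on (1, 3] the second and third pieces combine to one passage. Positivity of u₂ and u₄
separates the three ranges. -/
theorem curve_injOn (hf : IsBistable f uM uP) (hw : IsProfile uM uP w) :
    InjOn (curve w) (Icc 0 4) := by
  have key : ∀ s ∈ Icc (0 : ℝ) 4, ∀ t ∈ Icc (0 : ℝ) 4, s ≤ t → curve w s = curve w t → s = t := by
    intro s hs t ht hst heq
    have hb : (curve w s).2.1 = (curve w t).2.1 := by rw [heq]
    have hc : (curve w s).2.2.1 = (curve w t).2.2.1 := by rw [heq]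
    have hμ : (curve w s).2.2.2 = (curve w t).2.2.2 := by rw [heq]
    rcases lt_or_ge 3 t with h3 | h3
    · rw [curve_of_three_le h3.le] at hc hμ
      rcases lt_or_ge 3 s with k3 | k3
      · rw [curve_of_three_le k3.le] at hc hμ
        have := hw.injective hf (arg₃_mem s) (arg₃_mem t) hc hμ
        exact (clock_strictMonoOn 3).injOn ⟨k3.le, by linarith [hs.2]⟩ ⟨h3.le, by linarith [ht.2]⟩
          (by linarith)
      · rw [curve_last_eq_zero hf hw k3] at hc
        have := hw.pos hf (σ := -1 + clock 3 t) ⟨by linarith [clock_pos h3], (arg₃_mem t).2⟩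
        exact (this.ne hc).elim
    rcases lt_or_ge 1 t with h1 | h1
    · have hform : ∀ r : ℝ, 1 < r → r ≤ 3 → (curve w r).2.1 = w (-1 + clock 1 r + clock 2 r) ∧
          (curve w r).2.2.2 = par (-1 + clock 1 r + clock 2 r) := by
        intro r hr1 hr3
        rcases le_total r 2 with h2 | h2
        · rw [curve_of_mem_Icc_one_two hf hw hr1.le h2, clock_eq_zero h2, add_zero]
          exact ⟨rfl, rfl⟩
        · rw [curve_of_mem_Icc_two_three hf hw h2 hr3,
            clock_eq_one (show (1 : ℝ) + 1 ≤ r by linarith)]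
          simp
      obtain ⟨tb, tμ⟩ := hform t h1 h3
      rcases lt_or_ge 1 s with k1 | k1
      · obtain ⟨sb, sμ⟩ := hform s k1 (by linarith)
        rw [tb, sb] at hb
        rw [tμ, sμ] at hμ
        have h5 := hw.injective hf (arg₁_mem s) (arg₁_mem t) hb hμ
        by_contra hne
        have hlt := lt_of_le_of_ne hst hne
        have mono : ∀ k r r' : ℝ, r ≤ r' → clock k r ≤ clock k r' := by
          intro k r r' h
          rcases le_total r k with a1 | a1
          · rw [clock_eq_zero a1]; exact clock_nonneg _ _
          rcases le_total (k + 1) r' with a2 | a2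
          · rw [clock_eq_one a2]; exact clock_le_one _ _
          · exact (clock_strictMonoOn k).monotoneOn ⟨a1, by linarith⟩ ⟨by linarith, a2⟩ h
        have m1 := mono 1 s t hst
        have m2 := mono 2 s t hst
        rcases lt_or_ge s 2 with a1 | a1
        · have m3 : clock 1 s < clock 1 t := by
            rcases le_total (1 + 1) t with a2 | a2
            · rw [clock_eq_one a2]
              exact clock_lt_one (by linarith)
            · exact clock_strictMonoOn 1 ⟨k1.le, by linarith⟩ ⟨h1.le, a2⟩ hlt
          linarith
        · have m3 := clock_strictMonoOn 2 ⟨a1, by linarith⟩ ⟨by linarith, by linarith⟩ hlt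
          linarith
      · rw [tb, curve_of_le_one hf hw k1] at hb
        have hpos : -1 < -1 + clock 1 t + clock 2 t := by
          linarith [clock_pos h1, clock_nonneg 2 t]
        have := hw.pos hf (σ := -1 + clock 1 t + clock 2 t) ⟨hpos, (arg₁_mem t).2⟩
        exact (this.ne hb).elim
    · have ha : (curve w s).1 = (curve w t).1 := by rw [heq]
      rw [curve_of_le_one hf hw h1, curve_of_le_one hf hw (hst.trans h1)] at ha hμ
      have := hw.injective hf (arg₀_mem s) (arg₀_mem t) ha hμ
      exact (clock_strictMonoOn 0).injOn ⟨hs.1, by linarith⟩ ⟨ht.1, by linarith⟩ (by linarith)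
  intro s hs t ht h
  rcases le_total s t with hst | hst
  · exact key s hs t ht hst h
  · exact (key t ht s hs hst h.symm).symm

theorem curve_zero (hf : IsBistable f uM uP) (hw : IsProfile uM uP w) :
    curve w 0 = (0, 0, 0, 0) := by
  rw [curve_of_le_one hf hw zero_le_one, clock_eq_zero le_rfl]
  simp [hw.at_neg_one hf, par_neg_one]

theorem curve_four (hf : IsBistable f uM uP) (hw : IsProfile uM uP w) :
    curve w 4 = (1, 1, 1, 1) := by
  rw [curve_of_three_le (by norm_num), clock_eq_one (by norm_num)]
  simp [hw.at_zero hf, par_zero]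

theorem exceptional_eq (hf : IsBistable f uM uP) (hw : IsProfile uM uP w) :
    exceptional uM uP = {embed (curve w 0), embed (curve w 4)} := by
  rw [exceptional, mkPoint_barV_one, mkPoint_barV_four, curve_zero hf hw, curve_four hf hw,
    hf.uM_zero, hf.uM_one, hf.uP_one]

theorem embed_corner_mem (hf : IsBistable f uM uP) (hw : IsProfile uM uP w) {s : ℝ}
    (hs : s = 1 ∨ s = 2 ∨ s = 3) : embed (curve w s) ∈ corners62 uP := by
  rw [corners62, mkPoint_barU_one, mkPoint_barU_three, mkPoint_barU_three, hf.uP_one]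
  rcases hs with rfl | rfl | rfl
  · rw [curve_one hf hw]; simp
  · rw [curve_two hf hw]; simp
  · rw [curve_three hf hw]; simp

end Gamma

/-! ### Reparametrization and the family of embedded arcs -/

/-- The affine map of `[0, 1]` onto `[s₀ + K d, s₁ - K d]`. -/
def chart (s₀ s₁ K d t : ℝ) : ℝ := s₀ + K * d + t * (s₁ - s₀ - 2 * K * d)

section Chart

variable {s₀ s₁ K d t : ℝ}

theorem continuous_chart (s₀ s₁ K : ℝ) :
    Continuous fun p : ℝ × ℝ => chart s₀ s₁ K p.2 p.1 := by
  unfold chart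
  fun_prop

theorem hasDerivAt_chart (s₀ s₁ K d t : ℝ) :
    HasDerivAt (chart s₀ s₁ K d) (s₁ - s₀ - 2 * K * d) t := by
  have := ((hasDerivAt_id t).mul_const (s₁ - s₀ - 2 * K * d)).const_add (s₀ + K * d)
  exact this.congr_deriv (by ring)

theorem chart_mem (ht : t ∈ Icc (0 : ℝ) 1) (h : 2 * K * d ≤ s₁ - s₀) :
    s₀ + K * d ≤ chart s₀ s₁ K d t ∧ chart s₀ s₁ K d t ≤ s₁ - K * d := by
  have h1 : 0 ≤ s₁ - s₀ - 2 * K * d := by linarith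
  have h2 := mul_nonneg ht.1 h1
  have h3 := mul_le_mul_of_nonneg_right ht.2 h1
  unfold chart
  exact ⟨by linarith, by linarith⟩

theorem chart_injective (h : 2 * K * d < s₁ - s₀) : Function.Injective (chart s₀ s₁ K d) := by
  intro t t' heq
  unfold chart at heq
  exact mul_right_cancel₀ (by linarith : s₁ - s₀ - 2 * K * d ≠ 0) (by linarith)

theorem chart_image (h : s₀ < s₁) : chart s₀ s₁ K 0 '' Icc 0 1 = Icc s₀ s₁ := by
  apply Subset.antisymm
  · rintro _ ⟨t, ht, rfl⟩
    have := chart_mem (s₀ := s₀) (s₁ := s₁) (K := K) (d := 0) ht (by linarith)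
    simpa using this
  · intro s hs
    have h1 : 0 < s₁ - s₀ := by linarith
    refine ⟨(s - s₀) / (s₁ - s₀), ⟨div_nonneg (by linarith [hs.1]) h1.le,
      (div_le_one h1).2 (by linarith [hs.2])⟩, ?_⟩
    unfold chart
    field_simp
    ring

end Chart

section Conclusion

variable {f : ℝ → ℝ → ℝ} {uM uP w : ℝ → ℝ} {v : ℝ → Vec} {Λ a b dstar : ℝ} {x : ℝ × ℝ → Vec}

/-- Locally uniform convergence on `(a, b)` passes to the reparametrized curves. -/
theorem eventually_norm_embed_sub_lt {F : ℝ × ℝ → Vec} {G : ℝ → Vec} (hG : Continuous G)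
    (hF : ∀ s ∈ Ioo a b, ∀ ε : ℝ, 0 < ε → ∀ᶠ p : ℝ × ℝ in 𝓝 (s, 0), 0 < p.2 → ‖F p - G p.1‖ < ε)
    {s₀ s₁ : ℝ} (h₀ : a < s₀) (h₀₁ : s₀ < s₁) (h₁ : s₁ < b) (K : ℝ) {c : ℝ → ℝ}
    (hc : Continuous c) {ε : ℝ} (hε : 0 < ε) :
    ∀ᶠ d in 𝓝[>] (0 : ℝ), ∀ t ∈ Icc (0 : ℝ) 1,
      ‖embed (c d • F (chart s₀ s₁ K d t, d)) - embed (c 0 • G (chart s₀ s₁ K 0 t))‖ < ε := by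
  refine eventually_forall_Icc fun t ht => ?_
  set s := chart s₀ s₁ K 0 t with hs
  have hsI : s ∈ Ioo a b := by
    have := chart_mem (s₀ := s₀) (s₁ := s₁) (K := K) (d := 0) ht (by linarith)
    rw [mul_zero, add_zero, sub_zero] at this
    exact ⟨h₀.trans_le this.1, this.2.trans_lt h₁⟩
  -- Approach to (s, 0) through positive d only. The reparametrization maps such filters to each
  -- other, so locally uniform limits compose.
  set l : ℝ → Filter (ℝ × ℝ) := fun s => 𝓝 (s, 0) ⊓ 𝓟 {p | 0 < p.2} with hl
  have hFl : Tendsto F (l s) (𝓝 (G s)) := by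
    have h1 : Tendsto (fun p => F p - G p.1) (l s) (𝓝 0) := by
      refine Metric.tendsto_nhds.2 fun ε' hε' => ?_
      simp only [dist_zero_right]
      exact eventually_inf_principal.2 (hF s hsI ε' hε')
    have h2 : Tendsto (fun p : ℝ × ℝ => G p.1) (l s) (𝓝 (G s)) :=
      ((hG.comp continuous_fst).tendsto (s, (0 : ℝ))).mono_left inf_le_left
    simpa using h1.add h2
  have hm : Tendsto (fun p : ℝ × ℝ => (chart s₀ s₁ K p.2 p.1, p.2)) (l t) (l s) := by
    refine tendsto_inf.2 ⟨?_, tendsto_principal.2 (eventually_inf_principal.2 ?_)⟩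
    · exact (((continuous_chart s₀ s₁ K).prodMk continuous_snd).tendsto (t, (0 : ℝ))).mono_left
        inf_le_left
    · exact Eventually.of_forall fun p hp => hp
  have h3 : Tendsto (fun p : ℝ × ℝ => embed (c p.2 • F (chart s₀ s₁ K p.2 p.1, p.2))) (l t)
      (𝓝 (embed (c 0 • G s))) :=
    (embed.continuous.tendsto _).comp
      ((((hc.comp continuous_snd).tendsto (t, (0 : ℝ))).mono_left inf_le_left).smul (hFl.comp hm))
  have h4 : Tendsto (fun p : ℝ × ℝ => embed (c 0 • G (chart s₀ s₁ K 0 p.1))) (l t)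
      (𝓝 (embed (c 0 • G s))) := by
    have hch : Continuous fun p : ℝ × ℝ => chart s₀ s₁ K 0 p.1 := by unfold chart; fun_prop
    have : Continuous fun p : ℝ × ℝ => embed (c 0 • G (chart s₀ s₁ K 0 p.1)) :=
      embed.continuous.comp ((hG.comp hch).const_smul (c 0))
    exact (this.tendsto (t, (0 : ℝ))).mono_left inf_le_left
  have h5 := (h3.sub h4).norm
  rw [sub_self, norm_zero] at h5
  exact eventually_inf_principal.1 (h5.eventually_lt_const hε)

/-- From a branch over `[a, b]` to the family of embedded arcs. The hypothesis `hM` says that the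
branch avoids the neighbourhood of the endpoints over `[s₀ + K d, s₁ - K d]`. -/
theorem IsBranch.exists_embedded_arcs (hf : IsBistable f uM uP) (hw : IsProfile uM uP w)
    (hF : IsFrame f w v Λ) (hB : IsBranch f w v Λ a b dstar x) {s₀ s₁ K δ : ℝ} (h₀ : a < s₀)
    (h₀₁ : s₀ < s₁) (h₁ : s₁ < b) (hK : 0 ≤ K) (hδ : 0 < δ)
    (hfar : ∀ s ∈ Icc s₀ s₁, ∀ e ∈ exceptional uM uP, 2 * δ ≤ dist (embed (curve w s)) e)
    (hM : ∀ s ∈ Icc s₀ s₁, ∀ᶠ p : ℝ × ℝ in 𝓝 (s, 0), 0 < p.2 → s₀ + K * p.2 ≤ p.1 →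
      p.1 ≤ s₁ - K * p.2 → ∀ e ∈ exceptional uM uP, 2 * δ ≤ dist (embed (x p)) e) :
    ∃ (dmax : ℝ) (γ : ℝ → ℝ → Point 6) (g : ℝ → Point 6), 0 < dmax ∧
      IsArcParam g ((fun s => embed (curve w s)) '' Icc s₀ s₁) (corners62 uP) ∧
      (fun s => embed (curve w s)) '' Icc s₀ s₁ ⊆
        Gamma62 uM uP \ Metric.thickening (2 * δ) (exceptional uM uP) ∧
      (∀ d ∈ Ioo 0 dmax, IsSmoothArc (γ d) ∧ IsC1Close δ (γ d) g ∧
        ∀ s ∈ Icc (0 : ℝ) 1, IsSteadyState f 2 d (γ d s) ∧ IsFlipSymmetric (γ d s).fst ∧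
          (γ d s).snd ∈ Icc (0 : ℝ) 1 ∧ γ d s ∈ Metric.thickening δ (Gamma62 uM uP) \
            Metric.thickening (2 * δ) (exceptional uM uP)) ∧
      ContDiffOn ℝ ∞ (fun p : ℝ × ℝ => γ p.1 p.2) (Ioo 0 dmax ×ˢ Icc 0 1) ∧
      ∀ ε : ℝ, 0 < ε → ∀ᶠ d in 𝓝[>] (0 : ℝ), IsC1Close ε (γ d) g := by
  have hIoo : ∀ s ∈ Icc s₀ s₁, s ∈ Ioo a b := fun s hs => ⟨h₀.trans_le hs.1, hs.2.trans_lt h₁⟩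
  have hI4 : ∀ s ∈ Icc s₀ s₁, s ∈ Ioo (0 : ℝ) 4 := fun s hs => hB.mem_Ioo (hIoo s hs)
  set γ : ℝ → ℝ → Point 6 := fun d t => embed (x (chart s₀ s₁ K d t, d)) with hγ
  set g : ℝ → Point 6 := fun t => embed (curve w (chart s₀ s₁ K 0 t)) with hg
  have hch : ∀ d, 0 ≤ d → 2 * K * d < s₁ - s₀ → ∀ t ∈ Icc (0 : ℝ) 1,
      chart s₀ s₁ K d t ∈ Icc s₀ s₁ := by
    intro d hd hlt t ht
    have h1 := chart_mem ht hlt.le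
    have h2 := mul_nonneg hK hd
    exact ⟨by linarith, by linarith⟩
  have hch0 : ∀ t ∈ Icc (0 : ℝ) 1, chart s₀ s₁ K 0 t ∈ Icc s₀ s₁ :=
    hch 0 le_rfl (by linarith)
  have hgd : ∀ t, HasDerivAt g (embed ((s₁ - s₀ - 2 * K * 0) • curve' w (chart s₀ s₁ K 0 t))) t :=
    fun t => hasDerivAt_embed
      ((hw.hasDerivAt_curve _).scomp t (hasDerivAt_chart s₀ s₁ K 0 t))
  have hud : ∀ t ∈ Icc (0 : ℝ) 1, UniqueDiffWithinAt ℝ (Icc (0 : ℝ) 1) t :=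
    uniqueDiffOn_Icc zero_lt_one
  have hγd : ∀ d ∈ Ioo 0 dstar, 2 * K * d < s₁ - s₀ → ∀ t ∈ Icc (0 : ℝ) 1, HasDerivAt (γ d)
      (embed ((s₁ - s₀ - 2 * K * d) • velocity x (chart s₀ s₁ K d t, d))) t := by
    intro d hd hlt t ht
    exact hasDerivAt_embed
      ((hB.hasDerivAt (hIoo _ (hch d hd.1.le hlt t ht)) hd).scomp t
        (hasDerivAt_chart s₀ s₁ K d t))
  -- the conditions for small `d`
  have v1 : ∀ᶠ d in 𝓝[>] (0 : ℝ), d ∈ Ioo 0 dstar := Ioo_mem_nhdsGT hB.pos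
  have v2 : ∀ᶠ d in 𝓝[>] (0 : ℝ), 2 * K * d < s₁ - s₀ := by
    have : Tendsto (fun d : ℝ => 2 * K * d) (𝓝[>] 0) (𝓝 0) :=
      (Continuous.tendsto' (by fun_prop) _ _ (by simp)).mono_left nhdsWithin_le_nhds
    exact this.eventually_lt_const (by linarith)
  have hclose : ∀ ε : ℝ, 0 < ε → ∀ᶠ d in 𝓝[>] (0 : ℝ), IsC1Close ε (γ d) g := by
    intro ε hε
    have c1 := eventually_norm_embed_sub_lt (F := x) (G := curve w) (a := a) (b := b)
      hw.contDiff_curve.continuous (fun s hs ε hε => by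
        have hcont : Tendsto (fun z : (ℝ × ℝ) × Vec => ‖z.2 - curve w z.1.1‖)
            (𝓝 ((s, 0), curve w s)) (𝓝 0) := by
          have h1 : Continuous fun z : (ℝ × ℝ) × Vec => curve w z.1.1 :=
            hw.contDiff_curve.continuous.comp (by fun_prop)
          exact (continuous_snd.sub h1).norm.tendsto' _ _ (by simp)
        exact hB.eventually hw hs (hcont.eventually_lt_const hε))
      h₀ h₀₁ h₁ K (c := fun _ => 1) continuous_const hε
    have c2 := eventually_norm_embed_sub_lt (a := a) (b := b) hw.contDiff_curve'.continuous
      (fun s hs ε hε => hB.eventually_velocity hf hw hF hs hε) h₀ h₀₁ h₁ K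
      (c := fun d => s₁ - s₀ - 2 * K * d) (by fun_prop) hε
    filter_upwards [c1, c2, v1, v2] with d k1 k2 k3 k4 t ht
    rw [((hγd d k3 k4 t ht).hasDerivWithinAt).derivWithin (hud t ht),
      ((hgd t).hasDerivWithinAt).derivWithin (hud t ht)]
    refine ⟨?_, k2 t ht⟩
    have := k1 t ht
    rwa [one_smul, one_smul] at this
  have v3 := hB.eventually_injOn hf hw hF (curve_injOn hf hw) h₀ h₁
  have v4 := hB.eventually_sol hf hw hF h₀ h₁
  have v5 : ∀ᶠ d in 𝓝[>] (0 : ℝ), ∀ s ∈ Icc s₀ s₁, velocity x (s, d) ≠ 0 :=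
    eventually_forall_Icc fun s hs => by
      filter_upwards [hB.eventually_dot_pos hf hw hF (hIoo s hs)] with p hp hd h0
      have := hp hd
      rw [show velocity x p = 0 from h0] at this
      simp [dot] at this
  have v6 : ∀ᶠ d in 𝓝[>] (0 : ℝ), ∀ s ∈ Icc s₀ s₁, s₀ + K * d ≤ s → s ≤ s₁ - K * d →
      ∀ e ∈ exceptional uM uP, 2 * δ ≤ dist (embed (x (s, d))) e :=
    eventually_forall_Icc hM
  obtain ⟨dmax, hdmax, hall⟩ := mem_nhdsGT_iff_exists_Ioo_subset.1
    (v1.and (v2.and (v3.and (v4.and (v5.and (v6.and (hclose δ hδ)))))))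
  have hgΓ : ∀ s ∈ Icc s₀ s₁, embed (curve w s) ∈ Gamma62 uM uP := fun s hs => by
    rw [gamma_eq_image hf hw]
    exact ⟨s, Ioo_subset_Icc_self (hI4 s hs), rfl⟩
  have hsm : ∀ d ∈ Ioo 0 dmax, ∀ t ∈ Icc (0 : ℝ) 1,
      ContDiffAt ℝ ∞ x (chart s₀ s₁ K d t, d) := fun d hd t ht =>
    hB.smooth _ (hIoo _ (hch d hd.1.le (hall hd).2.1 t ht)) d (hall hd).1
  refine ⟨dmax, γ, g, hdmax, ⟨?_, ?_, ?_, ?_⟩, ?_, fun d hd => ?_, ?_, hclose⟩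
  · have h1 : ContDiff ℝ ∞ (chart s₀ s₁ K 0) := by unfold chart; fun_prop
    exact ((contDiff_embed.comp (hw.contDiff_curve.comp h1)).of_le (by simp)).contDiffOn
  · intro t ht t' ht' heq
    refine chart_injective (K := K) (d := 0) (by linarith) (curve_injOn hf hw
      (Ioo_subset_Icc_self (hI4 _ (hch0 t ht))) (Ioo_subset_Icc_self (hI4 _ (hch0 t' ht'))) ?_)
    exact embed_injective heq
  · rw [← chart_image (K := K) h₀₁, image_image]
  · intro t ht hcor
    rw [((hgd t).hasDerivWithinAt).derivWithin (hud t ht)]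
    have hreg : chart s₀ s₁ K 0 t ∈ regularTimes := by
      have h1 := hI4 _ (hch0 t ht)
      have h2 : ¬(chart s₀ s₁ K 0 t = 1 ∨ chart s₀ s₁ K 0 t = 2 ∨ chart s₀ s₁ K 0 t = 3) :=
        fun h => hcor (embed_corner_mem hf hw h)
      push Not at h2
      exact ⟨h1, h2.1, h2.2.1, h2.2.2⟩
    have h3 := curve'_ne_zero hf hw hreg
    intro h0
    have h4 := embed_injective (h0.trans (map_zero embed).symm)
    exact (smul_ne_zero (by linarith : s₁ - s₀ - 2 * K * 0 ≠ 0) h3) h4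
  · rintro _ ⟨s, hs, rfl⟩
    refine ⟨hgΓ s hs, fun hmem => ?_⟩
    obtain ⟨e, he, hlt⟩ := Metric.mem_thickening_iff.1 hmem
    exact (hfar s hs e he).not_gt hlt
  · obtain ⟨k1, k2, k3, k4, k5, k6, k7⟩ := hall hd
    have hchd := hch d hd.1.le k2
    refine ⟨⟨?_, ?_, ?_⟩, k7, fun t ht => ⟨isSteadyState_embed (k4 _ (hchd t ht)).1,
      isFlipSymmetric_embed _, (k4 _ (hchd t ht)).2, ?_, fun hmem => ?_⟩⟩
    · intro t ht
      have h1 : ContDiffAt ℝ ∞ (fun t => (chart s₀ s₁ K d t, d)) t := by unfold chart; fun_prop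
      exact ((contDiff_embed.contDiffAt).comp t ((hsm d hd t ht).comp t h1)).contDiffWithinAt
    · intro t ht t' ht' heq
      exact chart_injective k2 (k3 (hchd t ht) (hchd t' ht') (embed_injective heq))
    · intro t ht
      rw [((hγd d k1 k2 t ht).hasDerivWithinAt).derivWithin (hud t ht)]
      intro h0
      have h4 := embed_injective (h0.trans (map_zero embed).symm)
      exact (smul_ne_zero (by linarith : s₁ - s₀ - 2 * K * d ≠ 0) (k5 _ (hchd t ht))) h4
    · refine Metric.mem_thickening_iff.2 ⟨g t, hgΓ _ (hch0 t ht), ?_⟩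
      rw [dist_eq_norm]
      exact (k7 t ht).1
    · obtain ⟨e, he, hlt⟩ := Metric.mem_thickening_iff.1 hmem
      have h1 := chart_mem ht k2.le
      exact (k6 _ (hchd t ht) h1.1 h1.2 e he).not_gt hlt
  · rintro ⟨d, t⟩ ⟨hd, ht⟩
    have h1 : ContDiffAt ℝ ∞ (fun p : ℝ × ℝ => (chart s₀ s₁ K p.1 p.2, p.1)) (d, t) := by
      unfold chart
      fun_prop
    exact ((contDiff_embed.contDiffAt).comp (d, t)
      (ContDiffAt.comp (d, t) (hsm d hd t ht) h1)).contDiffWithinAt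

end Conclusion

/-! ### Distances to the endpoints of Γ -/

section Levels

variable {f : ℝ → ℝ → ℝ} {uM uP w : ℝ → ℝ} {v : ℝ → Vec} {Λ a b dstar : ℝ} {x : ℝ × ℝ → Vec}

/-- Small levels of a function that increases away from its zero at `0`. -/
theorem exists_level {q : ℝ → ℝ} (hq : Continuous q) (h0 : q 0 = 0) {η L : ℝ}
    (hpos : ∀ s ∈ Ioc 0 L, 0 < q s) (hη : 0 < η) (hηL : η ≤ L)
    (hder : ∀ s ∈ Ioo 0 η, ∃ D, 0 < D ∧ HasDerivAt q D s) :
    ∃ m, 0 < m ∧ ∀ r ∈ Ioo 0 m, ∃ s₀ ∈ Ioo 0 η, q s₀ = r ∧ (∀ s ∈ Ico 0 s₀, q s < r) ∧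
      ∀ s ∈ Ioc s₀ L, r < q s := by
  have hmono : StrictMonoOn q (Icc 0 η) := by
    refine strictMonoOn_of_deriv_pos (convex_Icc 0 η) hq.continuousOn fun s hs => ?_
    rw [interior_Icc] at hs
    obtain ⟨D, hD, h⟩ := hder s hs
    rwa [h.deriv]
  -- A level below the minimum over [η, L] is attained only on the monotone stretch, hence exactly
  -- once.
  obtain ⟨c, hc, hmin⟩ := isCompact_Icc.exists_isMinOn (nonempty_Icc.2 hηL) hq.continuousOn
  refine ⟨q c, hpos c ⟨hη.trans_le hc.1, hc.2⟩, fun r hr => ?_⟩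
  have hrη : r < q η := hr.2.trans_le (hmin (left_mem_Icc.2 hηL))
  have hiv := intermediate_value_Icc hη.le hq.continuousOn
  rw [h0] at hiv
  obtain ⟨s₀, hs₀, rfl⟩ := hiv ⟨hr.1.le, hrη.le⟩
  have hl : 0 < s₀ := by
    refine lt_of_le_of_ne hs₀.1 fun h => ?_
    rw [← h, h0] at hr
    exact lt_irrefl _ hr.1
  have hu : s₀ < η := lt_of_le_of_ne hs₀.2 fun h => by
    rw [h] at hrη
    exact lt_irrefl _ hrη
  refine ⟨s₀, ⟨hl, hu⟩, rfl, fun s hs => hmono ⟨hs.1, hs.2.le.trans hs₀.2⟩ hs₀ hs.2,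
    fun s hs => ?_⟩
  rcases le_total s η with h | h
  · exact hmono hs₀ ⟨hl.le.trans hs.1.le, h⟩ hs.1
  · exact hr.2.trans_le (hmin ⟨h, hs.2⟩)

theorem dist_embed_eq (y z : Vec) : dist (embed y) (embed z) =
    √((y.1 - z.1) ^ 2 + 4 * (y.2.1 - z.2.1) ^ 2 + (y.2.2.1 - z.2.2.1) ^ 2 +
      (y.2.2.2 - z.2.2.2) ^ 2) := by
  have h := norm_sq_embed (y - z)
  rw [map_sub, ← dist_eq_norm] at h
  rw [eq_comm, Real.sqrt_eq_iff_eq_sq (by positivity) dist_nonneg, h]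
  rfl

/-- The distance to the left endpoint increases near it. -/
theorem exists_deriv_dist_left (hf : IsBistable f uM uP) (hw : IsProfile uM uP w) :
    ∃ η ∈ Ioc (0 : ℝ) (1 / 2), ∀ s ∈ Ioo 0 η, ∃ D, 0 < D ∧
      HasDerivAt (fun s => dist (embed (curve w s)) (embed (curve w 0))) D s := by
  have hc : Tendsto (fun s => -1 + 2 * clock 0 s) (𝓝 0) (𝓝 (-1)) := by
    have := (((contDiff_clock 0).continuous.const_mul 2).const_add (-1)).tendsto 0
    simpa [clock_eq_zero] using this
  obtain ⟨r, hr, hball⟩ :=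
    Metric.eventually_nhds_iff.1 (hc.eventually hw.eventually_deriv_pitchfork)
  refine ⟨min r (1 / 2), ⟨by positivity, min_le_right _ _⟩, fun s hs => ?_⟩
  have hsr : s < r := hs.2.trans_le (min_le_left _ _)
  have hs2 : s < foldTime := hs.2.trans_le (min_le_right _ _)
  have hs1 : s < 1 := by norm_num [foldTime] at hs2; linarith
  have hd := hball (y := s) (by rwa [Real.dist_eq, sub_zero, abs_of_pos hs.1])
  have hk : HasDerivAt (fun s => -1 + 2 * clock 0 s) (2 * clock' 0 s) s :=
    ((hasDerivAt_clock 0 s).const_mul 2).const_add _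
  have hk' := clock'_pos hs.1 (show s < 0 + 1 by linarith)
  have hneg := arg_foldTime_lt hs.1.le hs2
  have hgt : -1 < -1 + 2 * clock 0 s := by linarith [clock_pos hs.1]
  have dw := hw.hasDerivAt_comp hk (arg₀_mem s)
  have dp : HasDerivAt (fun s => par (-1 + 2 * clock 0 s)) _ s := (hasDerivAt_par _).comp s hk
  -- Near this endpoint the squared distance is w² + par², and both terms increase.
  have hN := (dw.pow 2).add (dp.pow 2)
  have hwp := hw.pos hf (σ := -1 + 2 * clock 0 s) ⟨hgt, (arg₀_mem s).2⟩
  set σ := -1 + 2 * clock 0 s with hσ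
  have hpp : 0 < par σ := (par_mem_Ioo hneg.ne (by nlinarith)).1
  have hpd : 0 < -4 * σ * (1 - σ ^ 2) := mul_pos (by linarith) (by nlinarith)
  -- Near the pitchfork w moves faster than `par`, whose derivative is positive between -1 and 0.
  have hwd : 0 < deriv w σ := by linarith
  have hNpos : 0 < w σ ^ 2 + par σ ^ 2 := by positivity
  have h5 := hN.sqrt hNpos.ne'
  refine ⟨_, ?_, h5.congr_of_eventuallyEq ?_⟩
  · refine div_pos ?_ (mul_pos two_pos (Real.sqrt_pos.2 hNpos))
    have h1 := mul_pos hwd (mul_pos two_pos hk')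
    have h2 := mul_pos hpd (mul_pos two_pos hk')
    simp only [Nat.cast_ofNat, Nat.add_one_sub_one, pow_one]
    exact add_pos (mul_pos (by positivity) h1) (mul_pos (by positivity) h2)
  · filter_upwards [Iio_mem_nhds hs1] with t ht
    rw [dist_embed_eq, curve_zero hf hw, curve_of_le_one hf hw (le_of_lt ht)]
    simp

/-- The distance to the right endpoint decreases near it. -/
theorem exists_deriv_dist_right (hf : IsBistable f uM uP) (hw : IsProfile uM uP w) :
    ∃ η ∈ Ioc (0 : ℝ) (1 / 2), ∀ s ∈ Ioo (4 - η) 4, ∃ D, D < 0 ∧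
      HasDerivAt (fun s => dist (embed (curve w s)) (embed (curve w 4))) D s := by
  have hc : Tendsto (fun s => 1 - clock 3 s) (𝓝 4) (𝓝 0) := by
    have h : Tendsto (fun s => 1 - clock 3 s) (𝓝 4) (𝓝 (1 - clock 3 4)) :=
      (continuous_const.sub (contDiff_clock 3).continuous).tendsto 4
    rwa [clock_eq_one (by norm_num), sub_self] at h
  obtain ⟨ρ, hρ, hw'⟩ := Metric.eventually_nhds_iff.1 hw.eventually_deriv_fold
  obtain ⟨r, hr, hball⟩ := Metric.eventually_nhds_iff.1
    (hc.eventually (Metric.ball_mem_nhds 0 (lt_min hρ (one_half_pos (α := ℝ)))))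
  refine ⟨min r (1 / 2), ⟨by positivity, min_le_right _ _⟩, fun s hs => ?_⟩
  have hsr : 4 - s < r := by linarith [hs.1, min_le_left r (1 / 2)]
  have hs3 : 3 < s := by linarith [hs.1, min_le_right r (1 / 2)]
  have hd := hball (y := s) (by rwa [Real.dist_eq, abs_sub_comm, abs_of_pos (by linarith [hs.2])])
  have hτ1 := clock_lt_one (show s < 3 + 1 by linarith [hs.2])
  have hk' := clock'_pos hs3 (show s < 3 + 1 by linarith [hs.2])
  rw [Real.dist_eq, sub_zero, abs_of_pos (by linarith), lt_min_iff] at hd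
  have dr := hw.hasDerivAt_comp ((hasDerivAt_clock 3 s).const_sub 1) (one_sub_clock_mem 3 s)
  have hk3 : HasDerivAt (fun s => -1 + clock 3 s) (clock' 3 s) s :=
    (hasDerivAt_clock 3 s).const_add _
  have dl := hw.hasDerivAt_comp hk3 (arg₃_mem s)
  have dp : HasDerivAt (fun s => par (-1 + clock 3 s)) _ s := (hasDerivAt_par _).comp s hk3
  -- The weight 5 counts nodes 1, 2, 3, 5, 6, which share the value u₊. These entries decrease to 1
  -- while u₄ and μ increase to 1, so each square decreases.
  have hN := (((dr.sub_const 1).pow 2).const_mul 5).add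
    (((dl.sub_const 1).pow 2).add ((dp.sub_const 1).pow 2))
  set τ := clock 3 s with hτ
  have hmono : StrictMonoOn w (Icc (-(1 - τ)) (1 - τ)) := by
    refine strictMonoOn_of_deriv_pos (convex_Icc _ _) (fun σ hσ => ?_) fun σ hσ => ?_
    · exact (hw.smooth σ ⟨by linarith [hσ.1, hd.2], by linarith [hσ.2, hd.2]⟩).continuousAt
        |>.continuousWithinAt
    · rw [interior_Icc] at hσ
      refine hw' ?_
      rw [Real.dist_eq, sub_zero, abs_lt]
      exact ⟨by linarith [hσ.1, hd.1], by linarith [hσ.2, hd.1]⟩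
  have hz : (0 : ℝ) ∈ Icc (-(1 - τ)) (1 - τ) := ⟨by linarith, by linarith⟩
  have h1 : 1 < w (1 - τ) :=
    (hw.at_zero hf).symm.trans_lt (hmono hz ⟨by linarith, le_rfl⟩ (by linarith))
  have h2 : w (-1 + τ) < 1 :=
    (hmono ⟨by linarith, by linarith⟩ hz (by linarith)).trans_eq (hw.at_zero hf)
  have d1 : 0 < deriv w (1 - τ) := hw' (by
    rw [Real.dist_eq, sub_zero, abs_lt]
    exact ⟨by linarith [hd.1], hd.1⟩)
  have d2 : 0 < deriv w (-1 + τ) := hw' (by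
    rw [Real.dist_eq, sub_zero, abs_lt]
    exact ⟨by linarith [hd.1], by linarith [hd.1]⟩)
  have h3 : par (-1 + τ) < 1 := (par_mem_Ioo (by linarith) (by nlinarith)).2
  have d3 : 0 < -4 * (-1 + τ) * (1 - (-1 + τ) ^ 2) := mul_pos (by linarith) (by nlinarith)
  have hNpos : 0 < 5 * (w (1 - τ) - 1) ^ 2 + ((w (-1 + τ) - 1) ^ 2 + (par (-1 + τ) - 1) ^ 2) := by
    have : 0 < w (1 - τ) - 1 := by linarith
    positivity
  have h5 := hN.sqrt hNpos.ne'
  refine ⟨_, ?_, h5.congr_of_eventuallyEq ?_⟩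
  · refine div_neg_of_neg_of_pos ?_ (mul_pos two_pos (Real.sqrt_pos.2 hNpos))
    simp only [Nat.cast_ofNat, Nat.add_one_sub_one, pow_one]
    have e1 := mul_pos (sub_pos.2 h1) (mul_pos d1 hk')
    have e2 := mul_pos (sub_pos.2 h2) (mul_pos d2 hk')
    have e3 := mul_pos (sub_pos.2 h3) (mul_pos d3 hk')
    linarith
  · filter_upwards [Ioi_mem_nhds hs3] with t ht
    rw [dist_embed_eq, curve_four hf hw, curve_of_three_le (le_of_lt ht)]
    congr 1
    simp only [Pi.add_apply, Pi.pow_apply]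
    ring

theorem continuous_dist_curve (hw : IsProfile uM uP w) (e : Point 6) :
    Continuous fun s => dist (embed (curve w s)) e :=
  (embed.continuous.comp hw.contDiff_curve.continuous).dist continuous_const

theorem IsBranch.eventually_le_dist (hw : IsProfile uM uP w)
    (hB : IsBranch f w v Λ a b dstar x) {s r : ℝ} (hs : s ∈ Ioo a b) {e : Point 6}
    (h : r < dist (embed (curve w s)) e) :
    ∀ᶠ p : ℝ × ℝ in 𝓝 (s, 0), 0 < p.2 → r ≤ dist (embed (x p)) e := by
  have hcont : Continuous fun z : (ℝ × ℝ) × Vec => dist (embed z.2) e :=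
    (embed.continuous.comp continuous_snd).dist continuous_const
  have t := hcont.tendsto ((s, 0), curve w s)
  exact (hB.eventually hw hs (t.eventually_const_lt h)).mono fun p hp hd => (hp hd).le

/-- Where the distance of the curve to `e` changes at a nonzero rate, the branch is at least as
far from `e` after moving by a multiple of `d`. -/
theorem IsBranch.exists_margin (hf : IsBistable f uM uP) (hw : IsProfile uM uP w)
    (hF : IsFrame f w v Λ) (hB : IsBranch f w v Λ a b dstar x) {s D : ℝ} (hs : s ∈ regularTimes)
    (hsI : s ∈ Ioo a b) {e : Point 6}
    (hD : HasDerivAt (fun s => dist (embed (curve w s)) e) D s) (hD0 : D ≠ 0) :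
    ∃ K : ℝ, 0 ≤ K ∧ ∀ᶠ p : ℝ × ℝ in 𝓝 (s, 0), 0 < p.2 → K * p.2 ≤ D * (p.1 - s) →
      dist (embed (curve w s)) e ≤ dist (embed (x p)) e := by
  obtain ⟨K, hK, hev⟩ := hB.exists_linear_bound hf hw hF hs hsI
  have hlin := (hasDerivAt_iff_isLittleO.1 hD).def (c := |D| / 2) (by positivity)
  have t1 : Tendsto (fun p : ℝ × ℝ => p.1) (𝓝 (s, 0)) (𝓝 s) :=
    Continuous.tendsto' (by fun_prop) _ _ rfl
  -- The first-order expansion loses at most half of D (p.1 - s). The other half compensates for the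
  -- deviation ‖embed‖ K d of the branch from the curve.
  refine ⟨2 * (‖embed‖ * K), by positivity, ?_⟩
  filter_upwards [hev, t1.eventually hlin] with p k1 k2 hd hle
  have k1 := k1 hd
  have h1 : dist (embed (x p)) (embed (curve w p.1)) ≤ ‖embed‖ * K * p.2 := by
    rw [dist_eq_norm, ← map_sub, mul_assoc]
    exact (embed.le_opNorm _).trans (by gcongr)
  have h2 := dist_triangle (embed (curve w p.1)) (embed (x p)) e
  rw [dist_comm (embed (curve w p.1)) (embed (x p))] at h2
  simp only [smul_eq_mul, Real.norm_eq_abs] at k2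
  have h3 := (abs_le.1 k2).1
  have h4 : |D| / 2 * |p.1 - s| = D * (p.1 - s) / 2 := by
    have h5 : 0 ≤ D * (p.1 - s) := le_trans (by positivity) hle
    rw [div_mul_eq_mul_div, ← abs_mul, abs_of_nonneg h5]
  linarith

end Levels

end RingLattice

end

/-! ### The theorem: small and large δ -/

theorem theorem2 (f : ℝ → ℝ → ℝ) (uM uP : ℝ → ℝ) (hf : RingLattice.IsBistable f uM uP) :
    ∃ δ₀ : ℝ, 0 < δ₀ ∧ ∀ δ : ℝ, 0 < δ →
      -- some point of the curve lies farther than `2 δ` from its endpoints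
      (∃ p ∈ RingLattice.Gamma62 uM uP,
        p ∉ Metric.cthickening (2 * δ) (RingLattice.exceptional uM uP)) →
      ∃ (dstar : ℝ) (γ : ℝ → ℝ → RingLattice.Point 6) (g : ℝ → RingLattice.Point 6)
        (A : Set (RingLattice.Point 6)),
        0 < dstar ∧
        -- `g` runs once through an arc `A` of the curve outside the neighbourhood of the endpoints
        RingLattice.IsArcParam g A (RingLattice.corners62 uP) ∧
        A ⊆ RingLattice.Gamma62 uM uP \
          Metric.thickening (2 * δ) (RingLattice.exceptional uM uP) ∧
        -- for small `δ` this arc is everything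
        (δ < δ₀ → A = RingLattice.Gamma62 uM uP \
          Metric.thickening (2 * δ) (RingLattice.exceptional uM uP)) ∧
        -- for each `d`, a smooth branch of symmetric steady states, `C^1`-close to the curve
        (∀ d ∈ Set.Ioo 0 dstar,
          RingLattice.IsSmoothArc (γ d) ∧
          RingLattice.IsC1Close δ (γ d) g ∧
          ∀ s ∈ Set.Icc (0 : ℝ) 1,
            RingLattice.IsSteadyState f 2 d (γ d s) ∧
            RingLattice.IsFlipSymmetric (γ d s).fst ∧
            (γ d s).snd ∈ Set.Icc (0 : ℝ) 1 ∧
            γ d s ∈ Metric.thickening δ (RingLattice.Gamma62 uM uP) \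
              Metric.thickening (2 * δ) (RingLattice.exceptional uM uP)) ∧
        -- smooth dependence on `d`
        ContDiffOn ℝ ∞ (fun p : ℝ × ℝ => γ p.1 p.2) (Set.Ioo 0 dstar ×ˢ Set.Icc 0 1) ∧
        -- convergence to the curve as `d → 0⁺`
        ∀ ε : ℝ, 0 < ε → ∀ᶠ d in 𝓝[>] (0 : ℝ), RingLattice.IsC1Close ε (γ d) g := by
  open RingLattice in
  obtain ⟨w, w1, w2, w3, w4, w5⟩ := hf.exists_profile
  have hw : IsProfile uM uP w := ⟨w1, w2, w3, w4, w5⟩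
  obtain ⟨v, Λ, hF⟩ := exists_frame hf hw
  have hE := exceptional_eq hf hw
  have hinj : ∀ s ∈ Icc (0 : ℝ) 4, ∀ t ∈ Icc (0 : ℝ) 4, s ≠ t →
      0 < dist (embed (curve w s)) (embed (curve w t)) := fun s hs t ht hne =>
    dist_pos.2 fun h => hne (curve_injOn hf hw hs ht (embed_injective h))
  have hbranch : ∀ s₀ s₁ : ℝ, 0 < s₀ → s₀ < s₁ → s₁ < 4 →
      ∃ a b dstar x, a < s₀ ∧ s₁ < b ∧ IsBranch f w v Λ a b dstar x := by
    intro s₀ s₁ h₀ h₀₁ h₁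
    -- The branch starts before the first corner, which makes the starting time regular wherever s₀
    -- lies.
    have hm : min s₀ (1 / 2) / 2 < s₀ := by linarith [min_le_left s₀ (1 / 2)]
    have hm0 : 0 < min s₀ (1 / 2) / 2 := by positivity
    have hm1 : min s₀ (1 / 2) / 2 < 1 := by linarith [min_le_right s₀ (1 / 2)]
    obtain ⟨dstar, x, hB⟩ := hF.exists_branch hf hw (a := min s₀ (1 / 2) / 2) (b := (s₁ + 4) / 2)
      ⟨⟨hm0, by linarith⟩, by linarith, by linarith, by linarith⟩ (by linarith) (by linarith)
    exact ⟨_, _, dstar, x, hm, by linarith, hB⟩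
  obtain ⟨η₀, hη₀, hder₀⟩ := exists_deriv_dist_left hf hw
  obtain ⟨η₁, hη₁, hder₁⟩ := exists_deriv_dist_right hf hw
  have hc₀ := continuous_dist_curve hw (embed (curve w 0))
  have hc₁ := continuous_dist_curve hw (embed (curve w 4))
  obtain ⟨m₀, hm₀, hlev₀⟩ := exists_level (L := 4) hc₀ (dist_self _)
    (fun s hs => hinj s (Ioc_subset_Icc_self hs) 0 (by simp) hs.1.ne') hη₀.1
    (by linarith [hη₀.2]) hder₀
  obtain ⟨m₁, hm₁, hlev₁⟩ := exists_level (L := 4)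
    (q := fun s => dist (embed (curve w (4 - s))) (embed (curve w 4)))
    (hc₁.comp (continuous_const.sub continuous_id)) (by simp)
    (fun s hs => hinj (4 - s) ⟨by linarith [hs.2], by linarith [hs.1]⟩ 4 (by simp)
      (by linarith [hs.1])) hη₁.1 (by linarith [hη₁.2]) (fun s hs => by
        obtain ⟨D, hD, h⟩ := hder₁ (4 - s) ⟨by linarith [hs.2], by linarith [hs.1]⟩
        exact ⟨-D, by linarith, (h.comp s ((hasDerivAt_id s).const_sub 4)).congr_deriv (by simp)⟩)
  -- Below this bound 2δ is a level that each of the two distances attains exactly once on the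
  -- curve, close to the respective endpoint.
  refine ⟨min m₀ m₁ / 2, by positivity, fun δ hδ hp => ?_⟩
  by_cases hsmall : δ < min m₀ m₁ / 2
  · obtain ⟨s₀, hs₀, e₀, l₀, u₀⟩ := hlev₀ (2 * δ)
      ⟨by linarith, by linarith [min_le_left m₀ m₁]⟩
    obtain ⟨t₁, ht₁, e₁, l₁, u₁⟩ := hlev₁ (2 * δ)
      ⟨by linarith, by linarith [min_le_right m₀ m₁]⟩
    have u₁' : ∀ s ∈ Ico (0 : ℝ) (4 - t₁),
        2 * δ < dist (embed (curve w s)) (embed (curve w 4)) := fun s hs => by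
      have := u₁ (4 - s) ⟨by linarith [hs.2], by linarith [hs.1]⟩
      simpa using this
    have l₁' : ∀ s ∈ Ioc (4 - t₁) (4 : ℝ),
        dist (embed (curve w s)) (embed (curve w 4)) < 2 * δ := fun s hs => by
      have := l₁ (4 - s) ⟨by linarith [hs.2], by linarith [hs.1]⟩
      simpa using this
    set s₁ := 4 - t₁ with hs₁
    have b0 : s₀ < 1 / 2 := hs₀.2.trans_le hη₀.2
    have b1 : 4 - 1 / 2 < s₁ := by linarith [ht₁.2, hη₁.2]
    have b2 : s₁ < 4 := by linarith [ht₁.1]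
    have h₀₁ : s₀ < s₁ := by linarith
    obtain ⟨a, b, dstar, x, ha, hb, hB⟩ := hbranch s₀ s₁ hs₀.1 h₀₁ b2
    obtain ⟨D₀, hD₀, hd₀⟩ := hder₀ s₀ hs₀
    obtain ⟨D₁, hD₁, hd₁⟩ := hder₁ s₁ ⟨by linarith [ht₁.2], b2⟩
    obtain ⟨K₀, hK₀, hev₀⟩ := hB.exists_margin hf hw hF (s := s₀)
      ⟨⟨hs₀.1, by linarith⟩, by linarith, by linarith, by linarith⟩ ⟨ha, by linarith⟩ hd₀ hD₀.ne'
    obtain ⟨K₁, hK₁, hev₁⟩ := hB.exists_margin hf hw hF (s := s₁)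
      ⟨⟨by linarith, b2⟩, by linarith, by linarith, by linarith⟩ ⟨by linarith, hb⟩ hd₁ hD₁.ne
    rw [e₀] at hev₀
    rw [e₁] at hev₁
    have hD₁' : 0 < -D₁ := by linarith
    have hge₀ : ∀ s ∈ Icc s₀ s₁, 2 * δ ≤ dist (embed (curve w s)) (embed (curve w 0)) := by
      intro s hs
      rcases eq_or_lt_of_le hs.1 with rfl | h
      · exact e₀.ge
      · exact (u₀ s ⟨h, by linarith [hs.2]⟩).le
    have hge₁ : ∀ s ∈ Icc s₀ s₁, 2 * δ ≤ dist (embed (curve w s)) (embed (curve w 4)) := by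
      intro s hs
      rcases eq_or_lt_of_le hs.2 with h | h
      · rw [h]; exact e₁.ge
      · exact (u₁' s ⟨by linarith [hs.1, hs₀.1], h⟩).le
    obtain ⟨dmax, γ, g, k1, k2, k3, k4, k5, k6⟩ := hB.exists_embedded_arcs hf hw hF
      -- The sum covers the margins at both ends: a shift by (Kᵢ / |Dᵢ|) d lets the distance to that
      -- endpoint grow enough to absorb the O(d) deviation.
      (K := K₀ / D₀ + K₁ / -D₁) (δ := δ) ha h₀₁ hb (by positivity) hδ
      (fun s hs e he => by
        rw [hE] at he
        rcases he with rfl | rfl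
        · exact hge₀ s hs
        · exact hge₁ s hs)
      (fun s hs => by
        have hsI : s ∈ Ioo a b := ⟨ha.trans_le hs.1, hs.2.trans_lt hb⟩
        have r₀ : ∀ᶠ p : ℝ × ℝ in 𝓝 (s, 0), 0 < p.2 → s₀ + (K₀ / D₀ + K₁ / -D₁) * p.2 ≤ p.1 →
            2 * δ ≤ dist (embed (x p)) (embed (curve w 0)) := by
          rcases eq_or_lt_of_le hs.1 with rfl | h
          · filter_upwards [hev₀] with p hp hd hle
            refine hp hd ?_
            have h1 : K₀ * p.2 = D₀ * (K₀ / D₀ * p.2) := by field_simp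
            rw [h1]
            refine mul_le_mul_of_nonneg_left ?_ hD₀.le
            have : 0 ≤ K₁ / -D₁ * p.2 := by positivity
            linarith
          · exact (hB.eventually_le_dist hw hsI (u₀ s ⟨h, by linarith [hs.2]⟩)).mono
              fun p hp hd _ => hp hd
        have r₁ : ∀ᶠ p : ℝ × ℝ in 𝓝 (s, 0), 0 < p.2 → p.1 ≤ s₁ - (K₀ / D₀ + K₁ / -D₁) * p.2 →
            2 * δ ≤ dist (embed (x p)) (embed (curve w 4)) := by
          rcases eq_or_lt_of_le hs.2 with h | h
          · rw [h]
            filter_upwards [hev₁] with p hp hd hle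
            refine hp hd ?_
            have h1 : K₁ * p.2 = -D₁ * (K₁ / -D₁ * p.2) := by
              rw [← mul_assoc, mul_div_cancel₀ K₁ hD₁'.ne']
            have h2 : D₁ * (p.1 - s₁) = -D₁ * (s₁ - p.1) := by ring
            rw [h1, h2]
            refine mul_le_mul_of_nonneg_left ?_ hD₁'.le
            have : 0 ≤ K₀ / D₀ * p.2 := by positivity
            linarith
          · exact (hB.eventually_le_dist hw hsI (u₁' s ⟨by linarith [hs.1, hs₀.1], h⟩)).mono
              fun p hp hd _ => hp hd
        filter_upwards [r₀, r₁] with p q₀ q₁ hd hl hu e he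
        rw [hE] at he
        rcases he with rfl | rfl
        · exact q₀ hd hl
        · exact q₁ hd hu)
    refine ⟨dmax, γ, g, _, k1, k2, k3, fun _ => ?_, k4, k5, k6⟩
    -- Points of the curve before s₀ or after s₁ lie strictly within 2δ of an endpoint.
    refine k3.antisymm ?_
    rintro p ⟨hpΓ, hpE⟩
    rw [gamma_eq_image hf hw] at hpΓ
    obtain ⟨s, hs, rfl⟩ := hpΓ
    refine ⟨s, ⟨?_, ?_⟩, rfl⟩
    · by_contra hlt
      exact hpE (Metric.mem_thickening_iff.2 ⟨_, by rw [hE]; exact Or.inl rfl,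
        l₀ s ⟨hs.1, not_le.1 hlt⟩⟩)
    · by_contra hlt
      exact hpE (Metric.mem_thickening_iff.2 ⟨_, by rw [hE]; exact Or.inr rfl,
        l₁' s ⟨not_le.1 hlt, hs.2⟩⟩)
  -- For large δ only some arc is required. A short one around a point strictly farther than 2δ
  -- works, and strictness makes K = 0 sufficient.
  · obtain ⟨p, hpΓ, hpE⟩ := hp
    rw [gamma_eq_image hf hw] at hpΓ
    obtain ⟨s, hs, rfl⟩ := hpΓ
    have hfar : ∀ e ∈ exceptional uM uP, 2 * δ < dist (embed (curve w s)) e := by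
      intro e he
      by_contra hle
      exact hpE (Metric.mem_cthickening_of_dist_le _ _ _ _ he (not_lt.1 hle))
    rw [hE] at hfar
    have f₀ := hfar _ (Or.inl rfl)
    have f₁ := hfar _ (Or.inr rfl)
    have hs0 : 0 < s := by
      refine lt_of_le_of_ne hs.1 fun h => ?_
      rw [← h, dist_self] at f₀
      linarith
    have hs4 : s < 4 := by
      refine lt_of_le_of_ne hs.2 fun h => ?_
      rw [h, dist_self] at f₁
      linarith
    obtain ⟨r, hr, hball⟩ := Metric.eventually_nhds_iff.1
      ((hc₀.continuousAt.eventually_const_lt f₀).and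
        ((hc₁.continuousAt.eventually_const_lt f₁).and (Ioo_mem_nhds hs0 hs4)))
    have hin : ∀ t ∈ Icc (s - r / 2) (s + r / 2), dist t s < r := fun t ht => by
      rw [Real.dist_eq, abs_lt]
      exact ⟨by linarith [ht.1], by linarith [ht.2]⟩
    have hl := (hball (hin (s - r / 2) ⟨le_rfl, by linarith⟩)).2.2
    have hu := (hball (hin (s + r / 2) ⟨by linarith, le_rfl⟩)).2.2
    obtain ⟨a, b, dstar, x, ha, hb, hB⟩ := hbranch _ _ hl.1 (by linarith) hu.2
    obtain ⟨dmax, γ, g, k1, k2, k3, k4, k5, k6⟩ := hB.exists_embedded_arcs hf hw hF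
      (K := 0) (δ := δ) ha (by linarith) hb le_rfl hδ
      (fun t ht e he => by
        rw [hE] at he
        rcases he with rfl | rfl
        · exact (hball (hin t ht)).1.le
        · exact (hball (hin t ht)).2.1.le)
      (fun t ht => by
        have htI : t ∈ Ioo a b := ⟨ha.trans_le ht.1, ht.2.trans_lt hb⟩
        filter_upwards [hB.eventually_le_dist hw htI (hball (hin t ht)).1,
          hB.eventually_le_dist hw htI (hball (hin t ht)).2.1] with p q₀ q₁ hd _ _ e he
        rw [hE] at he
        rcases he with rfl | rfl
        · exact q₀ hd
        · exact q₁ hd)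
    exact ⟨dmax, γ, g, _, k1, k2, k3, fun h => (hsmall h).elim, k4, k5, k6⟩
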